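/- **Conventions.** Let $\mathbb S=\{J\in\mathbb H: J^2=-1\}$ and $n\in\mathbb N$. For $K=\{k_1<\dots<k_p\}\subseteq\{1,\dots,n\}$ and $q\in\mathbb H^n$ put $q_K:=q_{k_1}\cdots q_{k_p}$ ($q_\emptyset:=1$). Let $D\subseteq\mathbb C^n$ be invariant under the conjugation $z\mapsto\bar z^h$ of each single variable $z_h$, and let $\Omega_D=\{(\alpha_i+J_i\beta_i)_i : (\alpha_i+i\beta_i)_i\in D,\ J_i\in\mathbb S\}$ be its circularization. A stem function $F=\sum_K e_KF_K$ on $D$ has components $F_K:D\to\mathbb H$, $K\subseteq\{1,\dots,n\}$, with $F_K(\bar z^h)=(-1)^{|K\cap\{h\}|}F_K(z)$; it induces the slice function $\mathcal I(F):\Omega_D\to\mathbb H$, $(\alpha_i+J_i\beta_i)_i\mapsto\sum_KJ_K\,F_K(\alpha+i\beta)$, and is determined by it. $\mathcal S(\Omega_D)$ is the set of slice functions. The slice product is $\mathcal I(F)\odot\mathcal I(G)=\mathcal I(F\otimes G)$ with $F\otimes G=\sum_{K,L}(-1)^{|K\cap L|}e_{K\triangle L}F_KG_L$. A slice function is slice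 preserving if the $F_K$ are real valued. For $D$ open it is slice regular if $F$ is $C^1$ and, for all $h$ and all $K\not\ni h$, $\partial_{\alpha_h}F_K=\partial_{\beta_h}F_{K\cup\{h\}}$ and $\partial_{\beta_h}F_K=-\partial_{\alpha_h}F_{K\cup\{h\}}$. A slice function is slice (resp. slice regular) w.r.t. $x_h$ if each of its restrictions to the variable $x_h$, the other variables being fixed, is a slice (resp. slice regular) function of one variable, and circular w.r.t. $x_h$ if each such restriction is constant on every sphere $\{\alpha+J\beta: J\in\mathbb S\}$ contained in its domain. For $H\subseteq\{1,\dots,n\}$ let $D_H=\{z\in D:\operatorname{Im}z_h\ne0\ \forall h\in H\}$, so that $\Omega_{D_H}$ is $\Omega_D$ without the points having a real $h$-th coordinate for some $h\in H$. The spherical derivative of $f=\mathcal I(F)\in\mathcal S(\Omega_D)$ is $f'_{s,H}=\mathcal I\big(\prod_{h\in H}\beta_h^{-1}\sum_{K\subseteq H^c}e_KF_{K\cup H}\big)\in\mathcal S(\Omega_{D_H})$, where $\beta_h=\operatorname{Im} z_h$. For $K\subseteq H$ put $\mathcal S^H_K(f):=(x_K\odot f)'_{s,H}\in\mathcal S(\Omega_{D_H})$,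 and $\mathcal S^n_K:=\mathcal S^{\{1,\dots,n\}}_K$. **Theorem.** Let $f\in\mathcal S(\Omega_D)$. 1. For every $H\subseteq\{1,\dots,n\}$, on $\Omega_{D_H}$, $$f(x)=\sum_{K\subseteq H}(-1)^{|H\setminus K|}\,(\bar x)_{H\setminus K}\odot\mathcal S^H_K(f)(x).$$ 2. For all $K\subseteq H$, $\mathcal S^H_K(f)$ is, on $\Omega_{D_H}$, circular w.r.t. every $x_h$ with $h\in H$ and, if $H\neq\{1,\dots,n\}$, slice w.r.t. $x_p$, where $p=\min H^c$. 3. If $D$ is open and $f$ is slice regular, then for all $K\subseteq H$ the function $\mathcal S^H_K(f)$ extends to a continuous function on $\Omega_D$. The extension is a slice function on $\Omega_D$, it is circular w.r.t. every $x_h$ with $h\in H$, slice w.r.t. $x_p$ if $H\neq\{1,\dots,n\}$ and $p=\min H^c$, and harmonic in $x_h\in\mathbb H=\mathbb R^4$ for every $h\in H$. With these extensions, the decomposition in 1 holds on all of $\Omega_D$. 4. If $D$ is open, then $f$ is slice regular if and only if, for all $K\subseteq H\subsetneq\{1,\dots,n\}$ and $p=\min H^c$, $\mathcal S^H_K(f)$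 is the restriction to $\Omega_{D_H}$ of a slice function on $\Omega_D$ that is slice regular w.r.t. $x_p$ and, if $H\ne\emptyset$, continuous on $\Omega_D$. (For $H=\emptyset$ this function is $f$ itself, for $H\neq\emptyset$ it is the unique continuous extension of $\mathcal S^H_K(f)$.) 5. The restriction of $f$ to $\Omega_{D_{\{1,\dots,n\}}}$ is slice preserving if and only if $\mathcal S^n_K(f)$ is real valued on $\Omega_{D_{\{1,\dots,n\}}}$ for every $K\subseteq\{1,\dots,n\}$. If, moreover, $f$ is continuous on $\Omega_D$ and $D_{\{1,\dots,n\}}$ is dense in $D$ (for instance, if $D$ is open), then $f$ is slice preserving on $\Omega_D$ if and only if $\mathcal S^n_K(f)$ is real valued on $\Omega_{D_{\{1,\dots,n\}}}$ for every $K\subseteq\{1,\dots,n\}$. -/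

import Mathlib

open scoped Quaternion

namespace SliceAnalysis

/-- The sphere of imaginary units, i.e. of the quaternionic square roots of `-1`. -/
def imUnits : Set ℍ[ℝ] := {J | J * J = -1}

/-- The quaternion `α + J β` attached to the complex number `α + i β` and to `J`. -/
noncomputable def slicePt (J : ℍ[ℝ]) (w : ℂ) : ℍ[ℝ] := (w.re : ℍ[ℝ]) + (w.im : ℝ) • J

/-- The ordered product `q_{k₁} ⋯ q_{k_p}`, where `K = {k₁ < ⋯ < k_p}`; it is `1` if `K = ∅`. -/
noncomputable def ordProd {n : ℕ} (K : Finset (Fin n)) (q : Fin n → ℍ[ℝ]) : ℍ[ℝ] :=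
  ((K.sort (· ≤ ·)).map q).prod

/-- The complex conjugation of the `h`-th variable of `ℂⁿ`. -/
noncomputable def conjAt {n : ℕ} (h : Fin n) (z : Fin n → ℂ) : Fin n → ℂ :=
  Function.update z h (star (z h))

/-- `D ⊆ ℂⁿ` is invariant under complex conjugation of each single variable. -/
def ConjInvariant {n : ℕ} (D : Set (Fin n → ℂ)) : Prop :=
  ∀ z ∈ D, ∀ h, conjAt h z ∈ D

/-- The circularization `Ω_D ⊆ ℍⁿ` of `D ⊆ ℂⁿ`. -/
def circ {n : ℕ} (D : Set (Fin n → ℂ)) : Set (Fin n → ℍ[ℝ]) :=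
  {x | ∃ z ∈ D, ∃ J : Fin n → ℍ[ℝ], (∀ i, J i ∈ imUnits) ∧ x = fun i => slicePt (J i) (z i)}

/-- The set `D_H` of the points of `D` none of whose `h`-th coordinates, `h ∈ H`, is real.
Its circularization is `Ω_D` without the points having a real `h`-th coordinate for some
`h ∈ H`. -/
def offReal {n : ℕ} (D : Set (Fin n → ℂ)) (H : Finset (Fin n)) : Set (Fin n → ℂ) :=
  {z | z ∈ D ∧ ∀ h ∈ H, (z h).im ≠ 0}

/-- Functions `F = ∑_K e_K F_K` with values in `ℍ ⊗ ℝ^{2ⁿ}`, given by their components `F_K`. -/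
abbrev StemMap (n : ℕ) : Type := (Fin n → ℂ) → Finset (Fin n) → ℍ[ℝ]

/-- `F` is a stem function on the (invariant) set `D`:
`F_K(z̄^h) = (-1)^{|K ∩ {h}|} F_K(z)`. -/
def IsStem {n : ℕ} (D : Set (Fin n → ℂ)) (F : StemMap n) : Prop :=
  ∀ z ∈ D, ∀ (h : Fin n) (K : Finset (Fin n)),
    F (conjAt h z) K = (-1 : ℝ) ^ (K ∩ {h}).card • F z K

/-- `f` is induced by `F` on `Ω_D`: `f(α + J β) = ∑_K J_K F_K(α + i β)`, for every choice of
the units `J₁, …, Jₙ`. -/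
def Induces {n : ℕ} (D : Set (Fin n → ℂ)) (F : StemMap n) (f : (Fin n → ℍ[ℝ]) → ℍ[ℝ]) : Prop :=
  ∀ z ∈ D, ∀ J : Fin n → ℍ[ℝ], (∀ i, J i ∈ imUnits) →
    f (fun i => slicePt (J i) (z i)) = ∑ K : Finset (Fin n), ordProd K J * F z K

/-- `f` is a slice function on `Ω_D`. (Only the values of `f` on `Ω_D` matter.) -/
def IsSlice {n : ℕ} (D : Set (Fin n → ℂ)) (f : (Fin n → ℍ[ℝ]) → ℍ[ℝ]) : Prop :=
  ∃ F : StemMap n, IsStem D F ∧ Induces D F f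

open Classical in
/-- The stem function inducing the slice function `f` on `Ω_D`. Its values on `D` are uniquely
determined, see `stem_unique`. -/
noncomputable def stem {n : ℕ} (D : Set (Fin n → ℂ)) (f : (Fin n → ℍ[ℝ]) → ℍ[ℝ]) : StemMap n :=
  if hf : IsSlice D f then hf.choose else 0

/-- The quaternion `i`. -/
def iUnit : ℍ[ℝ] := ⟨0, 1, 0, 0⟩

open Classical in
/-- The imaginary unit `J` in `q = α + J β`, `β > 0` (any unit does if `q` is real). -/
noncomputable def unitIm (q : ℍ[ℝ]) : ℍ[ℝ] :=
  if q.im = 0 then iUnit else ‖q.im‖⁻¹ • q.im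

/-- The complex number `α + i β`, `β ≥ 0`, such that `q = α + J β`. -/
noncomputable def toC (q : ℍ[ℝ]) : ℂ := ⟨q.re, ‖q.im‖⟩

/-- The function `𝓘(F)` induced by `F`. For a stem function the result does not depend on the
representation of `x` by units and complex numbers, see `induces_inducedFn`. -/
noncomputable def inducedFn {n : ℕ} (F : StemMap n) (x : Fin n → ℍ[ℝ]) : ℍ[ℝ] :=
  ∑ K : Finset (Fin n), ordProd K (fun i => unitIm (x i)) * F (fun i => toC (x i)) K

/-- The product of stem functions,
`F ⊗ G = ∑_{K,L} (-1)^{|K ∩ L|} e_{K Δ L} F_K G_L`. -/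
noncomputable def stemMul {n : ℕ} (F G : StemMap n) : StemMap n := fun z T =>
  ∑ K : Finset (Fin n), ∑ L : Finset (Fin n),
    if symmDiff K L = T then (-1 : ℝ) ^ (K ∩ L).card • (F z K * G z L) else 0

/-- The slice product `f ⊙ g` of slice functions on `Ω_D`. -/
noncomputable def sliceMul {n : ℕ} (D : Set (Fin n → ℂ)) (f g : (Fin n → ℍ[ℝ]) → ℍ[ℝ]) :
    (Fin n → ℍ[ℝ]) → ℍ[ℝ] :=
  inducedFn (stemMul (stem D f) (stem D g))

/-- `F'_H = β_H⁻¹ ∑_{K ⊆ Hᶜ} e_K F_{K ∪ H}`, with `β_H = ∏_{h ∈ H} β_h`; meaningful where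
`β_h ≠ 0` for all `h ∈ H`. It is the iteration of the operators `F ↦ F'_{h}`, `h ∈ H`, in any
order, see `stemDeriv_insert`. -/
noncomputable def stemDeriv {n : ℕ} (H : Finset (Fin n)) (F : StemMap n) : StemMap n :=
  fun z K => if Disjoint K H then (∏ h ∈ H, (z h).im)⁻¹ • F z (K ∪ H) else 0

/-- The spherical derivative `f'_{s,H}` of a slice function on `Ω_D`; it is a function on the
circularization of `D_H`. -/
noncomputable def sphDeriv {n : ℕ} (D : Set (Fin n → ℂ)) (H : Finset (Fin n))
    (f : (Fin n → ℍ[ℝ]) → ℍ[ℝ]) : (Fin n → ℍ[ℝ]) → ℍ[ℝ] :=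
  inducedFn (stemDeriv H (stem D f))

/-- The component `𝓢^H_K(f) = (x_K ⊙ f)'_{s,H}`, a function on the circularization of `D_H`. -/
noncomputable def almansi {n : ℕ} (D : Set (Fin n → ℂ)) (H K : Finset (Fin n))
    (f : (Fin n → ℍ[ℝ]) → ℍ[ℝ]) : (Fin n → ℍ[ℝ]) → ℍ[ℝ] :=
  sphDeriv D H (sliceMul D (fun x => ordProd K x) f)

/-- The commuting complex structures,
`𝓙_h (q ⊗ e_L) = (-1)^{|L ∩ {h}|} q ⊗ e_{L Δ {h}}`, written in components. -/
noncomputable def cplx {n : ℕ} (h : Fin n) (v : Finset (Fin n) → ℍ[ℝ]) :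
    Finset (Fin n) → ℍ[ℝ] :=
  fun K => (-1 : ℝ) ^ (symmDiff K {h} ∩ {h}).card • v (symmDiff K {h})

/-- `∂̄_h F = ½ (∂F/∂α_h + 𝓙_h ∂F/∂β_h)`. -/
noncomputable def dbar {n : ℕ} (h : Fin n) (F : StemMap n) : StemMap n := fun z =>
  (2⁻¹ : ℝ) • (fderiv ℝ F z (Pi.single h 1) + cplx h (fderiv ℝ F z (Pi.single h Complex.I)))

/-- `f` is slice regular on `Ω_D` (`D` open): it is induced by a holomorphic stem function of
class `C¹`. -/
def IsSliceRegular {n : ℕ} (D : Set (Fin n → ℂ)) (f : (Fin n → ℍ[ℝ]) → ℍ[ℝ]) : Prop :=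
  ∃ F : StemMap n, IsStem D F ∧ Induces D F f ∧ ContDiffOn ℝ 1 F D ∧
    ∀ h, ∀ z ∈ D, dbar h F z = 0

/-- `f` is slice preserving on `Ω_D`: the components of its stem function are real valued. -/
def IsSlicePreserving {n : ℕ} (D : Set (Fin n → ℂ)) (f : (Fin n → ℍ[ℝ]) → ℍ[ℝ]) : Prop :=
  ∃ F : StemMap n, IsStem D F ∧ Induces D F f ∧ ∀ z ∈ D, ∀ K, ∃ r : ℝ, F z K = (r : ℍ[ℝ])

/-- The subset of `ℂ` (as the space of one complex variable) whose circularization is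
`Ω_{D,h}(y) = {x ∈ ℍ | (y₁, …, y_{h-1}, x, y_{h+1}, …, yₙ) ∈ Ω_D}`. -/
def sectionSet {n : ℕ} (D : Set (Fin n → ℂ)) (h : Fin n) (y : Fin n → ℍ[ℝ]) :
    Set (Fin 1 → ℂ) :=
  {w | ∀ J ∈ imUnits, Function.update y h (slicePt J (w 0)) ∈ circ D}

/-- The restriction `f^y_h : x ↦ f(y₁, …, y_{h-1}, x, y_{h+1}, …, yₙ)`, as a function of one
quaternionic variable. -/
def restrictVar {n : ℕ} (f : (Fin n → ℍ[ℝ]) → ℍ[ℝ]) (h : Fin n) (y : Fin n → ℍ[ℝ]) :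
    (Fin 1 → ℍ[ℝ]) → ℍ[ℝ] :=
  fun x => f (Function.update y h (x 0))

/-- `𝓢_h(Ω_D)`: slice functions that are slice with respect to `x_h`. -/
def IsSliceIn {n : ℕ} (D : Set (Fin n → ℂ)) (h : Fin n) (f : (Fin n → ℍ[ℝ]) → ℍ[ℝ]) : Prop :=
  IsSlice D f ∧ ∀ y ∈ circ D, IsSlice (sectionSet D h y) (restrictVar f h y)

/-- `𝓢𝓡_h(Ω_D)`: slice functions that are slice regular with respect to `x_h`. -/
def IsSliceRegularIn {n : ℕ} (D : Set (Fin n → ℂ)) (h : Fin n)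
    (f : (Fin n → ℍ[ℝ]) → ℍ[ℝ]) : Prop :=
  IsSlice D f ∧ ∀ y ∈ circ D, IsSliceRegular (sectionSet D h y) (restrictVar f h y)

/-- `𝓢_{c,h}(Ω_D)`: slice functions that are circular with respect to `x_h`, i.e. `f^y_h` is
constant on each sphere `{α + J β | J² = -1}` in its domain. -/
def IsCircularIn {n : ℕ} (D : Set (Fin n → ℂ)) (h : Fin n)
    (f : (Fin n → ℍ[ℝ]) → ℍ[ℝ]) : Prop :=
  IsSlice D f ∧ ∀ y ∈ circ D, ∀ w : ℂ, ∀ J ∈ imUnits, ∀ J' ∈ imUnits,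
    Function.update y h (slicePt J w) ∈ circ D → Function.update y h (slicePt J' w) ∈ circ D →
      f (Function.update y h (slicePt J w)) = f (Function.update y h (slicePt J' w))

/-- `f` is harmonic on `Ω_D` (`D` open) with respect to `x_h ∈ ℍ = ℝ⁴`: it is of class `C²` in
`x_h` and `Δ_h f = 0`. -/
def IsHarmonicIn {n : ℕ} (D : Set (Fin n → ℂ)) (h : Fin n)
    (f : (Fin n → ℍ[ℝ]) → ℍ[ℝ]) : Prop :=
  ∀ y ∈ circ D, InnerProductSpace.HarmonicAt (fun t : ℍ[ℝ] => f (Function.update y h t)) (y h)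

/-! Well-definedness of the notions above. -/

theorem iUnit_mem : iUnit ∈ imUnits := by
  change iUnit * iUnit = -1
  ext <;> simp [Quaternion.re_mul, Quaternion.imI_mul, Quaternion.imJ_mul, Quaternion.imK_mul] <;>
    simp [iUnit]

theorem ordProd_smul {n : ℕ} (K : Finset (Fin n)) (s : Fin n → ℝ) (J : Fin n → ℍ[ℝ]) :
    ordProd K (fun i => s i • J i) = (∏ i ∈ K, s i) • ordProd K J := by
  have key : ∀ l : List (Fin n), (l.map (fun i => s i • J i)).prod
      = (l.map s).prod • (l.map J).prod := by
    intro l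
    induction l with
    | nil => simp
    | cons a l ih => simp [ih, smul_smul, mul_comm]
  have hs : ((K.sort (· ≤ ·)).map s).prod = ∏ i ∈ K, s i := by
    rw [← List.prod_toFinset s (Finset.sort_nodup K (· ≤ ·)), Finset.sort_toFinset]
  rw [ordProd, key, hs, ordProd]

theorem ordProd_congr {n : ℕ} (K : Finset (Fin n)) {J J' : Fin n → ℍ[ℝ]}
    (h : ∀ i ∈ K, J i = J' i) : ordProd K J = ordProd K J' := by
  unfold ordProd
  congr 1
  apply List.map_congr_left
  intro i hi
  exact h i (by simpa using hi)

/-- The stem function inducing a given function is unique. -/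
theorem stem_unique {n : ℕ} {D : Set (Fin n → ℂ)} {F F' : StemMap n}
    {f : (Fin n → ℍ[ℝ]) → ℍ[ℝ]} (hF : Induces D F f) (hF' : Induces D F' f) :
    ∀ z ∈ D, F z = F' z := by
  intro z hz
  have h0 : ∀ T S : Finset (Fin n), ∀ J : Fin n → ℍ[ℝ], (∀ i, J i ∈ imUnits) →
      ∑ K : Finset (Fin n) with K ∩ T = S, ordProd K J * (F z K - F' z K) = 0 := by
    intro T
    induction T using Finset.induction_on with
    | empty =>
      intro S J hJ
      by_cases hS : S = ∅
      · subst hS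
        simp [mul_sub, Finset.sum_sub_distrib, ← hF z hz J hJ, ← hF' z hz J hJ]
      · have : ∀ K : Finset (Fin n), ¬ (∅ = S) := fun _ h => hS h.symm
        simp [Ne.symm hS]
    | insert h T hT ih =>
      intro S J hJ
      let s : Fin n → ℝ := fun i => if i = h then -1 else 1
      have e1 := ih (S.erase h) J hJ
      have e2 := ih (S.erase h) (fun i => s i • J i) (by
        intro i
        have := hJ i
        simp only [imUnits, Set.mem_ofPred_eq, s] at this ⊢
        split_ifs <;> simp [this])
      have hs : ∀ K : Finset (Fin n), ∏ i ∈ K, s i = if h ∈ K then -1 else 1 := by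
        intro K
        simp [s, Finset.prod_ite_eq']
      simp only [ordProd_smul, hs] at e2
      rw [← Finset.sum_filter_add_sum_filter_not _ (fun K => h ∈ K)] at e1 e2
      rw [Finset.filter_filter, Finset.filter_filter] at e1 e2
      have e3 : ∑ K : Finset (Fin n) with K ∩ T = S.erase h ∧ h ∈ K,
          ((if h ∈ K then (-1 : ℝ) else 1) • ordProd K J) * (F z K - F' z K)
          = - ∑ K : Finset (Fin n) with K ∩ T = S.erase h ∧ h ∈ K,
            ordProd K J * (F z K - F' z K) := by
        rw [← Finset.sum_neg_distrib]
        refine Finset.sum_congr rfl fun K hK => ?_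
        simp [(Finset.mem_filter.1 hK).2.2]
      have e4 : ∑ K : Finset (Fin n) with K ∩ T = S.erase h ∧ h ∉ K,
          ((if h ∈ K then (-1 : ℝ) else 1) • ordProd K J) * (F z K - F' z K)
          = ∑ K : Finset (Fin n) with K ∩ T = S.erase h ∧ h ∉ K,
            ordProd K J * (F z K - F' z K) := by
        refine Finset.sum_congr rfl fun K hK => ?_
        simp [(Finset.mem_filter.1 hK).2.2]
      rw [e3, e4] at e2
      set X := ∑ K : Finset (Fin n) with K ∩ T = S.erase h ∧ h ∈ K,
            ordProd K J * (F z K - F' z K)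
      set Y := ∑ K : Finset (Fin n) with K ∩ T = S.erase h ∧ h ∉ K,
            ordProd K J * (F z K - F' z K)
      have hY : Y = 0 := by
        have : (2 : ℝ) • Y = 0 := by
          rw [two_smul]
          calc Y + Y = (X + Y) + (-X + Y) := by abel
            _ = 0 := by rw [e1, e2, add_zero]
        simpa using this
      have hX : X = 0 := by rw [hY, add_zero] at e1; exact e1
      by_cases hS : h ∈ S
      · rw [← hX]
        refine Finset.sum_congr ?_ fun _ _ => rfl
        ext K
        simp only [Finset.mem_filter, Finset.mem_univ, true_and]
        constructor
        · rintro rfl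
          refine ⟨?_, by simpa using hS⟩
          ext i; by_cases hi : i = h <;> simp [hi, hT]
        · rintro ⟨h1, h2⟩
          ext i
          have := Finset.ext_iff.1 h1 i
          by_cases hi : i = h
          · subst hi; simp [h2, hS]
          · simpa [hi] using this
      · rw [← hY]
        refine Finset.sum_congr ?_ fun _ _ => rfl
        rw [Finset.erase_eq_of_notMem hS]
        ext K
        simp only [Finset.mem_filter, Finset.mem_univ, true_and]
        constructor
        · rintro rfl
          have hK : h ∉ K := by simpa using hS
          refine ⟨?_, hK⟩
          ext i; by_cases hi : i = h <;> simp [hi, hT, hK]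
        · rintro ⟨h1, h2⟩
          rw [← h1]
          ext i
          by_cases hi : i = h <;> simp [hi, hT, h2]
  funext L
  have := h0 Finset.univ L (fun _ => iUnit) (fun _ => iUnit_mem)
  simp only [Finset.inter_univ, Finset.filter_eq', Finset.mem_univ, if_true,
    Finset.sum_singleton, mul_eq_zero] at this
  rcases this with h | h
  · exfalso
    unfold ordProd at h
    rw [List.prod_eq_zero_iff, List.mem_map] at h
    obtain ⟨_, _, h⟩ := h
    have := congrArg (fun q : ℍ[ℝ] => q.imI) h
    simp [iUnit] at this
  · exact sub_eq_zero.1 h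

theorem stem_spec {n : ℕ} {D : Set (Fin n → ℂ)} {f : (Fin n → ℍ[ℝ]) → ℍ[ℝ]}
    (hf : IsSlice D f) : IsStem D (stem D f) ∧ Induces D (stem D f) f := by
  rw [stem, dif_pos hf]
  exact hf.choose_spec

theorem re_of_mem_imUnits {J : ℍ[ℝ]} (h : J ∈ imUnits) : J.re = 0 ∧ ‖J‖ = 1 := by
  have hn : ‖J‖ = 1 := by
    have : ‖J‖ * ‖J‖ = 1 := by
      rw [← norm_mul, show J * J = -1 from h]; simp
    nlinarith [norm_nonneg J]
  refine ⟨?_, hn⟩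
  have h1 : J * J = -1 := h
  have h2 : J * star J = 1 := by
    rw [Quaternion.self_mul_star, Quaternion.normSq_eq_norm_mul_self, hn]; simp
  have h3 : J * (J + star J) = 0 := by rw [mul_add, h1, h2]; simp
  have hJ : J ≠ 0 := by intro h; rw [h] at hn; simp at hn
  have h4 := (mul_eq_zero.1 h3).resolve_left hJ
  have h5 := congrArg (fun q : ℍ[ℝ] => q.re) h4
  simp at h5
  linarith

theorem slicePt_im {J : ℍ[ℝ]} (h : J ∈ imUnits) (w : ℂ) : (slicePt J w).im = w.im • J := by
  have := (re_of_mem_imUnits h).1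
  ext <;> simp [slicePt, this]

theorem toC_slicePt {J : ℍ[ℝ]} (h : J ∈ imUnits) (w : ℂ) :
    toC (slicePt J w) = ⟨w.re, |w.im|⟩ := by
  rw [toC, slicePt_im h, norm_smul, (re_of_mem_imUnits h).2, mul_one]
  simp [slicePt, (re_of_mem_imUnits h).1]

theorem unitIm_slicePt {J : ℍ[ℝ]} (h : J ∈ imUnits) {w : ℂ} (hw : w.im ≠ 0) :
    unitIm (slicePt J w) = (if w.im < 0 then (-1 : ℝ) else 1) • J := by
  have hJ : J ≠ 0 := by
    intro h0; have := (re_of_mem_imUnits h).2; rw [h0] at this; simp at this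
  simp only [unitIm, slicePt_im h, smul_ne_zero hw hJ, if_false]
  rw [norm_smul, (re_of_mem_imUnits h).2, mul_one, smul_smul, Real.norm_eq_abs]
  congr 1
  split_ifs with hneg
  · rw [abs_of_neg hneg, inv_neg, neg_mul, inv_mul_cancel₀ hw]
  · rw [abs_of_nonneg (not_lt.1 hneg), inv_mul_cancel₀ hw]

theorem IsStem.conj_mem {n : ℕ} {D : Set (Fin n → ℂ)} (hD : ConjInvariant D) {F : StemMap n}
    (hF : IsStem D F) {z : Fin n → ℂ} (hz : z ∈ D) (T : Finset (Fin n)) :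
    (fun i => if i ∈ T then star (z i) else z i) ∈ D ∧
      ∀ K, F (fun i => if i ∈ T then star (z i) else z i) K
        = (-1 : ℝ) ^ (K ∩ T).card • F z K := by
  induction T using Finset.induction_on with
  | empty => simpa using hz
  | insert h T hT ih =>
    have e : (fun i => if i ∈ insert h T then star (z i) else z i)
        = conjAt h (fun i => if i ∈ T then star (z i) else z i) := by
      funext i
      by_cases hi : i = h
      · subst hi; simp [conjAt, hT]
      · simp [conjAt, hi]
    rw [e]
    refine ⟨hD _ ih.1 h, fun K => ?_⟩
    rw [hF _ ih.1 h K, ih.2 K, smul_smul, ← pow_add]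
    congr 2
    rw [Finset.insert_eq, Finset.inter_union_distrib_left, Finset.card_union_of_disjoint]
    rw [Finset.disjoint_left]
    intro i hi hi'
    simp only [Finset.mem_inter, Finset.mem_singleton] at hi hi'
    exact hT (hi.2 ▸ hi'.2)

/-- `inducedFn F` is the function induced by the stem function `F`. -/
theorem induces_inducedFn {n : ℕ} {D : Set (Fin n → ℂ)} (hD : ConjInvariant D) {F : StemMap n}
    (hF : IsStem D F) : Induces D F (inducedFn F) := by
  intro z hz J hJ
  let T : Finset (Fin n) := {i | (z i).im < 0}
  have hT := hF.conj_mem hD hz T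
  have e : (fun i => toC (slicePt (J i) (z i))) = fun i => if i ∈ T then star (z i) else z i := by
    funext i
    rw [toC_slicePt (hJ i)]
    by_cases hi : (z i).im < 0
    · apply Complex.ext <;> simp [T, hi, abs_of_neg]
    · apply Complex.ext <;> simp [T, hi, abs_of_nonneg (not_lt.1 hi)]
  unfold inducedFn
  rw [e]
  refine Finset.sum_congr rfl fun K _ => ?_
  rw [hT.2 K]
  by_cases hK : ∃ i ∈ K, (z i).im = 0
  · obtain ⟨i, hi, hzi⟩ := hK
    have h1 := hF z hz i K
    have h2 : conjAt i z = z := by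
      rw [conjAt, Function.update_eq_self_iff]
      apply Complex.ext <;> simp [hzi]
    have h3 : K ∩ {i} = {i} := by ext j; simp; rintro rfl; exact hi
    rw [h2, h3] at h1
    have h4 : F z K = 0 := by
      simp only [Finset.card_singleton, pow_one, neg_smul, one_smul] at h1
      have h5 : (2 : ℝ) • F z K = 0 := by
        rw [two_smul]
        nth_rewrite 1 [h1]
        simp
      simpa using h5
    simp [h4]
  · push Not at hK
    have h1 : ordProd K (fun i => unitIm (slicePt (J i) (z i)))
        = ordProd K (fun i => (if (z i).im < 0 then (-1 : ℝ) else 1) • J i) :=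
      ordProd_congr K fun i hi => unitIm_slicePt (hJ i) (hK i hi)
    have h2 : ∏ i ∈ K, (if (z i).im < 0 then (-1 : ℝ) else 1) = (-1 : ℝ) ^ (K ∩ T).card := by
      rw [← Finset.prod_filter, Finset.prod_const]
      congr 2
      ext i; simp [T]
    rw [h1, ordProd_smul, h2, smul_mul_smul_comm, ← pow_add, ← two_mul]
    simp

theorem stemDeriv_insert {n : ℕ} {h : Fin n} {H : Finset (Fin n)} (hh : h ∉ H) (F : StemMap n) :
    stemDeriv (insert h H) F = stemDeriv {h} (stemDeriv H F) := by
  funext z K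
  have e1 : K ∪ insert h H = K ∪ {h} ∪ H := by
    ext i; simp
  have e2 : Disjoint K (insert h H) ↔ Disjoint K {h} ∧ Disjoint (K ∪ {h}) H := by
    simp [hh]
  unfold stemDeriv
  by_cases h1 : Disjoint K {h} <;> by_cases h2 : Disjoint (K ∪ {h}) H <;>
    simp [e2, h1, h2, e1, Finset.prod_insert hh, smul_smul, mul_comm]

end SliceAnalysis

open SliceAnalysis

/-! ### Normal forms of points; passage between functions and stem functions -/

namespace SliceAnalysis

variable {n : ℕ}

/-! Everything is read off stem functions, on which multiplication by an ordered product of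
variables and the spherical derivative act pointwise with real coefficients. For one variable x_h =
α + Jβ and an index T not containing h, the two components of f have the T-entries S_∅ = F_{T∪h}/β
and S_h = F_T + α F_{T∪h}/β. Hence F_{T∪h} = β S_∅ and F_T = S_h - α S_∅, that is f = S_h - x̄_h ⊙
S_∅. For general H the matrix is the tensor product of these 2×2 matrices over h ∈ H, and `recCoef`
is the inverse matrix (`sum_recCoef_mul`, `sum_recCoef_smul`). When H is everything, both matrices
being real gives the criterion for slice preserving functions.

The stem function of a component has only entries T disjoint from H. So no unit J_h with h ∈ H
occurs, which is circularity. If p = min Hᶜ, every index in T is at least p; the unit J_p, when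
present, is therefore the leftmost factor of J_T and can be pulled out, which is sliceness in x_p
(`induces_sectionStem`).

Regularity is reduced to complex analysis: for each real linear form ℓ, ℓ(F_K) + i ℓ(F_{K∪a}) has to
be holomorphic in z_a. A jointly continuous stem function that is separately holomorphic in this
sense is C¹, because its partial derivatives are continuous by locally uniform convergence
(`isSliceRegular_iff`). The quotient F_{K∪a}/β_a extends continuously across β_a = 0: its numerator
vanishes there, and the mean value theorem turns the quotient into a derivative at a nearby point.
Holomorphy in the remaining variables survives by density, so the variables of H can be treated one
at a time (`exists_isDerivExt`).

Harmonicity concerns functions Im φ(α+iβ)/β with φ holomorphic and compatible with conjugation. Off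
the real axis it is a computation in which the three imaginary directions of ℍ make the terms cancel
(`laplacian_imDiv`). At a real point the power series of φ is divided term by term: Im wⁿ⁺¹ / Im w
is a sum of products of w and w̄, hence comes from a real multilinear map on ℍ. The function is thus
real analytic, and its Laplacian vanishes on a dense set, hence nearby.

For the converse in the regularity criterion, H = {i < p} shows that F is holomorphic in z_p, since
the inverse matrix does not involve z_p. The joint continuity of F comes from the continuous
extensions for H = {0}, combined with the holomorphy of F in z_0 given by H = ∅
(`isSliceRegular_of_forall`). -/

theorem unitIm_mem (q : ℍ[ℝ]) : unitIm q ∈ imUnits := by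
  unfold unitIm
  split_ifs with h
  · exact iUnit_mem
  · have hq : ‖q.im‖ ≠ 0 := norm_ne_zero_iff.2 h
    have h1 : q.im * q.im = -((‖q.im‖ * ‖q.im‖ : ℝ) : ℍ[ℝ]) := by
      have h2 := Quaternion.self_mul_star q.im
      rw [Quaternion.star_eq_neg.2 (Quaternion.re_im q), Quaternion.normSq_eq_norm_mul_self,
        mul_neg, neg_eq_iff_eq_neg] at h2
      exact h2
    change (‖q.im‖⁻¹ • q.im) * (‖q.im‖⁻¹ • q.im) = -1
    rw [smul_mul_smul_comm, h1, smul_neg, ← Quaternion.coe_smul, smul_eq_mul, ← mul_inv,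
      inv_mul_cancel₀ (mul_ne_zero hq hq), Quaternion.coe_one]

theorem slicePt_unitIm_toC (q : ℍ[ℝ]) : slicePt (unitIm q) (toC q) = q := by
  have h : ‖q.im‖ • unitIm q = q.im := by
    unfold unitIm
    split_ifs with h
    · simp [h]
    · rw [smul_smul, mul_inv_cancel₀ (norm_ne_zero_iff.2 h), one_smul]
  change ((q.re : ℝ) : ℍ[ℝ]) + ‖q.im‖ • unitIm q = q
  rw [h, Quaternion.re_add_im]

/-- If `D` is conjugation invariant, so is membership under conjugation of several variables. -/
theorem ConjInvariant.conj_mem {D : Set (Fin n → ℂ)} (hD : ConjInvariant D) {z : Fin n → ℂ}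
    (hz : z ∈ D) (T : Finset (Fin n)) : (fun i => if i ∈ T then star (z i) else z i) ∈ D :=
  (IsStem.conj_mem hD (F := 0) (fun _ _ _ _ => by simp) hz T).1

/-- Passing to the representative with β ≥ 0 conjugates exactly the variables with negative
imaginary part. This operation is undone by conjugating the same variables, and D is invariant under
it. -/
theorem toC_slicePt_mem {D : Set (Fin n → ℂ)} (hD : ConjInvariant D) {z : Fin n → ℂ}
    {J : Fin n → ℍ[ℝ]} (hJ : ∀ i, J i ∈ imUnits) :
    (fun i => toC (slicePt (J i) (z i))) ∈ D ↔ z ∈ D := by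
  have e : (fun i => toC (slicePt (J i) (z i)))
      = fun i => if i ∈ ({i | (z i).im < 0} : Finset (Fin n)) then star (z i) else z i := by
    funext i
    rw [toC_slicePt (hJ i)]
    by_cases hi : (z i).im < 0
    · apply Complex.ext <;> simp [hi, abs_of_neg]
    · apply Complex.ext <;> simp [hi, abs_of_nonneg (not_lt.1 hi)]
  rw [e]
  refine ⟨fun h => ?_, fun h => hD.conj_mem h _⟩
  have := hD.conj_mem h ({i | (z i).im < 0} : Finset (Fin n))
  convert this using 1
  funext i
  by_cases hi : (z i).im < 0 <;> simp [hi]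

theorem mem_circ_iff {D : Set (Fin n → ℂ)} (hD : ConjInvariant D) {x : Fin n → ℍ[ℝ]} :
    x ∈ circ D ↔ (fun i => toC (x i)) ∈ D := by
  constructor
  · rintro ⟨z, hz, J, hJ, rfl⟩
    exact (toC_slicePt_mem hD hJ).2 hz
  · intro h
    exact ⟨_, h, fun i => unitIm (x i), fun i => unitIm_mem _,
      funext fun i => (slicePt_unitIm_toC _).symm⟩

theorem slicePt_mem_circ {D : Set (Fin n → ℂ)} {z : Fin n → ℂ} (hz : z ∈ D)
    {J : Fin n → ℍ[ℝ]} (hJ : ∀ i, J i ∈ imUnits) : (fun i => slicePt (J i) (z i)) ∈ circ D :=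
  ⟨z, hz, J, hJ, rfl⟩

theorem Induces.eq_inducedFn {D : Set (Fin n → ℂ)} (hD : ConjInvariant D) {F : StemMap n}
    {f : (Fin n → ℍ[ℝ]) → ℍ[ℝ]} (h : Induces D F f) {x : Fin n → ℍ[ℝ]} (hx : x ∈ circ D) :
    f x = inducedFn F x := by
  have := h _ ((mem_circ_iff hD).1 hx) (fun i => unitIm (x i)) (fun i => unitIm_mem _)
  simp only [slicePt_unitIm_toC] at this
  exact this

theorem inducedFn_congr {F G : StemMap n} {x : Fin n → ℍ[ℝ]}
    (h : ∀ K, F (fun i => toC (x i)) K = G (fun i => toC (x i)) K) :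
    inducedFn F x = inducedFn G x := by
  simp only [inducedFn, h]

theorem inducedFn_eqOn {D : Set (Fin n → ℂ)} (hD : ConjInvariant D) {F G : StemMap n}
    (h : ∀ z ∈ D, F z = G z) : Set.EqOn (inducedFn F) (inducedFn G) (circ D) := fun _ hx =>
  inducedFn_congr fun _ => by rw [h _ ((mem_circ_iff hD).1 hx)]

theorem Induces.congr {D : Set (Fin n → ℂ)} {F : StemMap n} {f g : (Fin n → ℍ[ℝ]) → ℍ[ℝ]}
    (h : Induces D F f) (hfg : Set.EqOn f g (circ D)) : Induces D F g := fun z hz J hJ => by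
  rw [← h z hz J hJ, hfg (slicePt_mem_circ hz hJ)]

theorem Induces.mono {D D' : Set (Fin n → ℂ)} (hDD : D' ⊆ D) {F : StemMap n}
    {f : (Fin n → ℍ[ℝ]) → ℍ[ℝ]} (h : Induces D F f) : Induces D' F f :=
  fun z hz => h z (hDD hz)

theorem IsStem.mono {D D' : Set (Fin n → ℂ)} (hDD : D' ⊆ D) {F : StemMap n}
    (h : IsStem D F) : IsStem D' F :=
  fun z hz => h z (hDD hz)

theorem offReal_subset (D : Set (Fin n → ℂ)) (H : Finset (Fin n)) : offReal D H ⊆ D :=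
  fun _ hz => hz.1

theorem circ_mono {D D' : Set (Fin n → ℂ)} (h : D' ⊆ D) : circ D' ⊆ circ D := by
  rintro x ⟨z, hz, r⟩
  exact ⟨z, h hz, r⟩

theorem ConjInvariant.offReal {D : Set (Fin n → ℂ)} (hD : ConjInvariant D)
    (H : Finset (Fin n)) : ConjInvariant (offReal D H) := by
  intro z hz h
  refine ⟨hD z hz.1 h, fun i hi => ?_⟩
  by_cases hih : i = h
  · subst hih; simpa [conjAt] using hz.2 i hi
  · simpa [conjAt, hih] using hz.2 i hi

theorem stem_eq {D : Set (Fin n → ℂ)} {F : StemMap n} {f : (Fin n → ℍ[ℝ]) → ℍ[ℝ]}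
    (hF : IsStem D F) (h : Induces D F f) : ∀ z ∈ D, stem D f z = F z :=
  stem_unique (stem_spec ⟨F, hF, h⟩).2 h

theorem neg_one_pow_card_inter_singleton (K : Finset (Fin n)) (h : Fin n) :
    (-1 : ℝ) ^ (K ∩ {h}).card = if h ∈ K then -1 else 1 := by
  by_cases hK : h ∈ K <;> simp [hK]

theorem IsStem.conjAt_apply {D : Set (Fin n → ℂ)} {F : StemMap n} (hF : IsStem D F)
    {z : Fin n → ℂ} (hz : z ∈ D) (h : Fin n) (K : Finset (Fin n)) :
    F (conjAt h z) K = (if h ∈ K then (-1 : ℝ) else 1) • F z K := by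
  rw [hF z hz h K, neg_one_pow_card_inter_singleton]

/-- A component whose index contains `h` vanishes where the `h`-th variable is real. -/
theorem IsStem.eq_zero_of_im {D : Set (Fin n → ℂ)} {F : StemMap n} (hF : IsStem D F)
    {z : Fin n → ℂ} (hz : z ∈ D) {h : Fin n} {K : Finset (Fin n)} (hK : h ∈ K)
    (him : (z h).im = 0) : F z K = 0 := by
  have h1 := hF.conjAt_apply hz h K
  have h2 : conjAt h z = z := by
    rw [conjAt, Function.update_eq_self_iff]
    apply Complex.ext <;> simp [him]
  rw [h2, if_pos hK, neg_one_smul] at h1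
  have h3 : (2 : ℝ) • F z K = 0 := by
    rw [two_smul]
    nth_rewrite 1 [h1]
    simp
  simpa using h3

/-- Parities add up: h lies in K Δ L exactly when it lies in one and only one of K and L. -/
theorem IsStem.stemMul {D : Set (Fin n → ℂ)} {F G : StemMap n} (hF : IsStem D F)
    (hG : IsStem D G) : IsStem D (stemMul F G) := by
  intro z hz h T
  simp only [SliceAnalysis.stemMul, Finset.smul_sum]
  refine Finset.sum_congr rfl fun K _ => Finset.sum_congr rfl fun L _ => ?_
  split_ifs with hT
  · subst hT
    rw [hF.conjAt_apply hz, hG.conjAt_apply hz, neg_one_pow_card_inter_singleton,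
      smul_mul_smul_comm, smul_comm]
    congr 1
    by_cases h1 : h ∈ K <;> by_cases h2 : h ∈ L <;> simp [h1, h2, Finset.mem_symmDiff]
  · simp

/-- For h ∈ H the sign picked up by F_{K∪H} is cancelled by that of β_h, so the quotient is even in
β_h; this matches h ∉ K. -/
theorem IsStem.stemDeriv {D : Set (Fin n → ℂ)} {F : StemMap n} (hF : IsStem D F)
    (H : Finset (Fin n)) : IsStem (offReal D H) (stemDeriv H F) := by
  intro z hz h K
  unfold SliceAnalysis.stemDeriv
  split_ifs with hK
  · rw [hF.conjAt_apply hz.1, neg_one_pow_card_inter_singleton]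
    by_cases hh : h ∈ H
    · have h1 : h ∉ K := fun h' => Finset.disjoint_left.1 hK h' hh
      have h2 : ∏ i ∈ H, (conjAt h z i).im = - ∏ i ∈ H, (z i).im := by
        rw [← Finset.mul_prod_erase H _ hh, ← Finset.mul_prod_erase H (fun i => (z i).im) hh,
          ← neg_mul]
        congr 1
        · simp [conjAt]
        · refine Finset.prod_congr rfl fun i hi => ?_
          simp [conjAt, Finset.ne_of_mem_erase hi]
      rw [h2]
      simp [hh, h1, inv_neg]
    · have h2 : ∏ i ∈ H, (conjAt h z i).im = ∏ i ∈ H, (z i).im := by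
        refine Finset.prod_congr rfl fun i hi => ?_
        have : i ≠ h := fun e => hh (e ▸ hi)
        simp [conjAt, this]
      rw [h2, smul_comm]
      simp [hh]
  · simp

/-! ### Products of variables and the stem functions of the components -/

/-- The components (real numbers) of the stem function of the ordered product of the variables
in `K`. -/
noncomputable def varCoef (K : Finset (Fin n)) (z : Fin n → ℂ) (L : Finset (Fin n)) : ℝ :=
  if L ⊆ K then ∏ i ∈ K, (if i ∈ L then (z i).im else (z i).re) else 0

/-- The stem function of the ordered product of the variables in `K`. -/
noncomputable def varStem (K : Finset (Fin n)) : StemMap n := fun z L => (varCoef K z L : ℍ[ℝ])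

/-- The stem function of the ordered product of the conjugates of the variables in `K`. -/
noncomputable def conjVarStem (K : Finset (Fin n)) : StemMap n :=
  fun z => varStem K (fun i => star (z i))

theorem varCoef_conjAt (K : Finset (Fin n)) (z : Fin n → ℂ) (h : Fin n) (L : Finset (Fin n)) :
    varCoef K (conjAt h z) L = (if h ∈ L then -1 else 1) * varCoef K z L := by
  unfold varCoef
  by_cases hL : L ⊆ K
  · simp only [hL, if_true]
    by_cases hh : h ∈ K
    · rw [← Finset.mul_prod_erase K _ hh,
        ← Finset.mul_prod_erase K (fun i => if i ∈ L then (z i).im else (z i).re) hh,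
        ← mul_assoc]
      congr 1
      · by_cases h' : h ∈ L <;> simp [conjAt, h']
      · refine Finset.prod_congr rfl fun i hi => ?_
        simp [conjAt, Finset.ne_of_mem_erase hi]
    · have h' : h ∉ L := fun h' => hh (hL h')
      simp only [h', if_false, one_mul]
      refine Finset.prod_congr rfl fun i hi => ?_
      have : i ≠ h := fun e => hh (e ▸ hi)
      simp [conjAt, this]
  · simp [hL]

theorem isStem_varStem (D : Set (Fin n → ℂ)) (K : Finset (Fin n)) : IsStem D (varStem K) := by
  intro z _ h L
  rw [neg_one_pow_card_inter_singleton, varStem, varCoef_conjAt, varStem, ← Quaternion.coe_smul,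
    smul_eq_mul]

theorem star_conjAt (z : Fin n → ℂ) (h : Fin n) :
    (fun i => star (conjAt h z i)) = conjAt h (fun i => star (z i)) := by
  funext i
  by_cases hi : i = h
  · subst hi; simp [conjAt]
  · simp [conjAt, hi]

theorem isStem_conjVarStem (D : Set (Fin n → ℂ)) (K : Finset (Fin n)) :
    IsStem D (conjVarStem K) := by
  intro z _ h L
  rw [conjVarStem, star_conjAt]
  exact isStem_varStem Set.univ K _ trivial h L

theorem ordProd_insert {K : Finset (Fin n)} {a : Fin n} (ha : ∀ b ∈ K, a < b)
    (q : Fin n → ℍ[ℝ]) : ordProd (insert a K) q = q a * ordProd K q := by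
  unfold ordProd
  rw [Finset.sort_insert (· ≤ ·) (fun b hb => (ha b hb).le) fun h => lt_irrefl _ (ha a h)]
  simp

/-- The product of the factors α_i + J_i β_i is expanded by adding the smallest index first from the
left, so that the units come out in increasing order; the real coefficients commute with everything.
-/
theorem ordProd_slicePt (K : Finset (Fin n)) (z : Fin n → ℂ) (J : Fin n → ℍ[ℝ]) :
    ordProd K (fun i => slicePt (J i) (z i))
      = ∑ L : Finset (Fin n), ordProd L J * (varCoef K z L : ℍ[ℝ]) := by
  have h0 : ∀ K : Finset (Fin n), ∑ L : Finset (Fin n), ordProd L J * (varCoef K z L : ℍ[ℝ])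
      = ∑ L ∈ K.powerset,
        (∏ i ∈ K, (if i ∈ L then (z i).im else (z i).re)) • ordProd L J := by
    intro K
    rw [← Finset.sum_subset (Finset.subset_univ K.powerset)]
    · refine Finset.sum_congr rfl fun L hL => ?_
      rw [varCoef, if_pos (Finset.mem_powerset.1 hL), Quaternion.mul_coe_eq_smul]
    · intro L _ hL
      rw [varCoef, if_neg (fun h => hL (Finset.mem_powerset.2 h))]
      simp
  rw [h0]
  induction K using Finset.induction_on_min with
  | empty => simp [ordProd]
  | insert a K ha ih =>
    have haK : a ∉ K := fun h => lt_irrefl _ (ha a h)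
    rw [ordProd_insert ha, ih, Finset.sum_powerset_insert haK, slicePt, add_mul, Finset.mul_sum,
      Finset.mul_sum]
    congr 1
    · refine Finset.sum_congr rfl fun L hL => ?_
      have haL : a ∉ L := fun h => haK (Finset.mem_powerset.1 hL h)
      rw [Finset.prod_insert haK, if_neg haL, Quaternion.coe_mul_eq_smul, smul_smul]
    · refine Finset.sum_congr rfl fun L hL => ?_
      have haL : a ∉ L := fun h => haK (Finset.mem_powerset.1 hL h)
      rw [Finset.prod_insert haK, if_pos (Finset.mem_insert_self _ _),
        ordProd_insert (fun b hb => ha b (Finset.mem_powerset.1 hL hb)), smul_mul_smul_comm]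
      congr 2
      refine Finset.prod_congr rfl fun i hi => ?_
      have : i ≠ a := fun e => haK (e ▸ hi)
      simp [this]

theorem induces_varStem (D : Set (Fin n → ℂ)) (K : Finset (Fin n)) :
    Induces D (varStem K) (fun x => ordProd K x) := fun z _ J _ => ordProd_slicePt K z J

theorem star_slicePt {J : ℍ[ℝ]} (h : J ∈ imUnits) (w : ℂ) :
    star (slicePt J w) = slicePt J (star w) := by
  have := (re_of_mem_imUnits h).1
  ext <;> simp [slicePt, this]

theorem induces_conjVarStem (D : Set (Fin n → ℂ)) (K : Finset (Fin n)) :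
    Induces D (conjVarStem K) (fun x => ordProd K (fun i => star (x i))) := by
  intro z _ J hJ
  simp only [star_slicePt (hJ _)]
  exact ordProd_slicePt K _ J

/-- For given L and T, only M = L Δ T satisfies L Δ M = T, and then L ∩ M = L \ T. This collapses
the double sum to a single one. -/
theorem stemMul_real_apply {r : Finset (Fin n) → ℝ} {E F : StemMap n} {z : Fin n → ℂ}
    (hE : ∀ L, E z L = (r L : ℍ[ℝ])) (T : Finset (Fin n)) :
    stemMul E F z T = ∑ L, ((-1) ^ (L \ T).card * r L) • F z (symmDiff L T) := by
  unfold stemMul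
  refine Finset.sum_congr rfl fun L _ => ?_
  rw [Finset.sum_eq_single (symmDiff L T)]
  · rw [if_pos (symmDiff_symmDiff_cancel_left L T), hE, Quaternion.coe_mul_eq_smul, smul_smul]
    congr 4
    ext i; simp [Finset.mem_symmDiff]; tauto
  · intro M _ hM
    rw [if_neg]
    rintro rfl
    exact hM (symmDiff_symmDiff_cancel_left L M).symm
  · simp

theorem stemMul_varStem_apply (K : Finset (Fin n)) (F : StemMap n) (z : Fin n → ℂ)
    (T : Finset (Fin n)) : stemMul (varStem K) F z T
      = ∑ L, ((-1) ^ (L \ T).card * varCoef K z L) • F z (symmDiff L T) :=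
  stemMul_real_apply (fun _ => rfl) T

/-- By uniqueness of stem functions, any F inducing f may replace the chosen ones in the definition.
-/
theorem almansi_eq {D : Set (Fin n → ℂ)} (hD : ConjInvariant D) {F : StemMap n}
    {f : (Fin n → ℍ[ℝ]) → ℍ[ℝ]} (hF : IsStem D F) (hf : Induces D F f) (H K : Finset (Fin n))
    {x : Fin n → ℍ[ℝ]} (hx : x ∈ circ D) :
    almansi D H K f x = inducedFn (stemDeriv H (stemMul (varStem K) F)) x := by
  have hz := (mem_circ_iff hD).1 hx
  have h1 : ∀ z ∈ D, stemMul (stem D fun x => ordProd K x) (stem D f) z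
      = stemMul (varStem K) F z := by
    intro z hz
    funext T
    simp only [stemMul, stem_eq hF hf z hz, stem_eq (isStem_varStem D K) (induces_varStem D K) z hz]
  have h2 : IsStem D (stemMul (stem D fun x => ordProd K x) (stem D f)) :=
    (stem_spec ⟨_, isStem_varStem D K, induces_varStem D K⟩).1.stemMul (stem_spec ⟨F, hF, hf⟩).1
  unfold almansi sphDeriv
  refine inducedFn_congr fun T => ?_
  unfold stemDeriv
  rw [sliceMul, stem_eq h2 (induces_inducedFn hD h2) _ hz, h1 _ hz]

theorem induces_almansi {D : Set (Fin n → ℂ)} (hD : ConjInvariant D) {F : StemMap n}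
    {f : (Fin n → ℍ[ℝ]) → ℍ[ℝ]} (hF : IsStem D F) (hf : Induces D F f) (H K : Finset (Fin n)) :
    IsStem (offReal D H) (stemDeriv H (stemMul (varStem K) F)) ∧
      Induces (offReal D H) (stemDeriv H (stemMul (varStem K) F)) (almansi D H K f) := by
  have h := ((isStem_varStem D K).stemMul hF).stemDeriv H
  exact ⟨h, (induces_inducedFn (hD.offReal H) h).congr fun x hx =>
    (almansi_eq hD hF hf H K (circ_mono (offReal_subset D H) hx)).symm⟩

/-! ### The decomposition as an inverse matrix -/

/-- The coefficients in the recovery of a stem function from the stem functions of its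
components. -/
noncomputable def recCoef (H K : Finset (Fin n)) (z : Fin n → ℂ) (V : Finset (Fin n)) : ℝ :=
  (∏ i ∈ K, if i ∈ V then 0 else 1) * ∏ i ∈ H \ K, if i ∈ V then (z i).im else -(z i).re

/-- The components of G that meet H vanish, so only L = V ∩ H survives in the product. A variable h
∈ H \ K contributes the entries of -x̄_h = -α + Jβ, namely β if h ∈ V and -α otherwise. A variable h
∈ K contributes the entries of the constant 1. These are the factors of `recCoef`. -/
theorem neg_one_pow_mul_conjVarStem {H K : Finset (Fin n)} (hK : K ⊆ H) {G : StemMap n}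
    {z : Fin n → ℂ} (hG : ∀ T, ¬ Disjoint T H → G z T = 0) (V : Finset (Fin n)) :
    (-1 : ℝ) ^ (H \ K).card • stemMul (conjVarStem (H \ K)) G z V
      = recCoef H K z V • G z (V \ H) := by
  rw [stemMul_real_apply (r := varCoef (H \ K) fun i => star (z i)) (fun _ => rfl),
    Finset.sum_eq_single (V ∩ H)]
  · have e1 : symmDiff (V ∩ H) V = V \ H := by
      ext i; simp [Finset.mem_symmDiff]; tauto
    have e2 : (V ∩ H) \ V = ∅ := by ext i; simp; tauto
    rw [e1, e2, smul_smul]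
    congr 1
    unfold recCoef varCoef
    by_cases hV : Disjoint K V
    · have h1 : V ∩ H ⊆ H \ K := by
        intro i hi
        rw [Finset.mem_inter] at hi
        exact Finset.mem_sdiff.2 ⟨hi.2, fun h => Finset.disjoint_left.1 hV h hi.1⟩
      have h2 : (∏ i ∈ K, if i ∈ V then (0 : ℝ) else 1) = 1 :=
        Finset.prod_eq_one fun i hi => if_neg (Finset.disjoint_left.1 hV hi)
      rw [if_pos h1, h2, Finset.card_empty, pow_zero, one_mul, one_mul, ← Finset.prod_const,
        ← Finset.prod_mul_distrib]
      refine Finset.prod_congr rfl fun i hi => ?_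
      have : i ∈ H := (Finset.mem_sdiff.1 hi).1
      by_cases hi : i ∈ V <;> simp [hi, this]
    · obtain ⟨i, hi, hi'⟩ := Finset.not_disjoint_iff.1 hV
      have h1 : (∏ i ∈ K, if i ∈ V then (0 : ℝ) else 1) = 0 :=
        Finset.prod_eq_zero hi (by simp [hi'])
      rw [if_neg, h1, zero_mul, mul_zero, mul_zero]
      intro h
      exact (Finset.mem_sdiff.1 (h (Finset.mem_inter.2 ⟨hi', hK hi⟩))).2 hi
  · intro L _ hL
    by_cases hLK : L ⊆ H \ K
    · rw [hG, smul_zero]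
      intro hdis
      apply hL
      ext i
      have h1 : i ∈ symmDiff L V → i ∉ H := fun h => Finset.disjoint_left.1 hdis h
      have h2 := fun h => (Finset.mem_sdiff.1 (hLK (x := i) h)).1
      rw [Finset.mem_symmDiff] at h1
      rw [Finset.mem_inter]
      tauto
    · simp [varCoef, hLK]
  · simp

theorem stemDeriv_eq_zero {H : Finset (Fin n)} (F : StemMap n) (z : Fin n → ℂ)
    {T : Finset (Fin n)} (hT : ¬ Disjoint T H) : stemDeriv H F z T = 0 := if_neg hT

/-- The sum over K is the expansion of a product of binomials, one for each i ∈ H. The i-th binomial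
is β_i if i lies in exactly one of M and V, and otherwise it is 0 + 0 or α_i - α_i. -/
theorem sum_recCoef_mul {H V M : Finset (Fin n)} (z : Fin n → ℂ) (hM : M ⊆ H) :
    ∑ K ∈ H.powerset, recCoef H K z V * varCoef K z M
      = if M = H \ V then ∏ i ∈ H, (z i).im else 0 := by
  have h1 : ∀ K ∈ H.powerset, recCoef H K z V * varCoef K z M
      = (∏ i ∈ K, (if i ∈ V then 0 else if i ∈ M then (z i).im else (z i).re)) *
        ∏ i ∈ H \ K, (if i ∈ M then 0 else if i ∈ V then (z i).im else -(z i).re) := by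
    intro K hK
    unfold recCoef varCoef
    by_cases hMK : M ⊆ K
    · rw [if_pos hMK, mul_right_comm, ← Finset.prod_mul_distrib]
      congr 1
      · exact Finset.prod_congr rfl fun i _ => by split_ifs <;> simp
      · refine Finset.prod_congr rfl fun i hi => ?_
        rw [if_neg fun h => (Finset.mem_sdiff.1 hi).2 (hMK h)]
    · obtain ⟨i, hi, hi'⟩ := Finset.not_subset.1 hMK
      have h2 : ∏ i ∈ H \ K, (if i ∈ M then 0 else if i ∈ V then (z i).im else -(z i).re) = 0 :=
        Finset.prod_eq_zero (Finset.mem_sdiff.2 ⟨hM hi, hi'⟩) (by simp [hi])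
      rw [if_neg hMK, mul_zero, h2, mul_zero]
  rw [Finset.sum_congr rfl h1, ← Finset.prod_add]
  split_ifs with h
  · refine Finset.prod_congr rfl fun i hi => ?_
    have h2 : i ∈ M ↔ i ∉ V := by rw [h]; simp [hi]
    by_cases hV : i ∈ V <;> simp [h2, hV]
  · obtain ⟨i, hi, hi'⟩ : ∃ i ∈ H, ¬ (i ∈ M ↔ i ∉ V) := by
      by_contra! hc
      refine h (Finset.ext fun i => ?_)
      rw [Finset.mem_sdiff]
      exact ⟨fun hi => ⟨hM hi, (hc i (hM hi)).1 hi⟩, fun hi => (hc i hi.1).2 hi.2⟩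
    refine Finset.prod_eq_zero hi ?_
    by_cases h1 : i ∈ M <;> by_cases h2 : i ∈ V <;> simp_all

/-- Only L ⊆ K ⊆ H contribute, and L \ (T ∪ H) is empty, so that all signs disappear. This is the
matrix that `recCoef` inverts. -/
theorem stemDeriv_varStem_apply {H K : Finset (Fin n)} (hK : K ⊆ H) (F : StemMap n)
    (z : Fin n → ℂ) {T : Finset (Fin n)} (hT : Disjoint T H) :
    stemDeriv H (stemMul (varStem K) F) z T
      = (∏ h ∈ H, (z h).im)⁻¹ • ∑ L ∈ H.powerset, varCoef K z L • F z (T ∪ (H \ L)) := by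
  rw [stemDeriv, if_pos hT, stemMul_varStem_apply]
  congr 1
  symm
  rw [← Finset.sum_subset (Finset.subset_univ H.powerset)]
  · refine Finset.sum_congr rfl fun L hL => ?_
    have hLH := Finset.mem_powerset.1 hL
    have e1 : L \ (T ∪ H) = ∅ := by
      rw [Finset.sdiff_eq_empty_iff_subset]; exact hLH.trans Finset.subset_union_right
    have e2 : symmDiff L (T ∪ H) = T ∪ (H \ L) := by
      ext i
      have h1 : i ∈ T → i ∉ H := fun h => Finset.disjoint_left.1 hT h
      have h2 := @hLH i
      simp only [Finset.mem_symmDiff, Finset.mem_union, Finset.mem_sdiff]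
      tauto
    rw [e1, e2]; simp
  · intro L _ hL
    have : ¬ L ⊆ K := fun h => hL (Finset.mem_powerset.2 (h.trans hK))
    simp [varCoef, this]

/-- The stem function is recovered from the stem functions of the components. -/
theorem sum_recCoef_smul (H : Finset (Fin n)) (F : StemMap n) {z : Fin n → ℂ}
    (hz : ∀ h ∈ H, (z h).im ≠ 0) (V : Finset (Fin n)) :
    ∑ K ∈ H.powerset, recCoef H K z V • stemDeriv H (stemMul (varStem K) F) z (V \ H)
      = F z V := by
  have hp : ∏ h ∈ H, (z h).im ≠ 0 := Finset.prod_ne_zero_iff.2 hz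
  have h1 : ∀ K ∈ H.powerset, recCoef H K z V • stemDeriv H (stemMul (varStem K) F) z (V \ H)
      = (∏ h ∈ H, (z h).im)⁻¹ • ∑ L ∈ H.powerset,
        (recCoef H K z V * varCoef K z L) • F z ((V \ H) ∪ (H \ L)) := by
    intro K hK
    rw [stemDeriv_varStem_apply (Finset.mem_powerset.1 hK) F z Finset.sdiff_disjoint, smul_comm,
      Finset.smul_sum]
    simp only [smul_smul]
  rw [Finset.sum_congr rfl h1, ← Finset.smul_sum, Finset.sum_comm]
  simp only [← Finset.sum_smul]
  have h2 : ∀ L ∈ H.powerset, (∑ K ∈ H.powerset, recCoef H K z V * varCoef K z L) •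
      F z ((V \ H) ∪ (H \ L))
      = if L = H \ V then (∏ i ∈ H, (z i).im) • F z ((V \ H) ∪ (H \ L)) else 0 := by
    intro L hL
    rw [sum_recCoef_mul z (Finset.mem_powerset.1 hL), ite_smul, zero_smul]
  rw [Finset.sum_congr rfl h2, Finset.sum_ite_eq' H.powerset (H \ V),
    if_pos (Finset.mem_powerset.2 Finset.sdiff_subset), smul_smul, inv_mul_cancel₀ hp, one_smul]
  congr 1
  ext i; simp; tauto

/-- The function-level form of a decomposition, given the stem-level form. -/
theorem decomposition_of_stem {D : Set (Fin n → ℂ)} (hD : ConjInvariant D) {F : StemMap n}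
    {f : (Fin n → ℍ[ℝ]) → ℍ[ℝ]} (hf : Induces D F f) {H : Finset (Fin n)}
    {G : Finset (Fin n) → StemMap n} {g : Finset (Fin n) → (Fin n → ℍ[ℝ]) → ℍ[ℝ]}
    (hG : ∀ K ⊆ H, IsStem D (G K)) (hg : ∀ K ⊆ H, Induces D (G K) (g K))
    (hG0 : ∀ K ⊆ H, ∀ z ∈ D, ∀ T, ¬ Disjoint T H → G K z T = 0)
    (hrec : ∀ z ∈ D, ∀ V, ∑ K ∈ H.powerset, recCoef H K z V • G K z (V \ H) = F z V)
    {x : Fin n → ℍ[ℝ]} (hx : x ∈ circ D) :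
    f x = ∑ K ∈ H.powerset, (-1 : ℝ) ^ (H \ K).card •
        sliceMul D (fun y => ordProd (H \ K) (fun i => star (y i))) (g K) x := by
  have hz := (mem_circ_iff hD).1 hx
  have h1 : ∀ K ∈ H.powerset, (-1 : ℝ) ^ (H \ K).card •
        sliceMul D (fun y => ordProd (H \ K) (fun i => star (y i))) (g K) x
      = ∑ V : Finset (Fin n), ordProd V (fun i => unitIm (x i)) *
        (recCoef H K (fun i => toC (x i)) V • G K (fun i => toC (x i)) (V \ H)) := by
    intro K hK
    have hK := Finset.mem_powerset.1 hK
    rw [sliceMul, inducedFn, Finset.smul_sum]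
    refine Finset.sum_congr rfl fun V _ => ?_
    rw [← neg_one_pow_mul_conjVarStem hK (hG0 K hK _ hz) V, mul_smul_comm]
    congr 2
    simp only [stemMul, stem_eq (hG K hK) (hg K hK) _ hz,
      stem_eq (isStem_conjVarStem D _) (induces_conjVarStem D (H \ K)) _ hz]
  rw [Finset.sum_congr rfl h1, Finset.sum_comm, hf.eq_inducedFn hD hx, inducedFn]
  refine Finset.sum_congr rfl fun V _ => ?_
  rw [← Finset.mul_sum, hrec _ hz]

/-! ### Circularity and sliceness in one variable -/

theorem toC_update (y : Fin n → ℍ[ℝ]) (h : Fin n) (q : ℍ[ℝ]) :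
    (fun i => toC (Function.update y h q i)) = Function.update (fun i => toC (y i)) h (toC q) := by
  funext i
  by_cases hi : i = h
  · subst hi; simp
  · simp [hi]

theorem unitIm_update (y : Fin n → ℍ[ℝ]) (h : Fin n) (q : ℍ[ℝ]) :
    (fun i => unitIm (Function.update y h q i))
      = Function.update (fun i => unitIm (y i)) h (unitIm q) := by
  funext i
  by_cases hi : i = h
  · subst hi; simp
  · simp [hi]

theorem ordProd_update_of_notMem {K : Finset (Fin n)} {h : Fin n} (hK : h ∉ K)
    (J : Fin n → ℍ[ℝ]) (q : ℍ[ℝ]) : ordProd K (Function.update J h q) = ordProd K J :=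
  ordProd_congr K fun _ hi => Function.update_of_ne (fun e : _ = h => hK (e ▸ hi)) _ _

/-- Along a sphere α + Jβ only the unit J_h changes, and it enters only through the terms whose
index contains h. -/
theorem isCircularIn_of_stem {D : Set (Fin n → ℂ)} (hD : ConjInvariant D) {G : StemMap n}
    {g : (Fin n → ℍ[ℝ]) → ℍ[ℝ]} (hG : IsStem D G) (hg : Induces D G g) {h : Fin n}
    (hG0 : ∀ z ∈ D, ∀ T, h ∈ T → G z T = 0) : IsCircularIn D h g := by
  refine ⟨⟨G, hG, hg⟩, fun y _ w J hJ J' hJ' hx hx' => ?_⟩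
  rw [hg.eq_inducedFn hD hx, hg.eq_inducedFn hD hx']
  have e : toC (slicePt J w) = toC (slicePt J' w) := by rw [toC_slicePt hJ, toC_slicePt hJ']
  have hz := (mem_circ_iff hD).1 hx
  unfold inducedFn
  refine Finset.sum_congr rfl fun T _ => ?_
  rw [toC_update, toC_update, ← e]
  rw [toC_update] at hz
  by_cases hT : h ∈ T
  · rw [hG0 _ hz T hT, mul_zero, mul_zero]
  · rw [unitIm_update, unitIm_update, ordProd_update_of_notMem hT, ordProd_update_of_notMem hT]

theorem slicePt_update (J : Fin n → ℍ[ℝ]) (z : Fin n → ℂ) (h : Fin n) (I : ℍ[ℝ]) (w : ℂ) :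
    (fun i => slicePt (Function.update J h I i) (Function.update z h w i))
      = Function.update (fun i => slicePt (J i) (z i)) h (slicePt I w) := by
  funext i
  by_cases hi : i = h
  · subst hi; simp
  · simp [hi]

theorem update_mem_imUnits {J : Fin n → ℍ[ℝ]} (hJ : ∀ i, J i ∈ imUnits) (h : Fin n) {I : ℍ[ℝ]}
    (hI : I ∈ imUnits) (i : Fin n) : Function.update J h I i ∈ imUnits := by
  by_cases hi : i = h
  · subst hi; simpa
  · simpa [hi] using hJ i

theorem mem_sectionSet {D : Set (Fin n → ℂ)} (hD : ConjInvariant D) {h : Fin n}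
    {J : Fin n → ℍ[ℝ]} (hJ : ∀ i, J i ∈ imUnits) {z : Fin n → ℂ} {w : Fin 1 → ℂ} :
    w ∈ sectionSet D h (fun i => slicePt (J i) (z i)) ↔ Function.update z h (w 0) ∈ D := by
  have key : ∀ I ∈ imUnits, Function.update (fun i => slicePt (J i) (z i)) h (slicePt I (w 0))
      ∈ circ D ↔ Function.update z h (w 0) ∈ D := by
    intro I hI
    rw [← slicePt_update, mem_circ_iff hD, toC_slicePt_mem hD (update_mem_imUnits hJ h hI)]
  exact ⟨fun H => (key _ iUnit_mem).1 (H _ iUnit_mem), fun H I hI => (key I hI).2 H⟩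

/-- The stem function of one variable inducing the restriction to the variable `x_p`, the other
variables being fixed, of a slice function whose stem function `G` has no components with an index
below `p`. -/
noncomputable def sectionStem (p : Fin n) (J : Fin n → ℍ[ℝ]) (z : Fin n → ℂ) (G : StemMap n) :
    StemMap 1 := fun w S =>
  ∑ T : Finset (Fin n) with p ∉ T, ordProd T J *
    G (Function.update z p (w 0)) (if 0 ∈ S then insert p T else T)

theorem isStem_sectionStem {D : Set (Fin n → ℂ)} (hD : ConjInvariant D) {G : StemMap n}
    (hG : IsStem D G) (p : Fin n) {J : Fin n → ℍ[ℝ]} (hJ : ∀ i, J i ∈ imUnits)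
    (z : Fin n → ℂ) :
    IsStem (sectionSet D p (fun i => slicePt (J i) (z i))) (sectionStem p J z G) := by
  intro w hw h S
  rw [mem_sectionSet hD hJ] at hw
  obtain rfl : h = 0 := Subsingleton.elim _ _
  rw [neg_one_pow_card_inter_singleton]
  unfold sectionStem
  rw [Finset.smul_sum]
  refine Finset.sum_congr rfl fun T hT => ?_
  have hT : p ∉ T := (Finset.mem_filter.1 hT).2
  have e : Function.update z p (conjAt 0 w 0) = conjAt p (Function.update z p (w 0)) := by
    simp [conjAt]
  rw [e, hG.conjAt_apply hw, ← mul_smul_comm]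
  by_cases h0 : 0 ∈ S <;> simp [h0, hT]

theorem sum_finset_split {M : Type*} [AddCommMonoid M] (p : Fin n) (φ : Finset (Fin n) → M) :
    ∑ T, φ T = ∑ T : Finset (Fin n) with p ∉ T, (φ T + φ (insert p T)) := by
  rw [Finset.sum_add_distrib, ← Finset.sum_filter_add_sum_filter_not Finset.univ (fun T => p ∉ T)]
  congr 1
  refine Finset.sum_nbij' (fun T => T.erase p) (fun T => insert p T) ?_ ?_ ?_ ?_ ?_
  · intro T _; simp
  · intro T _; simp
  · intro T hT
    exact Finset.insert_erase (by simpa using hT)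
  · intro T hT
    exact Finset.erase_insert (by simpa using hT)
  · intro T hT
    rw [Finset.insert_erase (by simpa using hT)]

/-- Since the units do not commute, the restriction to x_p is a slice function of one variable only
if J_p can be moved to the far left. The vanishing of all components with an index below p
guarantees this. -/
theorem induces_sectionStem {D : Set (Fin n → ℂ)} (hD : ConjInvariant D) {G : StemMap n}
    {g : (Fin n → ℍ[ℝ]) → ℍ[ℝ]} (hg : Induces D G g) {p : Fin n}
    (hG0 : ∀ z ∈ D, ∀ T, (∃ i ∈ T, i < p) → G z T = 0)
    {J : Fin n → ℍ[ℝ]} (hJ : ∀ i, J i ∈ imUnits) (z : Fin n → ℂ) :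
    Induces (sectionSet D p (fun i => slicePt (J i) (z i))) (sectionStem p J z G)
      (restrictVar g p (fun i => slicePt (J i) (z i))) := by
  intro w hw I hI
  rw [mem_sectionSet hD hJ] at hw
  rw [restrictVar, ← slicePt_update, hg _ hw _ (update_mem_imUnits hJ p (hI 0)),
    sum_finset_split p, sum_finset_split 0]
  have e0 : ({T : Finset (Fin 1) | 0 ∉ T} : Finset (Finset (Fin 1))) = {∅} := by decide
  rw [e0, Finset.sum_singleton]
  have e1 : ordProd (∅ : Finset (Fin 1)) I = 1 := by simp [ordProd]
  have e2 : ordProd (insert 0 ∅ : Finset (Fin 1)) I = I 0 := by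
    rw [ordProd_insert (by simp), e1, mul_one]
  rw [e1, e2, one_mul, sectionStem, sectionStem, Finset.mul_sum, ← Finset.sum_add_distrib]
  refine Finset.sum_congr rfl fun T hT => ?_
  have hT : p ∉ T := (Finset.mem_filter.1 hT).2
  simp only [Finset.notMem_empty, if_false, Finset.mem_insert, true_or, if_true]
  rw [ordProd_update_of_notMem hT]
  congr 1
  -- Either T has an index below p, and the term is zero, or p is smaller than all of T, and J_p is
  -- the first factor of the ordered product.
  by_cases hlt : ∃ i ∈ T, i < p
  · rw [hG0 _ hw _ (by obtain ⟨i, hi, h⟩ := hlt; exact ⟨i, Finset.mem_insert_of_mem hi, h⟩)]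
    simp
  · push Not at hlt
    rw [ordProd_insert fun b hb => lt_of_le_of_ne (hlt b hb) fun e => hT (e ▸ hb),
      Function.update_self, ordProd_update_of_notMem hT, mul_assoc]

theorem isSliceIn_of_stem {D : Set (Fin n → ℂ)} (hD : ConjInvariant D) {G : StemMap n}
    {g : (Fin n → ℍ[ℝ]) → ℍ[ℝ]} (hG : IsStem D G) (hg : Induces D G g) {p : Fin n}
    (hG0 : ∀ z ∈ D, ∀ T, (∃ i ∈ T, i < p) → G z T = 0) : IsSliceIn D p g := by
  refine ⟨⟨G, hG, hg⟩, ?_⟩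
  rintro y ⟨z, _, J, hJ, rfl⟩
  exact ⟨_, isStem_sectionStem hD hG p hJ z, induces_sectionStem hD hg hG0 hJ z⟩

/-- Every index below the least element of Hᶜ belongs to H. -/
theorem not_disjoint_of_isLeast {H : Finset (Fin n)} {p : Fin n} (hp : IsLeast {i | i ∉ H} p)
    {T : Finset (Fin n)} (hT : ∃ i ∈ T, i < p) : ¬ Disjoint T H := by
  obtain ⟨i, hi, hip⟩ := hT
  refine Finset.not_disjoint_iff.2 ⟨i, hi, ?_⟩
  by_contra h
  exact absurd (hp.2 h) (not_le.2 hip)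

/-! ### Real-valued components -/

theorem isSlicePreserving_iff {D : Set (Fin n → ℂ)} {F : StemMap n}
    {f : (Fin n → ℍ[ℝ]) → ℍ[ℝ]} (hF : IsStem D F) (hf : Induces D F f) :
    IsSlicePreserving D f ↔ ∀ z ∈ D, ∀ K, ∃ r : ℝ, F z K = (r : ℍ[ℝ]) := by
  constructor
  · rintro ⟨F', _, hf', h⟩ z hz
    rw [stem_unique hf hf' z hz]
    exact h z hz
  · exact fun h => ⟨F, hF, hf, h⟩

theorem exists_coe_sum {ι : Type*} {s : Finset ι} {q : ι → ℍ[ℝ]}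
    (h : ∀ i ∈ s, ∃ r : ℝ, q i = (r : ℍ[ℝ])) : ∃ r : ℝ, ∑ i ∈ s, q i = (r : ℍ[ℝ]) := by
  choose! r hr using h
  refine ⟨∑ i ∈ s, r i, ?_⟩
  rw [Finset.sum_congr rfl hr]
  exact (map_sum (algebraMap ℝ ℍ[ℝ]) r s).symm

theorem exists_coe_smul (c : ℝ) {q : ℍ[ℝ]} (h : ∃ r : ℝ, q = (r : ℍ[ℝ])) :
    ∃ r : ℝ, c • q = (r : ℍ[ℝ]) := by
  obtain ⟨r, rfl⟩ := h
  exact ⟨c • r, (Quaternion.coe_smul c r).symm⟩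

theorem inducedFn_stemDeriv_univ (F : StemMap n) (x : Fin n → ℍ[ℝ]) :
    inducedFn (stemDeriv Finset.univ F) x
      = stemDeriv Finset.univ F (fun i => toC (x i)) ∅ := by
  unfold inducedFn
  rw [Finset.sum_eq_single ∅]
  · simp [ordProd]
  · intro T _ hT
    rw [stemDeriv_eq_zero, mul_zero]
    exact fun h => hT (by simpa using disjoint_top.1 h)
  · simp

/-- For H = {1, …, n} a component is a single real combination of the F_K, with no units left, and
the inverse passage through `recCoef` is also real. -/
theorem real_iff_almansi_real {D : Set (Fin n → ℂ)} (hD : ConjInvariant D) {F : StemMap n}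
    {f : (Fin n → ℍ[ℝ]) → ℍ[ℝ]} (hF : IsStem D F) (hf : Induces D F f) :
    (∀ z ∈ offReal D Finset.univ, ∀ K, ∃ r : ℝ, F z K = (r : ℍ[ℝ])) ↔
      ∀ K : Finset (Fin n), ∀ x ∈ circ (offReal D Finset.univ),
        ∃ r : ℝ, almansi D Finset.univ K f x = (r : ℍ[ℝ]) := by
  have key : ∀ K x, x ∈ circ (offReal D Finset.univ) → almansi D Finset.univ K f x
      = stemDeriv Finset.univ (stemMul (varStem K) F) (fun i => toC (x i)) ∅ := by
    intro K x hx
    rw [almansi_eq hD hF hf _ _ (circ_mono (offReal_subset D _) hx), inducedFn_stemDeriv_univ]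
  constructor
  · intro h K x hx
    rw [key K x hx,
      stemDeriv_varStem_apply (Finset.subset_univ K) F _ (Finset.disjoint_empty_left _)]
    exact exists_coe_smul _ (exists_coe_sum fun L _ => exists_coe_smul _
      (h _ ((mem_circ_iff (hD.offReal _)).1 hx) _))
  · intro h z hz V
    have hz' : z ∈ offReal D Finset.univ := hz
    rw [← sum_recCoef_smul Finset.univ F hz.2 V]
    refine exists_coe_sum fun K _ => exists_coe_smul _ ?_
    have e : V \ Finset.univ = ∅ := by simp
    rw [e]
    have hx := slicePt_mem_circ hz (J := fun _ => iUnit) (fun _ => iUnit_mem)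
    obtain ⟨r, hr⟩ := h K _ hx
    rw [(induces_almansi hD hF hf _ K).2 z hz _ (fun _ => iUnit_mem),
      Finset.sum_eq_single ∅] at hr
    · exact ⟨r, by simpa [ordProd] using hr⟩
    · intro T _ hT
      rw [stemDeriv_eq_zero, mul_zero]
      exact fun h => hT (by simpa using disjoint_top.1 h)
    · simp

end SliceAnalysis

/-! ### Inversion by sign changes, continuity, density off the real points -/

namespace SliceAnalysis

open Filter Topology

variable {n : ℕ}

theorem norm_ordProd_of_mem {J : Fin n → ℍ[ℝ]} (hJ : ∀ i, J i ∈ imUnits)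
    (K : Finset (Fin n)) : ‖ordProd K J‖ = 1 := by
  have key : ∀ l : List (Fin n), ‖(l.map J).prod‖ = 1 := by
    intro l
    induction l with
    | nil => simp
    | cons a l ih => simp [ih, (re_of_mem_imUnits (hJ a)).2]
  exact key _

theorem ordProd_ne_zero {J : Fin n → ℍ[ℝ]} (hJ : ∀ i, J i ∈ imUnits) (K : Finset (Fin n)) :
    ordProd K J ≠ 0 := fun h => by
  have := norm_ordProd_of_mem hJ K
  rw [h, norm_zero] at this
  exact zero_ne_one this

/-- `1` off `E` and `-1` on `E`. -/
def signOn (E : Finset (Fin n)) (i : Fin n) : ℝ := if i ∈ E then -1 else 1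

theorem prod_signOn_comm (E K : Finset (Fin n)) :
    ∏ i ∈ K, signOn E i = ∏ i ∈ E, signOn K i := by
  simp only [signOn, ← Finset.prod_filter, Finset.prod_const]
  congr 2
  ext i; simp [and_comm]

/-- Orthogonality of the characters of the group (ℤ/2)ⁿ. -/
theorem sum_prod_signOn (S K : Finset (Fin n)) :
    ∑ E : Finset (Fin n), (∏ i ∈ S, signOn E i) * ∏ i ∈ K, signOn E i
      = if K = S then 2 ^ n else 0 := by
  have h1 : ∀ E : Finset (Fin n), (∏ i ∈ S, signOn E i) * ∏ i ∈ K, signOn E i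
      = (∏ i ∈ E, signOn S i * signOn K i) * ∏ i ∈ Eᶜ, (1 : ℝ) := by
    intro E
    rw [prod_signOn_comm, prod_signOn_comm E K, Finset.prod_const_one, mul_one,
      Finset.prod_mul_distrib]
  rw [Finset.sum_congr rfl fun E _ => h1 E, ← Fintype.prod_add]
  split_ifs with h
  · subst h
    have : ∀ i, signOn K i * signOn K i + 1 = 2 := by
      intro i; unfold signOn; split_ifs <;> norm_num
    simp [this]
  · obtain ⟨i, hi⟩ : ∃ i, ¬ (i ∈ K ↔ i ∈ S) := by
      by_contra! hc
      exact h (Finset.ext hc)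
    refine Finset.prod_eq_zero (Finset.mem_univ i) ?_
    unfold signOn
    by_cases h1 : i ∈ S <;> by_cases h2 : i ∈ K <;> simp_all

/-- Changing the signs of the units in E multiplies J_K by a character of E, so Fourier inversion
over all E isolates the single term with index S. -/
theorem sum_signOn_ordProd (c : Finset (Fin n) → ℍ[ℝ]) (J : Fin n → ℍ[ℝ])
    (S : Finset (Fin n)) :
    ∑ E : Finset (Fin n), (∏ i ∈ S, signOn E i) •
      ∑ K : Finset (Fin n), ordProd K (fun i => signOn E i • J i) * c K
      = (2 : ℝ) ^ n • (ordProd S J * c S) := by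
  simp only [ordProd_smul, Finset.smul_sum, smul_mul_assoc, smul_smul]
  rw [Finset.sum_comm]
  simp only [← Finset.sum_smul, sum_prod_signOn, ite_smul, zero_smul, Finset.sum_ite_eq',
    Finset.mem_univ, if_true]

theorem signOn_smul_mem (E : Finset (Fin n)) {J : ℍ[ℝ]} (hJ : J ∈ imUnits) (i : Fin n) :
    signOn E i • J ∈ imUnits := by
  have : J * J = -1 := hJ
  change (signOn E i • J) * (signOn E i • J) = -1
  unfold signOn
  split_ifs <;> simp [this]

/-- A linear combination of the values of a slice function gives a component of its stem
function. -/
theorem Induces.stem_apply {D : Set (Fin n → ℂ)} {F : StemMap n}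
    {f : (Fin n → ℍ[ℝ]) → ℍ[ℝ]} (hf : Induces D F f) {z : Fin n → ℂ} (hz : z ∈ D)
    (S : Finset (Fin n)) :
    F z S = (ordProd S fun _ => iUnit)⁻¹ * (((2 : ℝ) ^ n)⁻¹ •
      ∑ E : Finset (Fin n), (∏ i ∈ S, signOn E i) •
        f (fun i => slicePt (signOn E i • iUnit) (z i))) := by
  have h1 : ∀ E : Finset (Fin n), f (fun i => slicePt (signOn E i • iUnit) (z i))
      = ∑ K : Finset (Fin n), ordProd K (fun i => signOn E i • iUnit) * F z K :=
    fun E => hf z hz _ (signOn_smul_mem E iUnit_mem)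
  simp only [h1]
  rw [sum_signOn_ordProd, smul_smul, inv_mul_cancel₀ (by positivity), one_smul, ← mul_assoc,
    inv_mul_cancel₀ (ordProd_ne_zero (fun _ => iUnit_mem) S), one_mul]

theorem continuous_slicePt (J : ℍ[ℝ]) : Continuous (slicePt J) := by
  unfold slicePt
  exact (Quaternion.continuous_coe.comp Complex.continuous_re).add
    (Complex.continuous_im.smul continuous_const)

/-- The stem function of a continuous slice function is continuous. -/
theorem Induces.continuousOn_stem {D : Set (Fin n → ℂ)} {F : StemMap n}
    {f : (Fin n → ℍ[ℝ]) → ℍ[ℝ]} (hf : Induces D F f) (hc : ContinuousOn f (circ D))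
    (S : Finset (Fin n)) : ContinuousOn (fun z => F z S) D := by
  refine ContinuousOn.congr ?_ fun z hz => hf.stem_apply hz S
  have h1 : ∀ E : Finset (Fin n), ContinuousOn
      (fun z : Fin n → ℂ => f (fun i => slicePt (signOn E i • iUnit) (z i))) D := by
    intro E
    refine hc.comp (f := fun z : Fin n → ℂ => fun i => slicePt (signOn E i • iUnit) (z i)) ?_ ?_
    · exact (continuous_pi fun i => (continuous_slicePt _).comp (continuous_apply i)).continuousOn
    · exact fun z hz => slicePt_mem_circ hz (signOn_smul_mem E iUnit_mem)
  exact continuousOn_const.fun_mul (continuousOn_const.fun_smul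
    (continuousOn_finsetSum _ fun E _ => continuousOn_const.fun_smul (h1 E)))

theorem continuous_toC : Continuous toC := by
  have : toC = fun q : ℍ[ℝ] => (q.re : ℂ) + (‖q.im‖ : ℂ) * Complex.I := by
    funext q
    apply Complex.ext <;> simp [toC]
  rw [this]
  exact (Complex.continuous_ofReal.comp Quaternion.continuous_re).add
    ((Complex.continuous_ofReal.comp Quaternion.continuous_im.norm).mul continuous_const)

theorem continuousAt_unitIm {q : ℍ[ℝ]} (hq : q.im ≠ 0) : ContinuousAt unitIm q := by
  have h1 : ContinuousAt (fun q : ℍ[ℝ] => ‖q.im‖⁻¹ • q.im) q :=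
    (Quaternion.continuous_im.norm.continuousAt.inv₀ (norm_ne_zero_iff.2 hq)).smul
      Quaternion.continuous_im.continuousAt
  refine h1.congr ?_
  filter_upwards [Quaternion.continuous_im.continuousAt.eventually_ne hq] with p hp
  rw [unitIm, if_neg hp]

theorem continuousAt_ordProd {x : Fin n → ℍ[ℝ]} {K : Finset (Fin n)}
    (hx : ∀ i ∈ K, (x i).im ≠ 0) :
    ContinuousAt (fun x : Fin n → ℍ[ℝ] => ordProd K (fun i => unitIm (x i))) x := by
  have key : ∀ l : List (Fin n), (∀ i ∈ l, (x i).im ≠ 0) →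
      ContinuousAt (fun x : Fin n → ℍ[ℝ] => (l.map fun i => unitIm (x i)).prod) x := by
    intro l
    induction l with
    | nil => intro _; simpa using continuousAt_const
    | cons a l ih =>
      intro h
      simp only [List.map_cons, List.prod_cons]
      have ha : ContinuousAt (fun x : Fin n → ℍ[ℝ] => unitIm (x a)) x :=
        ContinuousAt.comp (f := fun x : Fin n → ℍ[ℝ] => x a) (g := unitIm)
          (continuousAt_unitIm (h a (by simp))) (continuous_apply a).continuousAt
      exact ha.mul (ih fun i hi => h i (by simp [hi]))
  exact key _ fun i hi => hx i (by simpa using hi)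

/-- The function induced by a continuous stem function is continuous. -/
theorem continuousOn_inducedFn {D : Set (Fin n → ℂ)} (hD : ConjInvariant D) {F : StemMap n}
    (hF : IsStem D F) (hc : ∀ S, ContinuousOn (fun z => F z S) D) :
    ContinuousOn (inducedFn F) (circ D) := by
  refine continuousOn_finsetSum _ fun K _ => fun x hx => ?_
  have hz := (mem_circ_iff hD).1 hx
  have hFc : ContinuousWithinAt (fun x : Fin n → ℍ[ℝ] => F (fun i => toC (x i)) K) (circ D) x :=
    ((hc K).comp (continuous_pi fun i => continuous_toC.comp (continuous_apply i)).continuousOn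
      fun y hy => (mem_circ_iff hD).1 hy) x hx
  by_cases h : ∀ i ∈ K, (x i).im ≠ 0
  · exact (continuousAt_ordProd h).continuousWithinAt.mul hFc
  · push Not at h
    -- At a point with a real i-th coordinate, i ∈ K, the unit need not be continuous. But F_K
    -- vanishes there and J_K has norm 1, so the term tends to zero.
    obtain ⟨i, hi, hxi⟩ := h
    have h0 : F (fun i => toC (x i)) K = 0 := hF.eq_zero_of_im hz hi (by simp [toC, hxi])
    unfold ContinuousWithinAt at hFc ⊢
    beta_reduce at hFc ⊢
    rw [h0] at hFc ⊢
    rw [mul_zero]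
    refine squeeze_zero_norm (fun y => ?_) (tendsto_zero_iff_norm_tendsto_zero.1 hFc)
    rw [norm_mul, norm_ordProd_of_mem (fun i => unitIm_mem _), one_mul]

/-- Shifting all coordinates by it with small t > 0 makes every one of them nonreal. -/
theorem subset_closure_offReal {D : Set (Fin n → ℂ)} (hD : IsOpen D) (H : Finset (Fin n)) :
    D ⊆ closure (offReal D H) := by
  intro z hz
  have h1 : Tendsto (fun t : ℝ => fun i => z i + t * Complex.I) (𝓝[>] 0) (𝓝 z) := by
    have : Continuous (fun t : ℝ => fun i => z i + t * Complex.I) := by fun_prop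
    have h := this.tendsto 0
    simp only [Complex.ofReal_zero, zero_mul, add_zero] at h
    exact h.mono_left nhdsWithin_le_nhds
  refine mem_closure_of_tendsto h1 ?_
  have h2 : ∀ i : Fin n, ∀ᶠ t : ℝ in 𝓝[>] 0, (z i).im + t ≠ 0 := by
    intro i
    by_cases hi : (z i).im = 0
    · filter_upwards [self_mem_nhdsWithin] with t ht
      rw [hi, zero_add]
      exact ne_of_gt ht
    · have : ContinuousAt (fun t : ℝ => (z i).im + t) 0 := by fun_prop
      exact (this.eventually_ne (by simpa using hi)).filter_mono nhdsWithin_le_nhds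
  filter_upwards [h1.eventually (hD.mem_nhds hz), eventually_all.2 h2] with t ht ht'
  refine ⟨ht, fun h _ => ?_⟩
  simpa using ht' h

theorem real_on_of_real_on_dense {D D' : Set (Fin n → ℂ)} {φ : (Fin n → ℂ) → ℍ[ℝ]}
    (hφ : ContinuousOn φ D) (hD' : D' ⊆ D) (hD : D ⊆ closure D')
    (h : ∀ z ∈ D', ∃ r : ℝ, φ z = (r : ℍ[ℝ])) : ∀ z ∈ D, ∃ r : ℝ, φ z = (r : ℍ[ℝ]) := by
  have h1 : Set.EqOn φ (fun z => ((φ z).re : ℍ[ℝ])) D' := by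
    intro z hz
    obtain ⟨r, hr⟩ := h z hz
    simp [hr]
  have h2 := h1.of_subset_closure hφ
    (Quaternion.continuous_coe.comp_continuousOn (Quaternion.continuous_re.comp_continuousOn hφ))
    hD' hD
  exact fun z hz => ⟨_, h2 hz⟩

theorem isSlicePreserving_iff_of_dense {D : Set (Fin n → ℂ)} {F : StemMap n}
    {f : (Fin n → ℍ[ℝ]) → ℍ[ℝ]} (hF : IsStem D F) (hf : Induces D F f)
    (hc : ContinuousOn f (circ D)) {H : Finset (Fin n)} (hd : D ⊆ closure (offReal D H)) :
    IsSlicePreserving D f ↔ IsSlicePreserving (offReal D H) f := by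
  rw [isSlicePreserving_iff hF hf, isSlicePreserving_iff (hF.mono (offReal_subset D H))
    (hf.mono (offReal_subset D H))]
  refine ⟨fun h z hz => h z hz.1, fun h z hz K => ?_⟩
  exact real_on_of_real_on_dense (hf.continuousOn_stem hc K) (offReal_subset D H) hd
    (fun z hz => h z hz K) z hz

end SliceAnalysis

/-! ### Separate holomorphy together with joint continuity -/

namespace SliceAnalysis

open Filter Topology Function

variable {n : ℕ}

theorem continuous_update_pair (a : Fin n) :
    Continuous fun p : (Fin n → ℂ) × ℂ => update p.1 a p.2 :=
  continuous_fst.update a continuous_snd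

theorem isOpen_section {D : Set (Fin n → ℂ)} (hD : IsOpen D) (a : Fin n) (z : Fin n → ℂ) :
    IsOpen {w | update z a w ∈ D} :=
  hD.preimage (continuous_const.update a continuous_id)

theorem update_mem_ball {z₀ z : Fin n → ℂ} {r : ℝ} (hz : z ∈ Metric.ball z₀ r) {a : Fin n}
    {w : ℂ} (hw : w ∈ Metric.ball (z₀ a) r) : update z a w ∈ Metric.ball z₀ r := by
  have hr : 0 < r := dist_nonneg.trans_lt hz
  rw [Metric.mem_ball, dist_pi_lt_iff hr] at hz ⊢
  intro i
  by_cases hi : i = a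
  · subst hi; simpa using hw
  · simpa [hi] using hz i

theorem apply_mem_ball {z₀ z : Fin n → ℂ} {r : ℝ} (hz : z ∈ Metric.ball z₀ r) (a : Fin n) :
    z a ∈ Metric.ball (z₀ a) r :=
  (dist_le_pi_dist z z₀ a).trans_lt hz

/-- Near a point of an open set, a continuous function depends on its parameters locally
uniformly. -/
theorem tendstoLocallyUniformlyOn_update {D : Set (Fin n → ℂ)} {φ : (Fin n → ℂ) → ℂ}
    (hφ : ContinuousOn φ D) (a : Fin n) {z₀ : Fin n → ℂ} {r : ℝ}
    (hr : 0 < r) (hrD : Metric.ball z₀ r ⊆ D) :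
    TendstoLocallyUniformlyOn (fun z w => φ (update z a w)) (fun w => φ (update z₀ a w)) (𝓝 z₀)
      (Metric.ball (z₀ a) r) := by
  have hz₀ : z₀ ∈ Metric.ball z₀ r := Metric.mem_ball_self hr
  rw [Metric.tendstoLocallyUniformlyOn_iff]
  intro ε hε w hw
  have hmem := update_mem_ball hz₀ hw
  have hφc : ContinuousAt φ (update z₀ a w) :=
    hφ.continuousAt (mem_of_superset (Metric.isOpen_ball.mem_nhds hmem) hrD)
  have h1 : ContinuousAt (fun p : (Fin n → ℂ) × ℂ => φ (update p.1 a p.2)) (z₀, w) :=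
    ContinuousAt.comp (f := fun p : (Fin n → ℂ) × ℂ => update p.1 a p.2) hφc
      (continuous_update_pair a).continuousAt
  have h2 : ContinuousAt (fun p : (Fin n → ℂ) × ℂ => φ (update z₀ a p.2)) (z₀, w) :=
    ContinuousAt.comp (f := fun p : (Fin n → ℂ) × ℂ => update z₀ a p.2) hφc
      (continuous_const.update a continuous_snd).continuousAt
  have h3 := (h2.dist h1).eventually_lt (continuousAt_const (y := ε)) (by simpa using hε)
  rw [nhds_prod_eq] at h3
  obtain ⟨p, hp, q, hq, hpq⟩ := eventually_prod_iff.1 h3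
  exact ⟨{y | q y}, mem_nhdsWithin_of_mem_nhds hq, hp.mono fun z hz y hy => hpq hz hy⟩

/-- As the parameters tend to z₀, the sections in z_a converge locally uniformly. By Weierstrass so
do their derivatives, and these may then be evaluated at the moving point z_a. -/
theorem continuousOn_deriv_update {D : Set (Fin n → ℂ)} (hD : IsOpen D)
    {φ : (Fin n → ℂ) → ℂ} (hφ : ContinuousOn φ D) (a : Fin n)
    (hd : ∀ z ∈ D, DifferentiableAt ℂ (fun w => φ (update z a w)) (z a)) :
    ContinuousOn (fun z => deriv (fun w => φ (update z a w)) (z a)) D := by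
  intro z₀ hz₀
  obtain ⟨r, hr, hrD⟩ := Metric.isOpen_iff.1 hD z₀ hz₀
  have hdiff : ∀ z ∈ Metric.ball z₀ r,
      DifferentiableOn ℂ (fun w => φ (update z a w)) (Metric.ball (z₀ a) r) := by
    intro z hz w hw
    have := hd _ (hrD (update_mem_ball hz hw))
    simp only [update_idem, update_self] at this
    exact this.differentiableWithinAt
  have hlim := (tendstoLocallyUniformlyOn_update hφ a hr hrD).deriv
    (eventually_of_mem (Metric.ball_mem_nhds z₀ hr) hdiff) Metric.isOpen_ball
  have hcont : ContinuousWithinAt (deriv fun w => φ (update z₀ a w)) (Metric.ball (z₀ a) r)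
      (z₀ a) :=
    ((hdiff z₀ (Metric.mem_ball_self hr)).deriv Metric.isOpen_ball).continuousOn _
      (Metric.mem_ball_self hr)
  have hg : Tendsto (fun z : Fin n → ℂ => z a) (𝓝 z₀) (𝓝[Metric.ball (z₀ a) r] (z₀ a)) := by
    rw [Metric.isOpen_ball.nhdsWithin_eq (Metric.mem_ball_self hr)]
    exact (continuous_apply a).tendsto z₀
  have := hlim.tendsto_comp hcont (Metric.mem_ball_self hr) hg
  exact ContinuousAt.continuousWithinAt this

/-- Holomorphy in one variable passes from a dense subset, saturated with respect to this
variable, to the whole of the domain. -/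
theorem differentiableAt_update_of_dense {D D' : Set (Fin n → ℂ)} (hD : IsOpen D)
    {φ : (Fin n → ℂ) → ℂ} (hφ : ContinuousOn φ D) (a : Fin n) (hdense : D ⊆ closure D')
    (hsat : ∀ z ∈ D', ∀ w, update z a w ∈ D → update z a w ∈ D')
    (hd : ∀ z ∈ D', DifferentiableAt ℂ (fun w => φ (update z a w)) (z a)) :
    ∀ z ∈ D, DifferentiableAt ℂ (fun w => φ (update z a w)) (z a) := by
  intro z₀ hz₀
  obtain ⟨r, hr, hrD⟩ := Metric.isOpen_iff.1 hD z₀ hz₀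
  -- The limit is taken through D' only. By saturation, the sections over nearby points of D' are
  -- holomorphic on one common disc, and a locally uniform limit of them is holomorphic.
  have : (𝓝[D'] z₀).NeBot := mem_closure_iff_nhdsWithin_neBot.1 (hdense hz₀)
  have hdiff : ∀ᶠ z in 𝓝[D'] z₀,
      DifferentiableOn ℂ (fun w => φ (update z a w)) (Metric.ball (z₀ a) r) := by
    filter_upwards [self_mem_nhdsWithin,
      mem_nhdsWithin_of_mem_nhds (Metric.ball_mem_nhds z₀ hr)] with z hz' hz w hw
    have := hd _ (hsat z hz' w (hrD (update_mem_ball hz hw)))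
    simp only [update_idem, update_self] at this
    exact this.differentiableWithinAt
  have hlim : TendstoLocallyUniformlyOn (fun z w => φ (update z a w))
      (fun w => φ (update z₀ a w)) (𝓝[D'] z₀) (Metric.ball (z₀ a) r) := by
    intro u hu x hx
    obtain ⟨t, ht, h⟩ := tendstoLocallyUniformlyOn_update hφ a hr hrD u hu x hx
    exact ⟨t, ht, h.filter_mono nhdsWithin_le_nhds⟩
  exact (hlim.differentiableOn hdiff Metric.isOpen_ball).differentiableAt
    (Metric.ball_mem_nhds _ hr)

/-- A function with continuous partial derivatives is differentiable. -/
theorem hasFDerivAt_of_partial {E : Type*} [NormedAddCommGroup E] [NormedSpace ℝ E]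
    {D : Set (Fin n → ℂ)} (hD : IsOpen D) {f : (Fin n → ℂ) → E}
    {A : Fin n → (Fin n → ℂ) → (ℂ →L[ℝ] E)}
    (hA : ∀ a, ∀ z ∈ D, HasFDerivAt (fun w => f (update z a w)) (A a z) (z a))
    (hc : ∀ a, ContinuousOn (A a) D) {z₀ : Fin n → ℂ} (hz₀ : z₀ ∈ D) :
    HasFDerivAt f (∑ a, (A a z₀).comp (ContinuousLinearMap.proj a)) z₀ := by
  rw [hasFDerivAt_iff_isLittleO, Asymptotics.isLittleO_iff]
  intro ε hε
  -- Each of the n coordinate steps below costs at most ε'‖z - z₀‖; the denominator n + 1 also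
  -- covers n = 0.
  set ε' := ε / (n + 1) with hε'
  have hε'0 : 0 < ε' := by positivity
  have h1 : ∀ᶠ z in 𝓝 z₀, z ∈ D ∧ ∀ a, ‖A a z - A a z₀‖ ≤ ε' := by
    refine Filter.Eventually.and (hD.mem_nhds hz₀) (eventually_all.2 fun a => ?_)
    have := Metric.tendsto_nhds.1 ((hc a).continuousAt (hD.mem_nhds hz₀)) ε' hε'0
    filter_upwards [this] with z hz
    rw [← dist_eq_norm]; exact hz.le
  obtain ⟨r, hr, hball⟩ := Metric.eventually_nhds_iff_ball.1 h1
  filter_upwards [Metric.ball_mem_nhds z₀ hr] with z hz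
  -- A polygonal path from z₀ to z that changes one coordinate at a time. It stays in the ball
  -- because balls of the sup norm are products.
  let p : ℕ → Fin n → ℂ := fun m i => if i.val < m then z i else z₀ i
  have hp : ∀ m, p m ∈ Metric.ball z₀ r := by
    intro m
    rw [Metric.mem_ball, dist_pi_lt_iff hr]
    intro i
    simp only [p]
    split_ifs
    · exact apply_mem_ball hz i
    · simpa using hr
  have hp1 : ∀ k : Fin n, p (k + 1) = update (p k) k (z k) := by
    intro k
    funext i
    by_cases hi : i = k
    · subst hi; simp [p]
    · have : i.val < k.val + 1 ↔ i.val < k.val := by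
        have : i.val ≠ k.val := fun h => hi (Fin.ext h)
        omega
      simp [p, hi, this]
  have hp0 : ∀ k : Fin n, p k = update (p k) k (z₀ k) := by
    intro k
    rw [eq_comm, update_eq_self_iff]
    simp [p]
  have hstep : ∀ k : Fin n, ‖f (p (k + 1)) - f (p k) - A k z₀ (z k - z₀ k)‖ ≤ ε' * ‖z - z₀‖ := by
    intro k
    have := Convex.norm_image_sub_le_of_norm_hasFDerivWithin_le' (𝕜 := ℝ)
      (f := fun w => f (update (p k) k w)) (f' := fun w => A k (update (p k) k w))
      (φ := A k z₀) (C := ε') (s := Metric.ball (z₀ k) r) (x := z₀ k) (y := z k)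
      (fun w hw => ?_) (fun w hw => ?_) (convex_ball _ _) (Metric.mem_ball_self hr)
      (apply_mem_ball hz k)
    · beta_reduce at this
      rw [← hp1, ← hp0] at this
      refine this.trans ?_
      gcongr
      exact norm_le_pi_norm (z - z₀) k
    · have h := hA k _ (hball _ (update_mem_ball (hp k) hw)).1
      simp only [update_idem, update_self] at h
      exact h.hasFDerivWithinAt
    · exact (hball _ (update_mem_ball (hp k) hw)).2 k
  have hpn : p n = z := by funext i; simp [p]
  have hp00 : p 0 = z₀ := by funext i; simp [p]
  have htel : f z - f z₀ = ∑ k : Fin n, (f (p (k + 1)) - f (p k)) := by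
    rw [Fin.sum_univ_eq_sum_range (fun k => f (p (k + 1)) - f (p k)) n,
      Finset.sum_range_sub (fun k => f (p k)), hpn, hp00]
  have : f z - f z₀ - (∑ a, (A a z₀).comp (ContinuousLinearMap.proj a)) (z - z₀)
      = ∑ k : Fin n, (f (p (k + 1)) - f (p k) - A k z₀ (z k - z₀ k)) := by
    rw [htel, Finset.sum_sub_distrib]
    simp
  rw [this]
  refine (norm_sum_le _ _).trans ((Finset.sum_le_sum fun k _ => hstep k).trans ?_)
  rw [Finset.sum_const, Finset.card_univ, Fintype.card_fin, nsmul_eq_mul, ← mul_assoc]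
  gcongr
  rw [hε', mul_div_assoc', div_le_iff₀ (by positivity)]
  nlinarith

theorem contDiffOn_one_of_partial {E : Type*} [NormedAddCommGroup E] [NormedSpace ℝ E]
    {D : Set (Fin n → ℂ)} (hD : IsOpen D) {f : (Fin n → ℂ) → E}
    {A : Fin n → (Fin n → ℂ) → (ℂ →L[ℝ] E)}
    (hA : ∀ a, ∀ z ∈ D, HasFDerivAt (fun w => f (update z a w)) (A a z) (z a))
    (hc : ∀ a, ContinuousOn (A a) D) : ContDiffOn ℝ 1 f D := by
  intro z hz
  refine ContDiffAt.contDiffWithinAt (contDiffAt_one_iff.2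
    ⟨fun z => ∑ a, (A a z).comp (ContinuousLinearMap.proj a), D, hD.mem_nhds hz, ?_,
      fun z hz => hasFDerivAt_of_partial hD hA hc hz⟩)
  exact continuousOn_finsetSum _ fun a _ => (hc a).clm_comp continuousOn_const

/-! ### Reduction of quaternion-valued statements to real linear forms -/

/-- The coordinates of a quaternion. -/
noncomputable def coords : ℍ[ℝ] ≃L[ℝ] (Fin 4 → ℝ) :=
  Quaternion.linearIsometryEquivTuple.toContinuousLinearEquiv.trans (EuclideanSpace.equiv (Fin 4) ℝ)

/-- The `i`-th coordinate of a quaternion, as a linear form. -/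
noncomputable def coord (i : Fin 4) : ℍ[ℝ] →L[ℝ] ℝ :=
  (ContinuousLinearMap.proj i).comp (coords : ℍ[ℝ] →L[ℝ] (Fin 4 → ℝ))

theorem eq_sum_coord (q : ℍ[ℝ]) : q = ∑ i, coord i q • coords.symm (Pi.single i 1) := by
  have h : coords q = ∑ i, coord i q • (Pi.single i 1 : Fin 4 → ℝ) := by
    funext j
    simp [coord, Finset.sum_apply, Pi.single_apply]
  conv_lhs => rw [← coords.symm_apply_apply q, h, map_sum]
  simp only [map_smul]

theorem harmonicAt_finsetSum {ι E G : Type*} [NormedAddCommGroup E] [InnerProductSpace ℝ E]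
    [FiniteDimensional ℝ E] [NormedAddCommGroup G] [NormedSpace ℝ G] {s : Finset ι}
    {g : ι → E → G} {x : E} (h : ∀ i ∈ s, InnerProductSpace.HarmonicAt (g i) x) :
    InnerProductSpace.HarmonicAt (fun x => ∑ i ∈ s, g i x) x := by
  classical
  induction s using Finset.induction_on with
  | empty => simp
  | insert i s hi ih =>
    simp only [Finset.sum_insert hi]
    exact (h i (Finset.mem_insert_self _ _)).add
      (ih fun j hj => h j (Finset.mem_insert_of_mem hj))

section Coordinates

variable {X : Type*} {g : X → ℍ[ℝ]}

theorem exists_tendsto_of_coord {l : Filter X}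
    (h : ∀ ℓ : ℍ[ℝ] →L[ℝ] ℝ, ∃ y, Tendsto (fun x => ℓ (g x)) l (𝓝 y)) :
    ∃ y, Tendsto g l (𝓝 y) := by
  choose y hy using h
  refine ⟨∑ i, y (coord i) • coords.symm (Pi.single i 1), ?_⟩
  rw [show g = fun x => ∑ i, coord i (g x) • coords.symm (Pi.single i 1) from
    funext fun x => eq_sum_coord (g x)]
  exact tendsto_finsetSum _ fun i _ => (hy (coord i)).smul_const _

theorem contDiffOn_of_coord {E : Type*} [NormedAddCommGroup E] [NormedSpace ℝ E] {g : E → ℍ[ℝ]}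
    {s : Set E} {m : WithTop ℕ∞} (h : ∀ ℓ : ℍ[ℝ] →L[ℝ] ℝ, ContDiffOn ℝ m (fun x => ℓ (g x)) s) :
    ContDiffOn ℝ m g s := by
  rw [show g = fun x => ∑ i, coord i (g x) • coords.symm (Pi.single i 1) from
    funext fun x => eq_sum_coord (g x)]
  exact ContDiffOn.sum fun i _ => (h (coord i)).smul contDiffOn_const

theorem harmonicAt_of_coord {E : Type*} [NormedAddCommGroup E] [InnerProductSpace ℝ E]
    [FiniteDimensional ℝ E] {g : E → ℍ[ℝ]} {x : E}
    (h : ∀ ℓ : ℍ[ℝ] →L[ℝ] ℝ, InnerProductSpace.HarmonicAt (fun x => ℓ (g x)) x) :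
    InnerProductSpace.HarmonicAt g x := by
  rw [show g = fun x => ∑ i, coord i (g x) • coords.symm (Pi.single i 1) from
    funext fun x => eq_sum_coord (g x)]
  exact harmonicAt_finsetSum fun i _ => (h (coord i)).comp_CLM
    (ContinuousLinearMap.toSpanSingleton ℝ (coords.symm (Pi.single i 1)))

theorem eq_of_forall_dual {q q' : ℍ[ℝ]} (h : ∀ ℓ : ℍ[ℝ] →L[ℝ] ℝ, ℓ q = ℓ q') : q = q' := by
  rw [eq_sum_coord q, eq_sum_coord q']
  simp only [h]

end Coordinates

end SliceAnalysis

/-! ### Cauchy–Riemann equations as holomorphy of complex pairings -/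

namespace SliceAnalysis

open Filter Topology Function

variable {n : ℕ}

/-- The complex number whose real and imaginary parts are the values of a linear form at the
components of `F` with indices `K` and `K ∪ {a}`. -/
noncomputable def pairing (ℓ : ℍ[ℝ] →L[ℝ] ℝ) (a : Fin n) (F : StemMap n) (K : Finset (Fin n))
    (z : Fin n → ℂ) : ℂ := (ℓ (F z K) : ℂ) + (ℓ (F z (insert a K)) : ℂ) * Complex.I

/-- `F` is holomorphic in the variable `z_a`, with respect to the complex structure `𝓙_a`. -/
def HolIn (D : Set (Fin n → ℂ)) (a : Fin n) (F : StemMap n) : Prop :=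
  ∀ z ∈ D, ∀ K, a ∉ K → ∀ ℓ : ℍ[ℝ] →L[ℝ] ℝ,
    DifferentiableAt ℂ (fun w => pairing ℓ a F K (update z a w)) (z a)

@[simp] theorem pairing_re (ℓ : ℍ[ℝ] →L[ℝ] ℝ) (a : Fin n) (F : StemMap n)
    (K : Finset (Fin n)) (z : Fin n → ℂ) : (pairing ℓ a F K z).re = ℓ (F z K) := by
  simp [pairing]

@[simp] theorem pairing_im (ℓ : ℍ[ℝ] →L[ℝ] ℝ) (a : Fin n) (F : StemMap n)
    (K : Finset (Fin n)) (z : Fin n → ℂ) :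
    (pairing ℓ a F K z).im = ℓ (F z (insert a K)) := by
  simp [pairing]

theorem continuousOn_pairing {D : Set (Fin n → ℂ)} {F : StemMap n}
    (hc : ∀ K, ContinuousOn (fun z => F z K) D) (ℓ : ℍ[ℝ] →L[ℝ] ℝ) (a : Fin n)
    (K : Finset (Fin n)) : ContinuousOn (pairing ℓ a F K) D :=
  (Complex.continuous_ofReal.comp_continuousOn (ℓ.continuous.comp_continuousOn (hc K))).add
    ((Complex.continuous_ofReal.comp_continuousOn
      (ℓ.continuous.comp_continuousOn (hc (insert a K)))).mul continuousOn_const)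

/-- The partial derivatives of the components, in terms of the complex derivatives. -/
theorem HolIn.hasFDerivAt_form {D : Set (Fin n → ℂ)} {a : Fin n} {F : StemMap n}
    (hF : HolIn D a F) {z : Fin n → ℂ} (hz : z ∈ D) (ℓ : ℍ[ℝ] →L[ℝ] ℝ) (V : Finset (Fin n)) :
    HasFDerivAt (fun w => ℓ (F (update z a w) V))
      ((if a ∈ V then Complex.imCLM else Complex.reCLM).comp
        ((ContinuousLinearMap.toSpanSingleton ℂ
          (deriv (fun w => pairing ℓ a F (V.erase a) (update z a w)) (z a))).restrictScalars ℝ))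
      (z a) := by
  have h := (hF z hz (V.erase a) (Finset.notMem_erase a V) ℓ).hasDerivAt.hasFDerivAt.restrictScalars ℝ
  split_ifs with haV
  · have := (Complex.imCLM.hasFDerivAt (x := pairing ℓ a F (V.erase a) (update z a (z a)))).comp
      (z a) h
    refine this.congr_of_eventuallyEq (Eventually.of_forall fun w => ?_)
    simp [Finset.insert_erase haV]
  · have := (Complex.reCLM.hasFDerivAt (x := pairing ℓ a F (V.erase a) (update z a (z a)))).comp
      (z a) h
    refine this.congr_of_eventuallyEq (Eventually.of_forall fun w => ?_)
    simp [Finset.erase_eq_of_notMem haV]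

/-- A continuous stem map which is holomorphic in each variable is of class `C¹`. -/
theorem contDiffOn_of_holIn {D : Set (Fin n → ℂ)} (hD : IsOpen D) {F : StemMap n}
    (hc : ∀ K, ContinuousOn (fun z => F z K) D) (hF : ∀ a, HolIn D a F) :
    ContDiffOn ℝ 1 F D := by
  refine contDiffOn_pi.2 fun V => contDiffOn_of_coord fun ℓ => ?_
  refine contDiffOn_one_of_partial hD (fun a z hz => (hF a).hasFDerivAt_form hz ℓ V) fun a => ?_
  have h := continuousOn_deriv_update hD (continuousOn_pairing hc ℓ a (V.erase a)) a
    fun z hz => hF a z hz _ (Finset.notMem_erase a V) ℓ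
  refine continuousOn_const.clm_comp ?_
  have h2 : Continuous fun c : ℂ =>
      (ContinuousLinearMap.toSpanSingleton ℂ c).restrictScalars ℝ := by
    have : (fun c : ℂ => (ContinuousLinearMap.toSpanSingleton ℂ c).restrictScalars ℝ)
        = fun c : ℂ => (ContinuousLinearMap.mul ℝ ℂ).flip c := by
      funext c; ext; simp [mul_comm]
    rw [this]
    exact ContinuousLinearMap.continuous _
  exact h2.comp_continuousOn h

theorem hasFDerivAt_update_apply {F : StemMap n} {z : Fin n → ℂ} (hF : DifferentiableAt ℝ F z)
    (a : Fin n) (V : Finset (Fin n)) :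
    ∃ d : ℂ →L[ℝ] ℍ[ℝ], HasFDerivAt (fun w => F (update z a w) V) d (z a) ∧
      ∀ v, d v = fderiv ℝ F z (Pi.single a v) V := by
  have h1 : HasFDerivAt F (fderiv ℝ F z) (update z a (z a)) := by
    rw [update_eq_self]; exact hF.hasFDerivAt
  have h2 := (hasFDerivAt_pi'.1 (h1.comp (z a) (hasFDerivAt_update (𝕜 := ℝ) z (z a)))) V
  refine ⟨_, h2, fun v => ?_⟩
  have e : ContinuousLinearMap.pi (Pi.single a (ContinuousLinearMap.id ℝ ℂ)) v
      = (Pi.single a v : Fin n → ℂ) := by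
    funext i
    by_cases hi : i = a
    · subst hi; simp
    · simp [hi]
  simp only [ContinuousLinearMap.comp_apply, ContinuousLinearMap.proj_apply, e]

theorem dbar_apply (F : StemMap n) (z : Fin n → ℂ) (a : Fin n) (K : Finset (Fin n)) :
    dbar a F z K = (2⁻¹ : ℝ) • (fderiv ℝ F z (Pi.single a 1) K +
      (if a ∈ K then (1 : ℝ) else -1) • fderiv ℝ F z (Pi.single a Complex.I) (symmDiff K {a})) := by
  unfold dbar cplx
  simp only [Pi.smul_apply, Pi.add_apply]
  rw [neg_one_pow_card_inter_singleton]
  by_cases h : a ∈ K <;> simp [h, Finset.mem_symmDiff]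

theorem symmDiff_singleton_of_notMem {K : Finset (Fin n)} {a : Fin n} (h : a ∉ K) :
    symmDiff K {a} = insert a K := by
  ext i
  by_cases hi : i = a
  · subst hi; simp [Finset.mem_symmDiff, h]
  · simp [Finset.mem_symmDiff, hi]

theorem symmDiff_singleton_insert {K : Finset (Fin n)} {a : Fin n} (h : a ∉ K) :
    symmDiff (insert a K) {a} = K := by
  ext i
  by_cases hi : i = a
  · subst hi; simp [Finset.mem_symmDiff, h]
  · simp [Finset.mem_symmDiff, hi]

/-- The structure 𝓙_a only exchanges the components K and K ∪ {a}, so the equation splits into one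
Cauchy–Riemann system for each such pair. -/
theorem dbar_eq_zero_iff {F : StemMap n} {z : Fin n → ℂ} {a : Fin n} :
    dbar a F z = 0 ↔ ∀ K, a ∉ K →
      fderiv ℝ F z (Pi.single a 1) K = fderiv ℝ F z (Pi.single a Complex.I) (insert a K) ∧
      fderiv ℝ F z (Pi.single a 1) (insert a K) = -fderiv ℝ F z (Pi.single a Complex.I) K := by
  have key : ∀ q q' : ℍ[ℝ], (2⁻¹ : ℝ) • (q + q') = 0 ↔ q = -q' := by
    intro q q'
    rw [smul_eq_zero_iff_right (by norm_num), add_eq_zero_iff_eq_neg]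
  constructor
  · intro h K hK
    have h1 := congrFun h K
    have h2 := congrFun h (insert a K)
    rw [dbar_apply, Pi.zero_apply, key, if_neg hK, symmDiff_singleton_of_notMem hK] at h1
    rw [dbar_apply, Pi.zero_apply, key, if_pos (Finset.mem_insert_self _ _),
      symmDiff_singleton_insert hK] at h2
    simp only [neg_smul, one_smul, neg_neg] at h1 h2
    exact ⟨h1, h2⟩
  · intro h
    funext K
    rw [dbar_apply, Pi.zero_apply, key]
    by_cases hK : a ∈ K
    · have h1 := (h (K.erase a) (Finset.notMem_erase a K)).2
      have h2 : symmDiff K {a} = K.erase a := by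
        conv_lhs => rw [← Finset.insert_erase hK]
        exact symmDiff_singleton_insert (Finset.notMem_erase a K)
      rw [Finset.insert_erase hK] at h1
      rw [if_pos hK, one_smul, h1, h2]
    · rw [if_neg hK, neg_one_smul, neg_neg, symmDiff_singleton_of_notMem hK]
      exact (h K hK).1

/-- The Cauchy–Riemann equations `∂̄_a F = 0` amount to complex differentiability in `z_a`. -/
theorem dbar_eq_zero_iff_differentiableAt {F : StemMap n} {z : Fin n → ℂ}
    (hF : DifferentiableAt ℝ F z) (a : Fin n) :
    dbar a F z = 0 ↔ ∀ K, a ∉ K → ∀ ℓ : ℍ[ℝ] →L[ℝ] ℝ,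
      DifferentiableAt ℂ (fun w => pairing ℓ a F K (update z a w)) (z a) := by
  rw [dbar_eq_zero_iff]
  refine forall₂_congr fun K _ => ?_
  obtain ⟨d, hd, hdv⟩ := hasFDerivAt_update_apply hF a K
  obtain ⟨d', hd', hdv'⟩ := hasFDerivAt_update_apply hF a (insert a K)
  rw [← hdv, ← hdv', ← hdv, ← hdv']
  have key : ∀ ℓ : ℍ[ℝ] →L[ℝ] ℝ, DifferentiableAt ℂ
      (fun w => pairing ℓ a F K (update z a w)) (z a) ↔
      ℓ (d 1) = ℓ (d' Complex.I) ∧ ℓ (d' 1) = -ℓ (d Complex.I) := by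
    intro ℓ
    have h1 : HasFDerivAt (fun w => (ℓ (F (update z a w) K) : ℂ))
        (Complex.ofRealCLM.comp (ℓ.comp d)) (z a) :=
      Complex.ofRealCLM.hasFDerivAt.comp _ (ℓ.hasFDerivAt.comp _ hd)
    have h2 : HasFDerivAt (fun w => (ℓ (F (update z a w) (insert a K)) : ℂ))
        (Complex.ofRealCLM.comp (ℓ.comp d')) (z a) :=
      Complex.ofRealCLM.hasFDerivAt.comp _ (ℓ.hasFDerivAt.comp _ hd')
    have h3 := h1.add (h2.mul_const Complex.I)
    have h4 : HasFDerivAt (fun w => pairing ℓ a F K (update z a w)) _ (z a) := h3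
    rw [differentiableAt_complex_iff_differentiableAt_real, h4.fderiv]
    simp only [h4.differentiableAt, true_and]
    simp [Complex.ext_iff]
    constructor
    · rintro ⟨e1, e2⟩; exact ⟨e2.symm, by linarith⟩
    · rintro ⟨e1, e2⟩; exact ⟨by linarith, e1.symm⟩
  constructor
  · rintro ⟨e1, e2⟩ ℓ
    rw [key, e1, e2, map_neg]
    exact ⟨rfl, rfl⟩
  · intro h
    refine ⟨eq_of_forall_dual fun ℓ => ((key ℓ).1 (h ℓ)).1, eq_of_forall_dual fun ℓ => ?_⟩
    rw [map_neg]
    exact ((key ℓ).1 (h ℓ)).2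

theorem holIn_of_dbar {D : Set (Fin n → ℂ)} (hD : IsOpen D) {F : StemMap n}
    (hF : ContDiffOn ℝ 1 F D) {a : Fin n} (h : ∀ z ∈ D, dbar a F z = 0) : HolIn D a F :=
  fun z hz => (dbar_eq_zero_iff_differentiableAt
    ((hF.contDiffAt (hD.mem_nhds hz)).differentiableAt one_ne_zero) a).1 (h z hz)

theorem dbar_of_holIn {D : Set (Fin n → ℂ)} (hD : IsOpen D) {F : StemMap n}
    (hF : ContDiffOn ℝ 1 F D) {a : Fin n} (h : HolIn D a F) : ∀ z ∈ D, dbar a F z = 0 :=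
  fun z hz => (dbar_eq_zero_iff_differentiableAt
    ((hF.contDiffAt (hD.mem_nhds hz)).differentiableAt one_ne_zero) a).2 (h z hz)

/-- Trades C¹ with ∂̄ = 0 for joint continuity and separate holomorphy, both of which pass to
extensions by density. By uniqueness it can be tested on any inducing stem function, as functions
agreeing on the open set D have the same derivatives there. -/
theorem isSliceRegular_iff {D : Set (Fin n → ℂ)} (hD : IsOpen D) {F : StemMap n}
    {f : (Fin n → ℍ[ℝ]) → ℍ[ℝ]} (hF : IsStem D F) (hf : Induces D F f) :
    IsSliceRegular D f ↔ (∀ K, ContinuousOn (fun z => F z K) D) ∧ ∀ a, HolIn D a F := by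
  constructor
  · rintro ⟨F', hF', hf', hc, hd⟩
    have e := stem_unique hf hf'
    have hc2 : ContDiffOn ℝ 1 F D := hc.congr e
    refine ⟨fun K => (continuousOn_pi.1 hc2.continuousOn) K, fun a =>
      holIn_of_dbar hD hc2 fun z hz => ?_⟩
    have e2 : F =ᶠ[𝓝 z] F' := eventually_of_mem (hD.mem_nhds hz) e
    have := hd a z hz
    unfold dbar at this ⊢
    rwa [e2.fderiv_eq]
  · rintro ⟨hc, hh⟩
    have h := contDiffOn_of_holIn hD hc hh
    exact ⟨F, hF, hf, h, fun a => dbar_of_holIn hD h (hh a)⟩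

/-- As a ∉ H, moving z_a cannot make a coordinate in H real, so D_H is saturated in the direction of
z_a. -/
theorem HolIn.of_dense {D : Set (Fin n → ℂ)} (hD : IsOpen D) {F : StemMap n}
    (hc : ∀ K, ContinuousOn (fun z => F z K) D) {H : Finset (Fin n)} {a : Fin n} (ha : a ∉ H)
    (hF : HolIn (offReal D H) a F) : HolIn D a F := fun z hz K hK ℓ =>
  differentiableAt_update_of_dense hD (continuousOn_pairing hc ℓ a K) a
    (subset_closure_offReal hD H)
    (fun z hz w hw => ⟨hw, fun h hh => by
      rw [update_of_ne (fun e : h = a => ha (e ▸ hh))]; exact hz.2 h hh⟩)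
    (fun z hz => hF z hz K hK ℓ) z hz

theorem HolIn.congr {D : Set (Fin n → ℂ)} (hD : IsOpen D) {F G : StemMap n} {a : Fin n}
    (hF : HolIn D a F) (h : ∀ z ∈ D, F z = G z) : HolIn D a G := by
  intro z hz K hK ℓ
  refine (hF z hz K hK ℓ).congr_of_eventuallyEq ?_
  have : z a ∈ {w | update z a w ∈ D} := by simpa using hz
  filter_upwards [(isOpen_section hD a z).mem_nhds this] with w hw
  simp only [pairing, h _ hw]

theorem IsStem.of_dense {D : Set (Fin n → ℂ)} (hDc : ConjInvariant D) (hD : IsOpen D)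
    {F : StemMap n} (hc : ∀ K, ContinuousOn (fun z => F z K) D) {H : Finset (Fin n)}
    (hF : IsStem (offReal D H) F) : IsStem D F := by
  intro z hz h K
  have hconj : Continuous (conjAt h : (Fin n → ℂ) → Fin n → ℂ) :=
    continuous_id.update h (continuous_star.comp (continuous_apply h))
  have h1 : Set.EqOn (fun z => F (conjAt h z) K) (fun z => (-1 : ℝ) ^ (K ∩ {h}).card • F z K)
      (offReal D H) := fun z hz => hF z hz h K
  exact h1.of_subset_closure ((hc K).comp hconj.continuousOn fun z hz => hDc z hz h)
    (continuousOn_const.fun_smul (hc K)) (offReal_subset D H) (subset_closure_offReal hD H) hz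

/-- For a ∉ H the factor β_H does not depend on z_a, and the pair K, K ∪ {a} is sent to the pair K ∪
H, K ∪ H ∪ {a}. -/
theorem HolIn.stemDeriv {D : Set (Fin n → ℂ)} {F : StemMap n} {a : Fin n} (hF : HolIn D a F)
    {H : Finset (Fin n)} (ha : a ∉ H) : HolIn (offReal D H) a (stemDeriv H F) := by
  intro z hz K hK ℓ
  by_cases hdis : Disjoint K H
  · have hdis' : Disjoint (insert a K) H := by simp [ha, hdis]
    have h := (hF z hz.1 (K ∪ H) (by simp [hK, ha]) ℓ).const_mul
      (((∏ h ∈ H, (z h).im)⁻¹ : ℝ) : ℂ)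
    refine h.congr_of_eventuallyEq (Eventually.of_forall fun w => ?_)
    have hp : ∏ h ∈ H, (update z a w h).im = ∏ h ∈ H, (z h).im :=
      Finset.prod_congr rfl fun i hi => by rw [update_of_ne (fun e : i = a => ha (e ▸ hi))]
    simp only [pairing, SliceAnalysis.stemDeriv, if_pos hdis, if_pos hdis', hp, map_smul,
      smul_eq_mul, Finset.insert_union]
    push_cast
    ring
  · have hdis' : ¬ Disjoint (insert a K) H := by simp [ha, hdis]
    simp [pairing, SliceAnalysis.stemDeriv, if_neg hdis, hdis']

theorem continuousOn_stemDeriv {D : Set (Fin n → ℂ)} {F : StemMap n}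
    (hc : ∀ K, ContinuousOn (fun z => F z K) D) (H K : Finset (Fin n)) :
    ContinuousOn (fun z => stemDeriv H F z K) (offReal D H) := by
  unfold stemDeriv
  split_ifs
  · have h1 : ContinuousOn (fun z : Fin n → ℂ => ∏ h ∈ H, (z h).im) (offReal D H) :=
      Continuous.continuousOn (by fun_prop)
    exact (h1.inv₀ fun z hz => Finset.prod_ne_zero_iff.2 hz.2).fun_smul
      ((hc _).mono (offReal_subset D H))
  · exact continuousOn_const

end SliceAnalysis

/-! ### Continuous extension of spherical derivatives -/

namespace SliceAnalysis

open Filter Topology Function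

variable {n : ℕ}

/-- The slice product of `F` by the stem function of the variable `x_a`, in components. -/
noncomputable def mulVar (a : Fin n) (F : StemMap n) : StemMap n := fun z V =>
  (z a).re • F z V + (if a ∈ V then (z a).im else -(z a).im) • F z (symmDiff V {a})

theorem stemMul_varStem_empty (F : StemMap n) : stemMul (varStem ∅) F = F := by
  funext z V
  rw [stemMul_varStem_apply, Finset.sum_eq_single ∅]
  · have : symmDiff ∅ V = V := bot_symmDiff V
    simp [varCoef, this]
  · intro L _ hL
    have : ¬ L ⊆ ∅ := fun h => hL (Finset.subset_empty.1 h)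
    rw [varCoef, if_neg this, mul_zero, zero_smul]
  · simp

/-- The sum over subsets of K ∪ {a} is split according to whether a belongs to the subset. The
coefficients being real, a may stand anywhere in the order. -/
theorem stemMul_varStem_insert {a : Fin n} {K : Finset (Fin n)} (ha : a ∉ K) (F : StemMap n) :
    stemMul (varStem (insert a K)) F = mulVar a (stemMul (varStem K) F) := by
  funext z V
  have h0 : ∀ (K V : Finset (Fin n)), stemMul (varStem K) F z V
      = ∑ L ∈ K.powerset, ((-1) ^ (L \ V).card *
        ∏ i ∈ K, (if i ∈ L then (z i).im else (z i).re)) • F z (symmDiff L V) := by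
    intro K V
    rw [stemMul_varStem_apply, ← Finset.sum_subset (Finset.subset_univ K.powerset)]
    · refine Finset.sum_congr rfl fun L hL => ?_
      rw [varCoef, if_pos (Finset.mem_powerset.1 hL)]
    · intro L _ hL
      rw [varCoef, if_neg fun h => hL (Finset.mem_powerset.2 h), mul_zero, zero_smul]
  rw [mulVar, h0, h0, h0, Finset.sum_powerset_insert ha, Finset.smul_sum, Finset.smul_sum]
  congr 1
  · refine Finset.sum_congr rfl fun L hL => ?_
    have haL : a ∉ L := fun h => ha (Finset.mem_powerset.1 hL h)
    rw [Finset.prod_insert ha, if_neg haL, smul_smul]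
    congr 1
    ring
  · refine Finset.sum_congr rfl fun L hL => ?_
    have haL : a ∉ L := fun h => ha (Finset.mem_powerset.1 hL h)
    have e1 : symmDiff (insert a L) V = symmDiff L (symmDiff V {a}) := by
      rw [← symmDiff_singleton_of_notMem haL, symmDiff_assoc, symmDiff_comm {a} V]
    have e2 : ∏ i ∈ K, (if i ∈ insert a L then (z i).im else (z i).re)
        = ∏ i ∈ K, (if i ∈ L then (z i).im else (z i).re) := by
      refine Finset.prod_congr rfl fun i hi => ?_
      have : i ≠ a := fun e => ha (e ▸ hi)
      simp [this]
    have e3 : L \ symmDiff V {a} = L \ V := by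
      ext i
      by_cases hi : i = a
      · subst hi; simp [haL]
      · simp [Finset.mem_symmDiff, hi]
    have e4 : ((-1 : ℝ)) ^ (insert a L \ V).card = (if a ∈ V then 1 else -1) *
        (-1) ^ (L \ V).card := by
      split_ifs with haV
      · rw [Finset.insert_sdiff_of_mem _ haV, one_mul]
      · rw [Finset.insert_sdiff_of_notMem _ haV, Finset.card_insert_of_notMem (by simp [haL]),
          pow_succ']
    rw [Finset.prod_insert ha, if_pos (Finset.mem_insert_self _ _), smul_smul, e1, e2, e3, e4]
    congr 1
    split_ifs <;> ring

theorem continuousOn_mulVar {D : Set (Fin n → ℂ)} {F : StemMap n}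
    (hc : ∀ K, ContinuousOn (fun z => F z K) D) (a : Fin n) (K : Finset (Fin n)) :
    ContinuousOn (fun z => mulVar a F z K) D := by
  have h1 : Continuous fun z : Fin n → ℂ => (z a).re := by fun_prop
  have h2 : Continuous fun z : Fin n → ℂ => (if a ∈ K then (z a).im else -(z a).im) := by
    split_ifs <;> fun_prop
  exact (h1.continuousOn.fun_smul (hc _)).fun_add (h2.continuousOn.fun_smul (hc _))

/-- For b = a the complex pairing is multiplied by the holomorphic function w. For b ≠ a it becomes
a combination of two pairings with real coefficients that are constant in z_b. -/
theorem HolIn.mulVar {D : Set (Fin n → ℂ)} {F : StemMap n} {b : Fin n} (hF : HolIn D b F)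
    (a : Fin n) : HolIn D b (mulVar a F) := by
  intro z hz K hK ℓ
  by_cases hab : b = a
  · subst hab
    have h := differentiableAt_id.mul (hF z hz K hK ℓ)
    refine h.congr_of_eventuallyEq (Eventually.of_forall fun w => ?_)
    apply Complex.ext
    · simp [SliceAnalysis.mulVar, hK, symmDiff_singleton_of_notMem hK]; ring
    · simp [SliceAnalysis.mulVar, hK, symmDiff_singleton_insert hK]
  · have hK' : b ∉ symmDiff K {a} := by simp [Finset.mem_symmDiff, hK, hab]
    have hins : symmDiff (insert b K) {a} = insert b (symmDiff K {a}) := by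
      ext i
      by_cases hi : i = b
      · subst hi; simp [Finset.mem_symmDiff, hab]
      · simp [Finset.mem_symmDiff, hi]
    have h := ((hF z hz K hK ℓ).const_mul ((z a).re : ℂ)).add
      ((hF z hz _ hK' ℓ).const_mul ((if a ∈ K then (z a).im else -(z a).im : ℝ) : ℂ))
    refine h.congr_of_eventuallyEq (Eventually.of_forall fun w => ?_)
    have hab' : a ≠ b := fun e => hab e.symm
    apply Complex.ext
    · by_cases haK : a ∈ K <;> simp [SliceAnalysis.mulVar, hab', haK]
    · by_cases haK : a ∈ K <;> simp [SliceAnalysis.mulVar, hab', hins, haK]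

theorem continuousOn_stemMul_varStem {D : Set (Fin n → ℂ)} {F : StemMap n}
    (hc : ∀ K, ContinuousOn (fun z => F z K) D) (K V : Finset (Fin n)) :
    ContinuousOn (fun z => stemMul (varStem K) F z V) D := by
  induction K using Finset.induction_on generalizing V with
  | empty => rw [stemMul_varStem_empty]; exact hc V
  | insert a K ha ih => rw [stemMul_varStem_insert ha]; exact continuousOn_mulVar ih a V

theorem HolIn.stemMul_varStem {D : Set (Fin n → ℂ)} {F : StemMap n} {b : Fin n}
    (hF : HolIn D b F) (K : Finset (Fin n)) : HolIn D b (stemMul (varStem K) F) := by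
  induction K using Finset.induction_on with
  | empty => rw [stemMul_varStem_empty]; exact hF
  | insert a K ha ih => rw [stemMul_varStem_insert ha]; exact ih.mulVar a

/-- The mean value theorem for the quotient by `Im z_a`. -/
theorem exists_inv_im_smul_eq {D : Set (Fin n → ℂ)} {F : StemMap n} (hF : IsStem D F)
    {a : Fin n} (hh : HolIn D a F) {K : Finset (Fin n)} (hK : a ∉ K) (ℓ : ℍ[ℝ] →L[ℝ] ℝ)
    {z : Fin n → ℂ} (him : (z a).im ≠ 0)
    (hz : ∀ t ∈ Set.Icc (0 : ℝ) 1, update z a (⟨(z a).re, t * (z a).im⟩ : ℂ) ∈ D) :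
    ∃ t ∈ Set.Icc (0 : ℝ) 1, ((z a).im)⁻¹ * ℓ (F z (insert a K))
      = (deriv (fun w => pairing ℓ a F K (update z a w)) ⟨(z a).re, t * (z a).im⟩).re := by
  -- The vertical segment from the real axis to z_a. The component with index K ∪ {a} vanishes at
  -- its start, and its derivative along the segment is β times the real part of the complex
  -- derivative.
  let γ : ℝ → ℂ := fun t => ⟨(z a).re, t * (z a).im⟩
  have hγ : ∀ t, HasDerivAt γ ((z a).im * Complex.I) t := by
    intro t
    have h1 : HasDerivAt (fun t : ℝ => ((z a).re : ℂ) + (t : ℂ) * ((z a).im * Complex.I))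
        (1 * ((z a).im * Complex.I)) t :=
      (((hasDerivAt_id t).ofReal_comp).mul_const _).const_add _
    rw [one_mul] at h1
    refine h1.congr_of_eventuallyEq (Eventually.of_forall fun s => ?_)
    apply Complex.ext <;> simp [γ]
  have hd : ∀ t ∈ Set.Icc (0 : ℝ) 1, HasDerivAt (fun t => ℓ (F (update z a (γ t)) (insert a K)))
      ((z a).im * (deriv (fun w => pairing ℓ a F K (update z a w)) (γ t)).re) t := by
    intro t ht
    have h1 := hh _ (hz t ht) K hK ℓ
    simp only [update_idem, update_self] at h1
    have h2 := h1.hasDerivAt.scomp t (hγ t)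
    have h3 := Complex.imCLM.hasFDerivAt.comp_hasDerivAt t h2
    have e1 : Complex.imCLM (((z a).im * Complex.I) •
        deriv (fun w => pairing ℓ a F K (update z a w)) ⟨(z a).re, t * (z a).im⟩)
        = (z a).im * (deriv (fun w => pairing ℓ a F K (update z a w)) (γ t)).re := by
      simp [γ]
    rw [e1] at h3
    exact h3.congr_of_eventuallyEq (Eventually.of_forall fun s => by simp)
  obtain ⟨t, ht, h⟩ := exists_hasDerivAt_eq_slope _ _ (zero_lt_one (α := ℝ))
    (fun t ht => (hd t ht).continuousAt.continuousWithinAt)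
    (fun t ht => hd t (Set.Ioo_subset_Icc_self ht))
  have h0 : F (update z a (γ 0)) (insert a K) = 0 :=
    hF.eq_zero_of_im (hz 0 (by simp)) (Finset.mem_insert_self a K) (by simp)
  have h1 : update z a (γ 1) = z := by
    rw [update_eq_self_iff]
    apply Complex.ext <;> simp [γ]
  rw [h0, h1, map_zero, sub_zero, sub_zero, div_one] at h
  refine ⟨t, Set.Ioo_subset_Icc_self ht, ?_⟩
  rw [← h, ← mul_assoc, inv_mul_cancel₀ him, one_mul]

/-- At a real z_a, the mean value theorem replaces the quotient by the real part of a complex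
derivative at an intermediate point, and this derivative is jointly continuous. -/
theorem exists_tendsto_stemDeriv_singleton {D : Set (Fin n → ℂ)} (hD : IsOpen D)
    {F : StemMap n} (hF : IsStem D F) (hc : ∀ K, ContinuousOn (fun z => F z K) D) {a : Fin n}
    (hh : HolIn D a F) (K : Finset (Fin n)) {z₀ : Fin n → ℂ} (hz₀ : z₀ ∈ D) :
    ∃ q, Tendsto (fun z => stemDeriv {a} F z K) (𝓝[offReal D {a}] z₀) (𝓝 q) := by
  by_cases hK : a ∈ K
  · have : ¬ Disjoint K {a} := by simpa using hK
    simp only [stemDeriv, if_neg this]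
    exact ⟨0, tendsto_const_nhds⟩
  by_cases him : (z₀ a).im ≠ 0
  · exact ⟨_, continuousOn_stemDeriv hc {a} K z₀ ⟨hz₀, by simpa using him⟩⟩
  rw [not_not] at him
  refine exists_tendsto_of_coord fun ℓ => ?_
  have hψ := continuousOn_deriv_update hD (continuousOn_pairing hc ℓ a K) a
    fun z hz => hh z hz K hK ℓ
  refine ⟨(deriv (fun w => pairing ℓ a F K (update z₀ a w)) (z₀ a)).re, ?_⟩
  rw [Metric.tendsto_nhds]
  intro ε hε
  have h1 := (Metric.tendsto_nhds.1 (hψ.continuousAt (hD.mem_nhds hz₀)) ε hε).and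
    (hD.mem_nhds hz₀ : ∀ᶠ z in 𝓝 z₀, z ∈ D)
  obtain ⟨r, hr, hball⟩ := Metric.eventually_nhds_iff_ball.1 h1
  filter_upwards [self_mem_nhdsWithin,
    mem_nhdsWithin_of_mem_nhds (Metric.ball_mem_nhds z₀ hr)] with z hz' hz
  have hzim : (z a).im ≠ 0 := hz'.2 a (Finset.mem_singleton_self a)
  -- The centre z₀ has a real a-th coordinate, so shrinking the imaginary part of z_a brings it
  -- closer to the centre.
  have hmem : ∀ t ∈ Set.Icc (0 : ℝ) 1,
      update z a (⟨(z a).re, t * (z a).im⟩ : ℂ) ∈ Metric.ball z₀ r := by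
    intro t ht
    refine update_mem_ball hz ?_
    have h2 := apply_mem_ball hz a
    rw [Metric.mem_ball, Complex.dist_eq] at h2 ⊢
    refine lt_of_le_of_lt ?_ h2
    rw [Complex.norm_def, Complex.norm_def]
    refine Real.sqrt_le_sqrt ?_
    simp only [Complex.normSq_apply, Complex.sub_re, Complex.sub_im, him, sub_zero]
    have h3 : t * t ≤ 1 := by nlinarith [ht.1, ht.2]
    nlinarith [mul_self_nonneg (z a).im]
  obtain ⟨t, ht, h⟩ := exists_inv_im_smul_eq hF hh hK ℓ hzim fun t ht => (hball _ (hmem t ht)).2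
  have h2 := (hball _ (hmem t ht)).1
  simp only [update_idem, update_self] at h2
  have h3 : ℓ (stemDeriv {a} F z K) = ((z a).im)⁻¹ * ℓ (F z (insert a K)) := by
    have e1 : Disjoint K {a} := by simpa using hK
    have e2 : K ∪ {a} = insert a K := by ext i; simp
    rw [stemDeriv, if_pos e1, Finset.prod_singleton, map_smul, smul_eq_mul, e2]
  rw [h3, h]
  refine lt_of_le_of_lt ?_ h2
  rw [Real.dist_eq, dist_eq_norm, ← Complex.sub_re]
  exact Complex.abs_re_le_norm _

/-- `G` is a continuous extension to `D` of the spherical derivative of `F`. -/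
structure IsDerivExt (D : Set (Fin n → ℂ)) (H : Finset (Fin n)) (F G : StemMap n) : Prop where
  isStem : IsStem D G
  cont : ∀ K, ContinuousOn (fun z => G z K) D
  eq : ∀ z ∈ offReal D H, G z = stemDeriv H F z

theorem IsDerivExt.holIn {D : Set (Fin n → ℂ)} (hD : IsOpen D) {H : Finset (Fin n)}
    {F G : StemMap n} (h : IsDerivExt D H F G) {b : Fin n} (hb : b ∉ H) (hF : HolIn D b F) :
    HolIn D b G := by
  have hopen : IsOpen (offReal D H) := by
    have : offReal D H = D ∩ ⋂ h ∈ H, {z | (z h).im ≠ 0} := by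
      ext z; simp [offReal]
    rw [this]
    exact hD.inter (isOpen_biInter_finset fun i _ =>
      isOpen_ne_fun (by fun_prop) continuous_const)
  exact ((hF.stemDeriv hb).congr hopen fun z hz => (h.eq z hz).symm).of_dense hD h.cont hb

theorem exists_isDerivExt_singleton {D : Set (Fin n → ℂ)} (hDc : ConjInvariant D)
    (hD : IsOpen D) {F : StemMap n} (hF : IsStem D F)
    (hc : ∀ K, ContinuousOn (fun z => F z K) D) {a : Fin n} (hh : HolIn D a F) :
    ∃ G, IsDerivExt D {a} F G := by
  let G : StemMap n := fun z K => extendFrom (offReal D {a}) (fun z => stemDeriv {a} F z K) z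
  have hcont : ∀ K, ContinuousOn (fun z => G z K) D := fun K =>
    continuousOn_extendFrom (subset_closure_offReal hD {a}) fun z hz =>
      exists_tendsto_stemDeriv_singleton hD hF hc hh K hz
  have heq : ∀ z ∈ offReal D {a}, G z = stemDeriv {a} F z := fun z hz => funext fun K =>
    extendFrom_eq (subset_closure hz) (continuousOn_stemDeriv hc {a} K z hz)
  refine ⟨G, IsStem.of_dense hDc hD hcont (H := {a}) fun z hz h K => ?_, hcont, heq⟩
  rw [heq z hz, heq _ (hDc.offReal {a} z hz h)]
  exact hF.stemDeriv {a} z hz h K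

theorem stemDeriv_congr {H : Finset (Fin n)} {F G : StemMap n} {z : Fin n → ℂ}
    (h : F z = G z) : stemDeriv H F z = stemDeriv H G z := by
  funext K; simp only [stemDeriv, h]

theorem offReal_insert (D : Set (Fin n → ℂ)) (h : Fin n) (H : Finset (Fin n)) (z : Fin n → ℂ) :
    z ∈ offReal D (insert h H) ↔ z ∈ offReal D H ∧ z ∈ offReal D {h} := by
  simp only [offReal, Set.mem_ofPred_eq, Finset.forall_mem_insert, Finset.mem_singleton,
    forall_eq]
  tauto

theorem IsDerivExt.insert {D : Set (Fin n → ℂ)} {H : Finset (Fin n)} {h : Fin n} (hh : h ∉ H)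
    {F G' G : StemMap n} (hG' : IsDerivExt D H F G') (hG : IsDerivExt D {h} G' G) :
    IsDerivExt D (insert h H) F G := by
  refine ⟨hG.isStem, hG.cont, fun z hz => ?_⟩
  rw [offReal_insert] at hz
  rw [hG.eq z hz.2, stemDeriv_insert hh, stemDeriv_congr (hG'.eq z hz.1)]

/-- The extension over H is still holomorphic in a variable outside H, so the argument for one
variable applies to it again. -/
theorem exists_isDerivExt {D : Set (Fin n → ℂ)} (hDc : ConjInvariant D) (hD : IsOpen D)
    {F : StemMap n} (hF : IsStem D F) (hc : ∀ K, ContinuousOn (fun z => F z K) D)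
    (H : Finset (Fin n)) (hh : ∀ a ∈ H, HolIn D a F) : ∃ G, IsDerivExt D H F G := by
  induction H using Finset.induction_on with
  | empty =>
    refine ⟨F, hF, hc, fun z _ => ?_⟩
    funext K
    simp [stemDeriv]
  | insert h H hhH ih =>
    obtain ⟨G', hG'⟩ := ih fun a ha => hh a (Finset.mem_insert_of_mem ha)
    obtain ⟨G, hG⟩ := exists_isDerivExt_singleton hDc hD hG'.isStem hG'.cont
      (hG'.holIn hD hhH (hh h (Finset.mem_insert_self h H)))
    exact ⟨G, hG'.insert hhH hG⟩

theorem IsDerivExt.unique {D : Set (Fin n → ℂ)} (hD : IsOpen D) {H : Finset (Fin n)}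
    {F G G' : StemMap n} (hG : IsDerivExt D H F G) (hG' : IsDerivExt D H F G') :
    ∀ z ∈ D, G z = G' z := by
  intro z hz
  funext K
  have h : Set.EqOn (fun z => G z K) (fun z => G' z K) (offReal D H) := fun z hz => by
    simp only [hG.eq z hz, hG'.eq z hz]
  exact h.of_subset_closure (hG.cont K) (hG'.cont K) (offReal_subset D H)
    (subset_closure_offReal hD H) hz

theorem IsDerivExt.eq_zero {D : Set (Fin n → ℂ)} (hD : IsOpen D) {H : Finset (Fin n)}
    {F G : StemMap n} (hG : IsDerivExt D H F G) {z : Fin n → ℂ} (hz : z ∈ D)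
    {T : Finset (Fin n)} (hT : ¬ Disjoint T H) : G z T = 0 := by
  have h : Set.EqOn (fun z => G z T) (fun _ => 0) (offReal D H) := fun z hz => by
    simp only [hG.eq z hz, stemDeriv_eq_zero _ _ hT]
  exact h.of_subset_closure (hG.cont T) continuousOn_const (offReal_subset D H)
    (subset_closure_offReal hD H) hz

/-- The extension is, in each variable `z_h`, `h ∈ H`, an extension of a spherical derivative
with respect to `x_h` of a stem function that is holomorphic in `z_h`. -/
theorem IsDerivExt.exists_singleton {D : Set (Fin n → ℂ)} (hDc : ConjInvariant D)
    (hD : IsOpen D) {F G : StemMap n} (hF : IsStem D F)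
    (hc : ∀ K, ContinuousOn (fun z => F z K) D) {H : Finset (Fin n)}
    (hh : ∀ a ∈ H, HolIn D a F) (hG : IsDerivExt D H F G) {h : Fin n} (hhH : h ∈ H) :
    ∃ G', IsStem D G' ∧ HolIn D h G' ∧ IsDerivExt D {h} G' G := by
  -- The variable h is treated last; uniqueness identifies the result with the given extension,
  -- whatever order produced it.
  obtain ⟨G', hG'⟩ := exists_isDerivExt hDc hD hF hc (H.erase h)
    fun a ha => hh a (Finset.mem_of_mem_erase ha)
  have hol := hG'.holIn hD (Finset.notMem_erase h H) (hh h hhH)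
  obtain ⟨G₁, hG₁⟩ := exists_isDerivExt_singleton hDc hD hG'.isStem hG'.cont hol
  have h1 := hG'.insert (Finset.notMem_erase h H) hG₁
  rw [Finset.insert_erase hhH] at h1
  refine ⟨G', hG'.isStem, hol, hG.isStem, hG.cont, fun z hz => ?_⟩
  rw [hG.unique hD h1 z hz.1, hG₁.eq z hz]

end SliceAnalysis

/-! ### Second derivatives of Im φ / β along curves -/

namespace SliceAnalysis

open Filter Topology

/-- The second derivative of a function in a direction, computed along a line. -/
theorem iteratedFDeriv_two_eq_of_line {E : Type*} [NormedAddCommGroup E] [NormedSpace ℝ E]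
    {f : E → ℝ} {x v : E} (hf : ContDiffAt ℝ 2 f x) {k : ℝ → ℝ} {k' : ℝ}
    (hk : ∀ᶠ t in 𝓝 (0 : ℝ), HasDerivAt (fun s : ℝ => f (x + s • v)) (k t) t)
    (hk' : HasDerivAt k k' 0) : iteratedFDeriv ℝ 2 f x ![v, v] = k' := by
  rw [iteratedFDeriv_two_apply]
  simp only [Matrix.cons_val_zero, Matrix.cons_val_one]
  have hline : ∀ t : ℝ, HasDerivAt (fun s : ℝ => x + s • v) v t := by
    intro t
    simpa using ((hasDerivAt_id t).smul_const v).const_add x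
  have hd : DifferentiableAt ℝ (fderiv ℝ f) (x + (0 : ℝ) • v) := by
    rw [zero_smul, add_zero]
    exact (hf.fderiv_right (m := 1) (by norm_num)).differentiableAt one_ne_zero
  have h1 : HasDerivAt (fun t : ℝ => fderiv ℝ f (x + t • v) v)
      (fderiv ℝ (fderiv ℝ f) (x + (0 : ℝ) • v) v v) 0 :=
    (ContinuousLinearMap.apply ℝ ℝ v).hasFDerivAt.comp_hasDerivAt (0 : ℝ)
      (hd.hasFDerivAt.comp_hasDerivAt (0 : ℝ) (hline 0))
  rw [zero_smul, add_zero] at h1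
  have hlim : Tendsto (fun t : ℝ => x + t • v) (𝓝 0) (𝓝 x) := by
    simpa using (hline 0).continuousAt.tendsto
  have hev : ∀ᶠ t in 𝓝 (0 : ℝ), DifferentiableAt ℝ f (x + t • v) :=
    hlim.eventually ((hf.eventually (by simp)).mono fun y hy => hy.differentiableAt two_ne_zero)
  have h2 : k =ᶠ[𝓝 0] fun t : ℝ => fderiv ℝ f (x + t • v) v := by
    filter_upwards [hk, hev] with t ht ht'
    exact ht.unique (ht'.hasFDerivAt.comp_hasDerivAt t (hline t))
  exact h1.unique (hk'.congr_of_eventuallyEq h2.symm)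

/-- The first two derivatives of `Im φ(α + i ρ) / ρ` along a curve with `ρ ρ' = c + t`. -/
theorem hasDerivAt_im_div {φ : ℂ → ℂ} {α c : ℝ} {ρ : ℝ → ℝ} {t : ℝ}
    (hφ : DifferentiableAt ℂ φ ⟨α, ρ t⟩) (h0 : ρ t ≠ 0)
    (hρ : HasDerivAt ρ ((c + t) / ρ t) t) :
    HasDerivAt (fun t => (ρ t)⁻¹ * (φ ⟨α, ρ t⟩).im)
      (((deriv φ ⟨α, ρ t⟩).re / ρ t ^ 2 - (φ ⟨α, ρ t⟩).im / ρ t ^ 3) * (c + t)) t ∧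
    HasDerivAt (fun t => (φ ⟨α, ρ t⟩).re) (-(deriv φ ⟨α, ρ t⟩).im * ((c + t) / ρ t)) t := by
  have hγ : HasDerivAt (fun t => (⟨α, ρ t⟩ : ℂ)) (((c + t) / ρ t : ℝ) * Complex.I) t := by
    have h1 := (hρ.ofReal_comp.mul_const Complex.I).const_add (α : ℂ)
    refine h1.congr_of_eventuallyEq (Eventually.of_forall fun s => ?_)
    apply Complex.ext <;> simp
  have h2 := hφ.hasDerivAt.scomp t hγ
  have him := Complex.imCLM.hasFDerivAt.comp_hasDerivAt t h2
  have hre := Complex.reCLM.hasFDerivAt.comp_hasDerivAt t h2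
  constructor
  · have h3 := (hρ.inv h0).mul him
    refine h3.congr_deriv ?_
    simp
    field_simp
    ring
  · refine hre.congr_deriv ?_
    simp
    ring

theorem hasDerivAt_im_div_two {φ : ℂ → ℂ} {α c : ℝ} {ρ : ℝ → ℝ}
    (hφ : DifferentiableAt ℂ φ ⟨α, ρ 0⟩) (hφ' : DifferentiableAt ℂ (deriv φ) ⟨α, ρ 0⟩)
    (h0 : ρ 0 ≠ 0) (hρ : HasDerivAt ρ (c / ρ 0) 0) :
    HasDerivAt (fun t =>
      ((deriv φ ⟨α, ρ t⟩).re / ρ t ^ 2 - (φ ⟨α, ρ t⟩).im / ρ t ^ 3) * (c + t))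
      ((-(deriv (deriv φ) ⟨α, ρ 0⟩).im / ρ 0 ^ 3 - 3 * (deriv φ ⟨α, ρ 0⟩).re / ρ 0 ^ 4
        + 3 * (φ ⟨α, ρ 0⟩).im / ρ 0 ^ 5) * c ^ 2
        + ((deriv φ ⟨α, ρ 0⟩).re / ρ 0 ^ 2 - (φ ⟨α, ρ 0⟩).im / ρ 0 ^ 3)) 0 := by
  have hρ' : HasDerivAt ρ ((c + 0) / ρ 0) 0 := by rwa [add_zero]
  have h1 := (hasDerivAt_im_div hφ h0 hρ').1
  have h2 := (hasDerivAt_im_div hφ' h0 hρ').2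
  have h3 := ((h2.div (hρ.pow 2) (pow_ne_zero 2 h0)).sub
    (h1.div (hρ.pow 2) (pow_ne_zero 2 h0))).mul ((hasDerivAt_id (0 : ℝ)).const_add c)
  -- Writing Im φ / ρ³ as (Im φ / ρ) / ρ² allows both first-order formulas to be reused, one for φ
  -- and one for its derivative. Where ρ = 0 the identity holds by the convention for division by
  -- zero.
  have h4 : (fun t => ((deriv φ ⟨α, ρ t⟩).re / ρ t ^ 2 - (φ ⟨α, ρ t⟩).im / ρ t ^ 3) * (c + t))
      = (fun t => ((deriv φ ⟨α, ρ t⟩).re / ρ t ^ 2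
        - (ρ t)⁻¹ * (φ ⟨α, ρ t⟩).im / ρ t ^ 2) * (c + t)) := by
    funext t
    congr 2
    by_cases h : ρ t = 0
    · simp [h]
    · field_simp
  rw [h4]
  refine h3.congr_deriv ?_
  simp
  field_simp
  ring

end SliceAnalysis

/-! ### Harmonicity off the real axis -/

namespace SliceAnalysis

open Filter Topology

theorem norm_im_eq (q : ℍ[ℝ]) : ‖q.im‖ = √(q.imI ^ 2 + q.imJ ^ 2 + q.imK ^ 2) := by
  rw [← Real.sqrt_sq (norm_nonneg q.im)]
  simp [sq, ← Quaternion.normSq_eq_norm_mul_self, Quaternion.normSq_def']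

theorem norm_im_sq (q : ℍ[ℝ]) : ‖q.im‖ ^ 2 = q.imI ^ 2 + q.imJ ^ 2 + q.imK ^ 2 := by
  rw [norm_im_eq, Real.sq_sqrt (by positivity)]

/-- The orthonormal basis `1, i, j, k` of the quaternions. -/
noncomputable def quatBasis : OrthonormalBasis (Fin 4) ℝ ℍ[ℝ] :=
  (EuclideanSpace.basisFun (Fin 4) ℝ).map Quaternion.linearIsometryEquivTuple.symm

theorem quatBasis_coords (i : Fin 4) :
    (quatBasis i).re = (if i = 0 then 1 else 0) ∧ (quatBasis i).imI = (if i = 1 then 1 else 0) ∧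
    (quatBasis i).imJ = (if i = 2 then 1 else 0) ∧
    (quatBasis i).imK = (if i = 3 then 1 else 0) := by
  have h : Quaternion.linearIsometryEquivTuple (quatBasis i) = EuclideanSpace.single i 1 := by
    rw [quatBasis, OrthonormalBasis.map_apply, LinearIsometryEquiv.apply_symm_apply,
      EuclideanSpace.basisFun_apply]
  have hj := fun j : Fin 4 => congrArg (fun v : EuclideanSpace ℝ (Fin 4) => v j) h
  refine ⟨(hj 0).trans ?_, (hj 1).trans ?_, (hj 2).trans ?_, (hj 3).trans ?_⟩ <;>
    simp [eq_comm]

/-- The imaginary part as a continuous linear map. -/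
noncomputable def imL : ℍ[ℝ] →L[ℝ] ℍ[ℝ] where
  toFun q := q.im
  map_add' _ _ := by ext <;> simp
  map_smul' _ _ := by ext <;> simp
  cont := Quaternion.continuous_im

/-- The real part as a continuous linear map. -/
noncomputable def reL : ℍ[ℝ] →L[ℝ] ℝ where
  toFun q := q.re
  map_add' _ _ := by simp
  map_smul' _ _ := by simp
  cont := Quaternion.continuous_re

/-- The quotient `Im φ(α + iβ) / β` at the quaternion `α + Jβ`. -/
noncomputable def imDiv (φ : ℂ → ℂ) (q : ℍ[ℝ]) : ℝ := ‖q.im‖⁻¹ * (φ (toC q)).im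

theorem contDiffAt_imDiv {φ : ℂ → ℂ} {q : ℍ[ℝ]} (hq : q.im ≠ 0) (hφ : AnalyticAt ℂ φ (toC q)) :
    ContDiffAt ℝ 2 (imDiv φ) q := by
  have h1 : ContDiffAt ℝ 2 (fun q : ℍ[ℝ] => ‖q.im‖) q :=
    ContDiffAt.comp (f := fun q : ℍ[ℝ] => q.im) q (contDiffAt_norm ℝ hq) imL.contDiff.contDiffAt
  have h2 : ContDiffAt ℝ 2 toC q := by
    have : toC = fun q : ℍ[ℝ] => (q.re : ℂ) + (‖q.im‖ : ℂ) * Complex.I := by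
      funext q
      apply Complex.ext <;> simp [toC]
    rw [this]
    exact (Complex.ofRealCLM.contDiff.contDiffAt.comp q reL.contDiff.contDiffAt).add
      ((Complex.ofRealCLM.contDiff.contDiffAt.comp q h1).mul contDiffAt_const)
  have h3 : ContDiffAt ℝ 2 φ (toC q) := hφ.restrictScalars.contDiffAt
  exact (h1.inv (norm_ne_zero_iff.2 hq)).mul
    (Complex.imCLM.contDiff.contDiffAt.comp q (h3.comp q h2))

/-- The second derivative in the direction of a purely imaginary unit with scalar product `c`
with `q`. -/
theorem iteratedFDeriv_imDiv_imag {φ : ℂ → ℂ} {q : ℍ[ℝ]} (hq : q.im ≠ 0)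
    (hφ : AnalyticAt ℂ φ (toC q)) {v : ℍ[ℝ]} (hv : v.re = 0) {c : ℝ}
    (hc : ∀ t : ℝ, ‖(q + t • v).im‖ ^ 2 = ‖q.im‖ ^ 2 + 2 * c * t + t ^ 2) :
    iteratedFDeriv ℝ 2 (imDiv φ) q ![v, v] =
      (-(deriv (deriv φ) (toC q)).im / ‖q.im‖ ^ 3 - 3 * (deriv φ (toC q)).re / ‖q.im‖ ^ 4
        + 3 * (φ (toC q)).im / ‖q.im‖ ^ 5) * c ^ 2
        + ((deriv φ (toC q)).re / ‖q.im‖ ^ 2 - (φ (toC q)).im / ‖q.im‖ ^ 3) := by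
  let ρ : ℝ → ℝ := fun t => ‖(q + t • v).im‖
  have hρ0 : ρ 0 = ‖q.im‖ := by simp [ρ]
  have hρ_cont : Continuous ρ := by
    have : Continuous fun t : ℝ => q + t • v := by fun_prop
    exact (Quaternion.continuous_im.comp this).norm
  -- Differentiating ρ² = ‖Im q‖² + 2ct + t² gives ρρ' = c + t, the form required by
  -- `hasDerivAt_im_div`.
  have hρ : ∀ t, ρ t ≠ 0 → HasDerivAt ρ ((c + t) / ρ t) t := by
    intro t ht
    have e : ρ = fun t => √(‖q.im‖ ^ 2 + 2 * c * t + t ^ 2) := by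
      funext s
      rw [← hc, Real.sqrt_sq (norm_nonneg _)]
    have h1 : HasDerivAt (fun t : ℝ => ‖q.im‖ ^ 2 + 2 * c * t + t ^ 2) (2 * (c + t)) t := by
      have := (((hasDerivAt_id t).const_mul (2 * c)).const_add (‖q.im‖ ^ 2)).add
        ((hasDerivAt_id t).pow 2)
      refine this.congr_deriv ?_
      simp
      ring
    have h2 := h1.sqrt (by rw [← hc]; exact pow_ne_zero 2 ht)
    rw [← e] at h2
    refine h2.congr_deriv ?_
    rw [← hc, Real.sqrt_sq (norm_nonneg _)]
    exact mul_div_mul_left _ _ two_ne_zero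
  have htoC : ∀ t : ℝ, toC (q + t • v) = ⟨q.re, ρ t⟩ := by
    intro t
    simp [toC, ρ, hv]
  have hz0 : toC q = ⟨q.re, ρ 0⟩ := by rw [← htoC, zero_smul, add_zero]
  have h0 : ρ 0 ≠ 0 := by rw [hρ0]; exact norm_ne_zero_iff.2 hq
  have hfun : (fun s : ℝ => imDiv φ (q + s • v)) = fun t => (ρ t)⁻¹ * (φ ⟨q.re, ρ t⟩).im := by
    funext s
    rw [imDiv, htoC]
  have hρ1 := hρ 0 h0
  rw [add_zero] at hρ1
  rw [hz0] at hφ ⊢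
  rw [← hρ0]
  refine iteratedFDeriv_two_eq_of_line (contDiffAt_imDiv hq (by rwa [hz0])) (k := fun t =>
      ((deriv φ ⟨q.re, ρ t⟩).re / ρ t ^ 2 - (φ ⟨q.re, ρ t⟩).im / ρ t ^ 3) * (c + t)) ?_
    (hasDerivAt_im_div_two hφ.differentiableAt hφ.deriv.differentiableAt h0 hρ1)
  rw [hfun]
  have hcont : Tendsto (fun t => (⟨q.re, ρ t⟩ : ℂ)) (𝓝 0) (𝓝 ⟨q.re, ρ 0⟩) := by
    have : (fun t => (⟨q.re, ρ t⟩ : ℂ)) = fun t => toC (q + t • v) := by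
      funext t; rw [htoC]
    rw [this, ← htoC]
    refine Continuous.tendsto ?_ 0
    exact continuous_toC.comp (by fun_prop)
  filter_upwards [hcont.eventually hφ.eventually_analyticAt,
    hρ_cont.continuousAt.eventually_ne h0] with t ht ht'
  exact (hasDerivAt_im_div ht.differentiableAt ht' (hρ t ht')).1

/-- A real translation keeps β fixed and moves the complex argument parallel to the real axis, so
only φ is differentiated. -/
theorem iteratedFDeriv_imDiv_real {φ : ℂ → ℂ} {q : ℍ[ℝ]} (hq : q.im ≠ 0)
    (hφ : AnalyticAt ℂ φ (toC q)) :
    iteratedFDeriv ℝ 2 (imDiv φ) q ![1, 1] = ‖q.im‖⁻¹ * (deriv (deriv φ) (toC q)).im := by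
  have htoC : ∀ t : ℝ, toC (q + t • 1) = toC q + (t : ℂ) := by
    intro t
    apply Complex.ext <;> simp [toC]
  have him : ∀ t : ℝ, ‖(q + t • (1 : ℍ[ℝ])).im‖ = ‖q.im‖ := by intro t; simp
  have hline : ∀ (ψ : ℂ → ℂ) (t : ℝ), DifferentiableAt ℂ ψ (toC q + (t : ℂ)) →
      HasDerivAt (fun t : ℝ => ‖q.im‖⁻¹ * (ψ (toC q + (t : ℂ))).im)
        (‖q.im‖⁻¹ * (deriv ψ (toC q + (t : ℂ))).im) t := by
    intro ψ t hψ
    have h1 : HasDerivAt (fun t : ℝ => toC q + (t : ℂ)) 1 t :=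
      ((hasDerivAt_id t).ofReal_comp).const_add _
    have h2 := Complex.imCLM.hasFDerivAt.comp_hasDerivAt t (hψ.hasDerivAt.scomp t h1)
    rw [one_smul] at h2
    exact h2.const_mul _
  have hcont : Tendsto (fun t : ℝ => toC q + (t : ℂ)) (𝓝 0) (𝓝 (toC q)) := by
    have : Continuous fun t : ℝ => toC q + (t : ℂ) := by fun_prop
    simpa using this.tendsto 0
  refine iteratedFDeriv_two_eq_of_line (contDiffAt_imDiv hq hφ)
    (k := fun t : ℝ => ‖q.im‖⁻¹ * (deriv φ (toC q + (t : ℂ))).im) ?_ ?_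
  · filter_upwards [hcont.eventually hφ.eventually_analyticAt] with t ht
    refine (hline φ t ht.differentiableAt).congr_of_eventuallyEq (Eventually.of_forall fun s => ?_)
    simp only [imDiv, htoC, him]
  · have := hline (deriv φ) 0 (by simpa using hφ.deriv.differentiableAt)
    simpa using this

/-- Write A = Im φ'', B = Re φ', C = Im φ. The squares of the three constants c add up to β², so the
imaginary directions give (-A/β³ - 3B/β⁴ + 3C/β⁵)β² + 3(B/β² - C/β³) = -A/β. The real direction
gives A/β. -/
theorem laplacian_imDiv {φ : ℂ → ℂ} {q : ℍ[ℝ]} (hq : q.im ≠ 0) (hφ : AnalyticAt ℂ φ (toC q)) :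
    Laplacian.laplacian (imDiv φ) q = 0 := by
  rw [InnerProductSpace.laplacian_eq_iteratedFDeriv_orthonormalBasis (imDiv φ) quatBasis]
  simp only [Fin.sum_univ_four]
  have e0 : quatBasis 0 = (1 : ℍ[ℝ]) := by ext <;> simp [quatBasis_coords]
  have h : ‖q.im‖ ≠ 0 := norm_ne_zero_iff.2 hq
  have h2 := norm_im_sq q
  rw [e0, iteratedFDeriv_imDiv_real hq hφ,
    iteratedFDeriv_imDiv_imag (v := quatBasis 1) (c := q.imI) hq hφ
      (by simp [quatBasis_coords]) (fun t => by rw [norm_im_sq, norm_im_sq]; simp [quatBasis_coords]; ring),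
    iteratedFDeriv_imDiv_imag (v := quatBasis 2) (c := q.imJ) hq hφ
      (by simp [quatBasis_coords]) (fun t => by rw [norm_im_sq, norm_im_sq]; simp [quatBasis_coords]; ring),
    iteratedFDeriv_imDiv_imag (v := quatBasis 3) (c := q.imK) hq hφ
      (by simp [quatBasis_coords]) (fun t => by rw [norm_im_sq, norm_im_sq]; simp [quatBasis_coords]; ring)]
  set A := (deriv (deriv φ) (toC q)).im
  set B := (deriv φ (toC q)).re
  set C := (φ (toC q)).im
  have h3 : ∀ X Y : ℝ, X * q.imI ^ 2 + Y + (X * q.imJ ^ 2 + Y) + (X * q.imK ^ 2 + Y)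
      = X * ‖q.im‖ ^ 2 + 3 * Y := by
    intro X Y; rw [h2]; ring
  rw [add_assoc, add_assoc, ← add_assoc (_ * q.imI ^ 2 + _), h3]
  field_simp
  ring

theorem harmonicAt_imDiv {φ : ℂ → ℂ} {q : ℍ[ℝ]} (hq : q.im ≠ 0) (hφ : AnalyticAt ℂ φ (toC q)) :
    InnerProductSpace.HarmonicAt (imDiv φ) q := by
  refine ⟨contDiffAt_imDiv hq hφ, ?_⟩
  filter_upwards [Quaternion.continuous_im.continuousAt.eventually_ne hq,
    continuous_toC.continuousAt.eventually hφ.eventually_analyticAt] with p hp hp'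
  exact laplacian_imDiv hp hp'

end SliceAnalysis

/-! ### Harmonicity across the real axis -/

namespace SliceAnalysis

open Filter Topology

/-- For a fixed unit J the map is an ℝ-algebra homomorphism from ℂ to ℍ, so products inside one
slice can be computed in ℂ. -/
theorem slicePt_eq_lift {J : ℍ[ℝ]} (hJ : J ∈ imUnits) (w : ℂ) :
    slicePt J w = Complex.liftAux J hJ w :=
  (Complex.liftAux_apply J hJ w).symm

/-- The divided difference of `wⁿ⁺¹` at `w` and its conjugate. -/
theorem sum_prod_conj_mul (w : ℂ) (n : ℕ) :
    (∑ k ∈ Finset.range (n + 1), ∏ i : Fin n, if (i : ℕ) < k then w else star w) * (w - star w)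
      = w ^ (n + 1) - star w ^ (n + 1) := by
  rw [← (Commute.all w (star w)).geom_sum₂_mul (n + 1)]
  congr 1
  refine Finset.sum_congr rfl fun k hk => ?_
  have hk : k < n + 1 := Finset.mem_range.1 hk
  rw [Fin.prod_univ_eq_prod_range (fun i => if i < k then w else star w) n, Finset.prod_ite,
    Finset.prod_const, Finset.prod_const]
  have e1 : ({i ∈ Finset.range n | i < k} : Finset ℕ) = Finset.range k := by
    ext i; simp; omega
  have e2 : ({i ∈ Finset.range n | ¬ i < k} : Finset ℕ) = Finset.Ico k n := by
    ext i; simp; omega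
  rw [e1, e2, Finset.card_range, Nat.card_Ico]
  congr 2

theorem sub_star_eq (u : ℂ) : u - star u = ((2 * u.im : ℝ) : ℂ) * Complex.I := by
  apply Complex.ext <;> simp; ring

/-- Both differences in the geometric sum have the form u - ū = 2i Im u, and the factor 2i cancels.
-/
theorem re_sum_prod_conj {w : ℂ} (hw : w.im ≠ 0) (n : ℕ) :
    (∑ k ∈ Finset.range (n + 1), ∏ i : Fin n, if (i : ℕ) < k then w else star w).re
      = w.im⁻¹ * (w ^ (n + 1)).im := by
  have h := sum_prod_conj_mul w n
  rw [← star_pow, sub_star_eq, sub_star_eq, ← mul_assoc] at h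
  have h2 := congrArg Complex.re (mul_right_cancel₀ Complex.I_ne_zero h)
  rw [Complex.re_mul_ofReal, Complex.ofReal_re] at h2
  field_simp
  linarith

/-- Conjugation of quaternions as a continuous linear map. -/
noncomputable def conjL : ℍ[ℝ] →L[ℝ] ℍ[ℝ] where
  toFun q := star q
  map_add' _ _ := by simp
  map_smul' _ _ := by simp
  cont := continuous_star

theorem norm_reL_le : ‖reL‖ ≤ 1 := by
  refine ContinuousLinearMap.opNorm_le_bound _ zero_le_one fun q => ?_
  rw [one_mul]
  change |q.re| ≤ ‖q‖
  refine abs_le_of_sq_le_sq ?_ (norm_nonneg q)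
  rw [sq ‖q‖, ← Quaternion.normSq_eq_norm_mul_self, Quaternion.normSq_def']
  nlinarith [sq_nonneg q.imI, sq_nonneg q.imJ, sq_nonneg q.imK]

theorem norm_conjL_le : ‖conjL‖ ≤ 1 := by
  refine ContinuousLinearMap.opNorm_le_bound _ zero_le_one fun q => ?_
  rw [one_mul]
  exact (Quaternion.norm_star q).le

/-- The real part of the product of `n` quaternions, those with index at least `k` being
conjugated. -/
noncomputable def conjMonomial (n k : ℕ) : ContinuousMultilinearMap ℝ (fun _ : Fin n => ℍ[ℝ]) ℝ :=
  reL.compContinuousMultilinearMap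
    ((ContinuousMultilinearMap.mkPiAlgebraFin ℝ n ℍ[ℝ]).compContinuousLinearMap
      fun i => if (i : ℕ) < k then ContinuousLinearMap.id ℝ ℍ[ℝ] else conjL)

theorem norm_conjMonomial_le (n k : ℕ) : ‖conjMonomial n k‖ ≤ 1 := by
  refine (ContinuousLinearMap.norm_compContinuousMultilinearMap_le _ _).trans ?_
  refine mul_le_one₀ norm_reL_le (norm_nonneg _) ?_
  refine (ContinuousMultilinearMap.norm_compContinuousLinearMap_le _ _).trans ?_
  rw [ContinuousMultilinearMap.norm_mkPiAlgebraFin, one_mul]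
  refine Finset.prod_le_one (fun _ _ => norm_nonneg _) fun i _ => ?_
  split_ifs
  · exact ContinuousLinearMap.norm_id_le
  · exact norm_conjL_le

/-- On the diagonal all factors, conjugated or not, lie in the same slice, where the product is that
of complex numbers. -/
theorem conjMonomial_slicePt {J : ℍ[ℝ]} (hJ : J ∈ imUnits) (w : ℂ) (n k : ℕ) :
    conjMonomial n k (fun _ => slicePt J w)
      = (∏ i : Fin n, if (i : ℕ) < k then w else star w).re := by
  have h1 : (List.ofFn fun i : Fin n =>
      (if (i : ℕ) < k then ContinuousLinearMap.id ℝ ℍ[ℝ] else conjL) (slicePt J w)).prod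
      = slicePt J (∏ i : Fin n, if (i : ℕ) < k then w else star w) := by
    rw [slicePt_eq_lift hJ (∏ i : Fin n, if (i : ℕ) < k then w else star w), ← List.prod_ofFn,
      map_list_prod, List.map_ofFn]
    congr 2
    funext i
    rw [Function.comp_apply]
    split_ifs
    · rw [← slicePt_eq_lift hJ]; rfl
    · rw [← slicePt_eq_lift hJ, ← star_slicePt hJ]; rfl
  have h2 : conjMonomial n k (fun _ => slicePt J w) = reL (List.ofFn fun i : Fin n =>
      (if (i : ℕ) < k then ContinuousLinearMap.id ℝ ℍ[ℝ] else conjL) (slicePt J w)).prod := rfl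
  rw [h2, h1]
  change (slicePt J _).re = _
  simp [slicePt, (re_of_mem_imUnits hJ).1]

/-- The power series on the quaternions obtained from a power series with real coefficients by
replacing `zⁿ⁺¹` by `Im zⁿ⁺¹ / Im z`. -/
noncomputable def divSeries (c : ℕ → ℝ) : FormalMultilinearSeries ℝ ℍ[ℝ] ℝ := fun n =>
  c (n + 1) • ∑ k ∈ Finset.range (n + 1), conjMonomial n k

theorem norm_divSeries_le (c : ℕ → ℝ) (n : ℕ) : ‖divSeries c n‖ ≤ |c (n + 1)| * (n + 1) := by
  refine ContinuousMultilinearMap.opNorm_le_bound (by positivity) fun m => ?_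
  have h1 : divSeries c n m = c (n + 1) * ∑ k ∈ Finset.range (n + 1), conjMonomial n k m := by
    rw [divSeries, smul_apply, sum_apply, smul_eq_mul]
  have h2 : ∀ k, ‖conjMonomial n k m‖ ≤ ∏ i, ‖m i‖ := fun k => by
    have := (conjMonomial n k).le_of_opNorm_le (norm_conjMonomial_le n k) m
    rwa [one_mul] at this
  rw [h1, norm_mul, Real.norm_eq_abs, mul_assoc]
  gcongr
  refine (norm_sum_le _ _).trans ((Finset.sum_le_sum fun k _ => h2 k).trans ?_)
  simp

/-- The n + 1 monomials of degree n cost a factor n + 1 ≤ 2ⁿ, which is absorbed by halving the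
radius. -/
theorem divSeries_radius_pos {c : ℕ → ℝ} {r C : ℝ} (hr : 0 < r)
    (h : ∀ n, |c n| * r ^ n ≤ C) : 0 < (divSeries c).radius := by
  have hr2 : (0 : ℝ) < r / 2 := by positivity
  refine lt_of_lt_of_le ?_ ((divSeries c).le_radius_of_bound (C / r) (r := ⟨r / 2, hr2.le⟩) ?_)
  · exact ENNReal.coe_pos.2 hr2
  · intro n
    change ‖divSeries c n‖ * (r / 2) ^ n ≤ C / r
    have h1 : ((n : ℝ) + 1) ≤ 2 ^ n := by exact_mod_cast Nat.lt_two_pow_self (n := n)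
    calc ‖divSeries c n‖ * (r / 2) ^ n ≤ (|c (n + 1)| * (n + 1)) * (r / 2) ^ n := by
          gcongr; exact norm_divSeries_le c n
      _ ≤ (|c (n + 1)| * 2 ^ n) * (r / 2) ^ n := by gcongr
      _ = |c (n + 1)| * r ^ (n + 1) / r := by
          rw [div_pow]; field_simp; ring
      _ ≤ C / r := by gcongr; exact h _

theorem divSeries_apply (c : ℕ → ℝ) (n : ℕ) {q : ℍ[ℝ]} (hq : q.im ≠ 0) :
    divSeries c n (fun _ => q) = c (n + 1) * (‖q.im‖⁻¹ * (toC q ^ (n + 1)).im) := by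
  have h : (toC q).im ≠ 0 := norm_ne_zero_iff.2 hq
  have h2 := re_sum_prod_conj h n
  rw [Complex.re_sum] at h2
  have h3 : ∀ k, conjMonomial n k (fun _ => q)
      = (∏ i : Fin n, if (i : ℕ) < k then toC q else star (toC q)).re := by
    intro k
    rw [← conjMonomial_slicePt (unitIm_mem q), slicePt_unitIm_toC]
  rw [divSeries, smul_apply, sum_apply]
  simp only [h3, h2, smul_eq_mul]
  rfl

theorem dense_im_ne_zero : Dense {q : ℍ[ℝ] | q.im ≠ 0} := by
  intro q
  by_cases hq : q.im = 0
  · have h1 : Tendsto (fun t : ℝ => q + t • iUnit) (𝓝[>] 0) (𝓝 q) := by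
      have : Continuous (fun t : ℝ => q + t • iUnit) := by fun_prop
      have h := this.tendsto 0
      rw [zero_smul, add_zero] at h
      exact h.mono_left nhdsWithin_le_nhds
    refine mem_closure_of_tendsto h1 ?_
    filter_upwards [self_mem_nhdsWithin] with t ht h0
    have h2 := congrArg (fun q : ℍ[ℝ] => q.imI) h0
    have h3 := congrArg (fun q : ℍ[ℝ] => q.imI) hq
    simp only [Quaternion.imI_im, Quaternion.imI_add, Quaternion.imI_smul,
      Quaternion.imI_zero] at h2 h3
    rw [h3] at h2
    have ht : (0 : ℝ) < t := ht
    simp [iUnit] at h2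
    exact ht.ne' h2
  · exact subset_closure hq

/-- Near a real point, a continuous function that coincides with `Im φ(α + iβ) / β` off the real
axis, with `φ` holomorphic and compatible with the conjugation, is analytic. -/
theorem analyticAt_of_eq_imDiv {φ : ℂ → ℂ} {α : ℝ} (hφ : AnalyticAt ℂ φ α)
    (hconj : ∀ᶠ z in 𝓝 (α : ℂ), φ (star z) = star (φ z)) {g : ℍ[ℝ] → ℝ}
    (hg : ∀ᶠ q in 𝓝 (α : ℍ[ℝ]), ContinuousAt g q)
    (heq : ∀ᶠ q in 𝓝 (α : ℍ[ℝ]), q.im ≠ 0 → g q = imDiv φ q) :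
    AnalyticAt ℝ g (α : ℍ[ℝ]) := by
  obtain ⟨p, R, hp⟩ := hφ
  -- The coefficients of φ are real by the symmetry, but this need not be proved: the series of φ(w)
  -- - φ(w̄), divided by 2iβ, has the terms p_n Im wⁿ / β, and taking real parts leaves Re p_n.
  let c : ℕ → ℝ := fun n => (p.coeff n).re
  obtain ⟨r, hr0, hrR⟩ := ENNReal.lt_iff_exists_nnreal_btwn.1 hp.r_pos
  have hr0' : (0 : ℝ) < r := by exact_mod_cast hr0
  obtain ⟨C, -, hC⟩ := p.norm_mul_pow_le_of_lt_radius (hrR.trans_le hp.r_le)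
  have hrad : 0 < (divSeries c).radius := by
    refine divSeries_radius_pos (r := r) (C := C) hr0' fun n => ?_
    refine le_trans ?_ (hC n)
    gcongr
    rw [FormalMultilinearSeries.norm_apply_eq_norm_coef]
    exact Complex.abs_re_le_norm _
  have hP := (divSeries c).hasFPowerSeriesOnBall hrad
  have hsub : Tendsto (fun q : ℍ[ℝ] => q - (α : ℍ[ℝ])) (𝓝 (α : ℍ[ℝ])) (𝓝 0) := by
    have : Continuous fun q : ℍ[ℝ] => q - (α : ℍ[ℝ]) := by fun_prop
    simpa using this.tendsto (α : ℍ[ℝ])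
  have htoC0 : toC 0 = 0 := by apply Complex.ext <;> simp [toC]
  have htoC : Tendsto (fun q : ℍ[ℝ] => toC (q - (α : ℍ[ℝ]))) (𝓝 (α : ℍ[ℝ])) (𝓝 0) := by
    have := continuous_toC.tendsto 0
    rw [htoC0] at this
    exact this.comp hsub
  have hadd : ∀ q : ℍ[ℝ], (α : ℂ) + toC (q - (α : ℍ[ℝ])) = toC q := by
    intro q; apply Complex.ext <;> simp [toC]
  have htoC' : Tendsto toC (𝓝 (α : ℍ[ℝ])) (𝓝 (α : ℂ)) := by
    have h1 : toC (α : ℍ[ℝ]) = (α : ℂ) := by apply Complex.ext <;> simp [toC]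
    rw [← h1]
    exact continuous_toC.tendsto _
  have hev : ∀ᶠ q in 𝓝 (α : ℍ[ℝ]), q.im ≠ 0 → g q = (divSeries c).sum (q - (α : ℍ[ℝ])) := by
    filter_upwards [heq, htoC'.eventually hconj, htoC.eventually (Metric.eball_mem_nhds 0 hp.r_pos)]
      with q hq hqc hqR him
    rw [hq him]
    set w := toC (q - (α : ℍ[ℝ])) with hw
    have him' : (q - (α : ℍ[ℝ])).im = q.im := by simp
    have himC : (‖q.im‖ : ℂ) ≠ 0 := by exact_mod_cast norm_ne_zero_iff.2 him
    have hs1 := hp.hasSum hqR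
    have hwstar : star w ∈ Metric.eball (0 : ℂ) R := by
      change edist (star w) 0 < R
      have : edist w 0 < R := hqR
      have h1 : edist (star w) 0 = edist w 0 := by
        rw [edist_zero_right, edist_zero_right, enorm_eq_iff_norm_eq, norm_star]
      rwa [h1]
    have hs2 := hp.hasSum hwstar
    have e1 : (α : ℂ) + star w = star (toC q) := by
      rw [← hadd q]; simp [hw]
    rw [hadd q] at hs1
    rw [e1, hqc] at hs2
    have hs3 := (hs1.sub hs2).mul_left (((2 * ‖q.im‖ : ℝ) : ℂ) * Complex.I)⁻¹
    have hs4 : HasSum (fun n => c n * (‖q.im‖⁻¹ * (w ^ n).im)) (imDiv φ q) := by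
      have := Complex.hasSum_re hs3
      have key : ∀ u v : ℂ, ((((2 * ‖q.im‖ : ℝ) : ℂ) * Complex.I)⁻¹ * (u * v - star u * v)).re
          = v.re * (‖q.im‖⁻¹ * u.im) := by
        intro u v
        have : u * v - star u * v = ((2 * ‖q.im‖ : ℝ) : ℂ) * Complex.I *
            ((‖q.im‖⁻¹ * u.im : ℝ) * v) := by
          rw [← sub_mul, sub_star_eq]
          push_cast
          field_simp
        rw [this, ← mul_assoc, inv_mul_cancel₀, one_mul, Complex.re_ofReal_mul, mul_comm]
        exact mul_ne_zero (by push_cast; exact mul_ne_zero two_ne_zero himC) Complex.I_ne_zero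
      convert this using 1
      · funext n
        rw [FormalMultilinearSeries.apply_eq_pow_smul_coeff,
          FormalMultilinearSeries.apply_eq_pow_smul_coeff, smul_eq_mul, smul_eq_mul, ← star_pow, key]
      · have := key (φ (toC q)) 1
        rw [mul_one, mul_one] at this
        rw [this, imDiv]
        simp
    -- The constant term drops out because Im w⁰ = 0, which explains the shift of the index in
    -- `divSeries`.
    have hs5 := (hasSum_nat_add_iff' 1).2 hs4
    simp only [Finset.range_one, Finset.sum_singleton, pow_zero, Complex.one_im, mul_zero,
      sub_zero] at hs5
    rw [FormalMultilinearSeries.sum, ← hs5.tsum_eq]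
    refine tsum_congr fun n => ?_
    rw [divSeries_apply c n (by rwa [him']), him']
  have hPan : AnalyticAt ℝ (fun q : ℍ[ℝ] => (divSeries c).sum (q - (α : ℍ[ℝ]))) (α : ℍ[ℝ]) := by
    have h1 : AnalyticAt ℝ (divSeries c).sum ((α : ℍ[ℝ]) - (α : ℍ[ℝ])) := by
      rw [sub_self]; exact hP.analyticAt
    exact h1.comp (f := fun q : ℍ[ℝ] => q - (α : ℍ[ℝ])) (by fun_prop)
  refine hPan.congr ?_
  -- So far the series equals g only off the real axis; both being continuous on a ball, they agree
  -- on all of it.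
  obtain ⟨ε, hε, hball⟩ := Metric.eventually_nhds_iff_ball.1
    ((hev.and hg).and hPan.eventually_analyticAt)
  filter_upwards [Metric.ball_mem_nhds _ hε] with q hq
  have h1 : Set.EqOn (fun q : ℍ[ℝ] => (divSeries c).sum (q - (α : ℍ[ℝ]))) g
      (Metric.ball (α : ℍ[ℝ]) ε ∩ {q | q.im ≠ 0}) :=
    fun q hq => ((hball q hq.1).1.1 hq.2).symm
  exact h1.of_subset_closure (t := Metric.ball (α : ℍ[ℝ]) ε)
    (fun q hq => (hball q hq).2.continuousAt.continuousWithinAt)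
    (fun q hq => (hball q hq).1.2.continuousWithinAt) Set.inter_subset_left
    (dense_im_ne_zero.open_subset_closure_inter Metric.isOpen_ball) hq

/-- The Laplacian of an analytic function is continuous, so its vanishing off the real axis
propagates to the real points. -/
theorem AnalyticAt.harmonicAt_of_dense {g : ℍ[ℝ] → ℝ} {q : ℍ[ℝ]} (hg : AnalyticAt ℝ g q)
    (h : ∀ᶠ p in 𝓝 q, p.im ≠ 0 → Laplacian.laplacian g p = 0) :
    InnerProductSpace.HarmonicAt g q := by
  refine ⟨hg.contDiffAt, ?_⟩
  obtain ⟨ε, hε, hball⟩ := Metric.eventually_nhds_iff_ball.1 (h.and hg.eventually_analyticAt)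
  have hcont : ContinuousOn (Laplacian.laplacian g) (Metric.ball q ε) := by
    rw [InnerProductSpace.laplacian_eq_iteratedFDeriv_orthonormalBasis g quatBasis]
    have hd : ContinuousOn (iteratedFDeriv ℝ 2 g) (Metric.ball q ε) :=
      (AnalyticOnNhd.iteratedFDeriv (fun p hp => (hball p hp).2) 2).continuousOn
    refine continuousOn_finsetSum _ fun i _ => ?_
    exact (ContinuousMultilinearMap.apply ℝ (fun _ : Fin 2 => ℍ[ℝ]) ℝ
      ![quatBasis i, quatBasis i]).continuous.comp_continuousOn hd
  filter_upwards [Metric.ball_mem_nhds q hε] with p hp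
  have h1 : Set.EqOn (Laplacian.laplacian g) 0 (Metric.ball q ε ∩ {q | q.im ≠ 0}) :=
    fun p hp => (hball p hp.1).1 hp.2
  exact h1.of_subset_closure hcont continuousOn_const Set.inter_subset_left
    (dense_im_ne_zero.open_subset_closure_inter Metric.isOpen_ball) hp

theorem harmonicAt_of_eq_imDiv {φ : ℂ → ℂ} {U : Set ℂ} (hU : IsOpen U)
    (hφ : DifferentiableOn ℂ φ U) (hconj : ∀ z ∈ U, φ (star z) = star (φ z)) {g : ℍ[ℝ] → ℝ}
    (hg : ContinuousOn g (toC ⁻¹' U)) (heq : ∀ q, toC q ∈ U → q.im ≠ 0 → g q = imDiv φ q)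
    {q : ℍ[ℝ]} (hq : toC q ∈ U) : InnerProductSpace.HarmonicAt g q := by
  have hV : IsOpen (toC ⁻¹' U) := hU.preimage continuous_toC
  have han : ∀ z ∈ U, AnalyticAt ℂ φ z := fun z hz => hφ.analyticAt (hU.mem_nhds hz)
  have hoff : ∀ p, toC p ∈ U → p.im ≠ 0 → InnerProductSpace.HarmonicAt g p := by
    intro p hp him
    refine (InnerProductSpace.harmonicAt_congr_nhds ?_).2 (harmonicAt_imDiv him (han _ hp))
    filter_upwards [hV.mem_nhds hp,
      Quaternion.continuous_im.continuousAt.eventually_ne him] with p' hp' him'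
    exact heq p' hp' him'
  by_cases him : q.im = 0
  · obtain ⟨α, rfl⟩ : ∃ α : ℝ, q = (α : ℍ[ℝ]) := ⟨q.re, by
      conv_lhs => rw [← Quaternion.re_add_im q, him, add_zero]⟩
    have e : toC (α : ℍ[ℝ]) = (α : ℂ) := by apply Complex.ext <;> simp [toC]
    have hαU : (α : ℂ) ∈ U := e ▸ hq
    refine AnalyticAt.harmonicAt_of_dense (analyticAt_of_eq_imDiv (han _ hαU)
      (eventually_of_mem (hU.mem_nhds hαU) hconj) ?_ ?_) ?_
    · exact eventually_of_mem (hV.mem_nhds hq) fun p hp => hg.continuousAt (hV.mem_nhds hp)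
    · exact eventually_of_mem (hV.mem_nhds hq) heq
    · filter_upwards [hV.mem_nhds hq] with p hp hpim
      exact (hoff p hp hpim).2.self_of_nhds
  · exact hoff q hq him

end SliceAnalysis

/-! ### Extended components of a slice regular function -/

namespace SliceAnalysis

open Filter Topology Function

variable {n : ℕ}

/-- A function whose stem function extends a spherical derivative with respect to `x_h` of a stem
function holomorphic in `z_h` is harmonic in `x_h`. -/
theorem isHarmonicIn_inducedFn {D : Set (Fin n → ℂ)} (hDc : ConjInvariant D) (hD : IsOpen D)
    {h : Fin n} {G' G : StemMap n} (hG' : IsStem D G') (hol : HolIn D h G')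
    (hG : IsDerivExt D {h} G' G) : IsHarmonicIn D h (inducedFn G) := by
  intro y hy
  set z : Fin n → ℂ := fun i => toC (y i) with hz
  have hzD : z ∈ D := (mem_circ_iff hDc).1 hy
  have hU : IsOpen {w | update z h w ∈ D} := isOpen_section hD h z
  have hyU : toC (y h) ∈ {w | update z h w ∈ D} := by
    change update z h (z h) ∈ D
    rwa [update_eq_self]
  have hterm : ∀ T, h ∉ T →
      InnerProductSpace.HarmonicAt (fun t => G (update z h (toC t)) T) (y h) := by
    intro T hT
    refine harmonicAt_of_coord fun ℓ => ?_
    refine harmonicAt_of_eq_imDiv (φ := fun w => pairing ℓ h G' T (update z h w)) hU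
      (fun w hw => ?_) (fun w hw => ?_) ?_ (fun q hq him => ?_) hyU
    · have := hol _ hw T hT ℓ
      simp only [update_idem, update_self] at this
      exact this.differentiableWithinAt
    -- The parity of the stem function in z_h is the reflection symmetry of the pairing: the
    -- component T is even and T ∪ {h} is odd.
    · have e : update z h (star w) = conjAt h (update z h w) := by simp [conjAt]
      rw [e]
      apply Complex.ext
      · simp [hG'.conjAt_apply hw, hT]
      · simp [hG'.conjAt_apply hw]
    · refine ℓ.continuous.comp_continuousOn ((hG.cont T).comp ?_ fun q hq => hq)
      exact (continuous_const.update h continuous_toC).continuousOn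
    · have hmem : update z h (toC q) ∈ offReal D {h} := by
        refine ⟨hq, fun i hi => ?_⟩
        obtain rfl := Finset.mem_singleton.1 hi
        rw [update_self]
        exact norm_ne_zero_iff.2 him
      have e1 : Disjoint T {h} := by simpa using hT
      have e2 : T ∪ {h} = insert h T := by ext i; simp
      rw [hG.eq _ hmem, stemDeriv, if_pos e1, Finset.prod_singleton, update_self, e2, map_smul,
        smul_eq_mul, imDiv, pairing_im]
      rfl
  have hsum : InnerProductSpace.HarmonicAt (fun t => ∑ T : Finset (Fin n) with h ∉ T,
      ordProd T (fun i => unitIm (y i)) * G (update z h (toC t)) T) (y h) :=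
    harmonicAt_finsetSum fun T hT => (hterm T (Finset.mem_filter.1 hT).2).comp_CLM
      (l := ContinuousLinearMap.mul ℝ ℍ[ℝ] (ordProd T fun i => unitIm (y i)))
  refine (InnerProductSpace.harmonicAt_congr_nhds ?_).2 hsum
  filter_upwards [(hU.preimage continuous_toC).mem_nhds hyU] with t ht
  have ht : update z h (toC t) ∈ D := ht
  rw [inducedFn, toC_update, unitIm_update,
    ← Finset.sum_filter_add_sum_filter_not Finset.univ (fun T => h ∉ T)]
  -- The terms whose unit J_h would depend on x_h have vanishing components; in the others the left
  -- factor J_T is constant in x_h.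
  have h0 : ∑ T : Finset (Fin n) with ¬ h ∉ T,
      ordProd T (update (fun i => unitIm (y i)) h (unitIm t)) * G (update z h (toC t)) T = 0 := by
    refine Finset.sum_eq_zero fun T hT => ?_
    have hT : h ∈ T := by simpa using hT
    rw [hG.eq_zero hD ht (by simpa using hT), mul_zero]
  rw [h0, add_zero]
  refine Finset.sum_congr rfl fun T hT => ?_
  rw [ordProd_update_of_notMem (Finset.mem_filter.1 hT).2]

theorem continuous_recCoef (H K V : Finset (Fin n)) : Continuous fun z => recCoef H K z V := by
  unfold recCoef
  refine continuous_const.mul (continuous_finsetProd _ fun i _ => ?_)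
  split_ifs <;> fun_prop

theorem continuousOn_sum_recCoef {D : Set (Fin n → ℂ)} {H : Finset (Fin n)}
    {G : Finset (Fin n) → StemMap n}
    (hG : ∀ K ⊆ H, ∀ T, ContinuousOn (fun z => G K z T) D) (V : Finset (Fin n)) :
    ContinuousOn (fun z => ∑ K ∈ H.powerset, recCoef H K z V • G K z (V \ H)) D :=
  continuousOn_finsetSum _ fun K hK => (continuous_recCoef H K V).continuousOn.fun_smul
    (hG K (Finset.mem_powerset.1 hK) _)

theorem sum_recCoef_smul_offReal {D : Set (Fin n → ℂ)} {F : StemMap n} {H : Finset (Fin n)}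
    {G : Finset (Fin n) → StemMap n}
    (hG : ∀ K ⊆ H, ∀ z ∈ offReal D H, G K z = stemDeriv H (stemMul (varStem K) F) z)
    {z : Fin n → ℂ} (hz : z ∈ offReal D H) (V : Finset (Fin n)) :
    ∑ K ∈ H.powerset, recCoef H K z V • G K z (V \ H) = F z V := by
  rw [← sum_recCoef_smul H F hz.2 V]
  exact Finset.sum_congr rfl fun K hK => by rw [hG K (Finset.mem_powerset.1 hK) z hz]

theorem sum_recCoef_smul_of_isDerivExt {D : Set (Fin n → ℂ)} (hD : IsOpen D) {F : StemMap n}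
    (hc : ∀ K, ContinuousOn (fun z => F z K) D) {H : Finset (Fin n)}
    {G : Finset (Fin n) → StemMap n}
    (hG : ∀ K ⊆ H, IsDerivExt D H (stemMul (varStem K) F) (G K)) {z : Fin n → ℂ} (hz : z ∈ D)
    (V : Finset (Fin n)) :
    ∑ K ∈ H.powerset, recCoef H K z V • G K z (V \ H) = F z V := by
  have h : Set.EqOn (fun z => ∑ K ∈ H.powerset, recCoef H K z V • G K z (V \ H))
      (fun z => F z V) (offReal D H) := fun z hz =>
    sum_recCoef_smul_offReal (fun K hK => (hG K hK).eq) hz V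
  exact h.of_subset_closure (continuousOn_sum_recCoef (fun K hK => (hG K hK).cont) V) (hc V)
    (offReal_subset D H) (subset_closure_offReal hD H) hz

theorem IsDerivExt.eqOn_almansi {D : Set (Fin n → ℂ)} (hDc : ConjInvariant D) {F G : StemMap n}
    {f : (Fin n → ℍ[ℝ]) → ℍ[ℝ]} (hF : IsStem D F) (hf : Induces D F f) {H K : Finset (Fin n)}
    (hG : IsDerivExt D H (stemMul (varStem K) F) G) :
    Set.EqOn (inducedFn G) (almansi D H K f) (circ (offReal D H)) := fun _ hx => by
  rw [almansi_eq hDc hF hf H K (circ_mono (offReal_subset D H) hx)]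
  exact inducedFn_eqOn (hDc.offReal H) hG.eq hx

theorem exists_isDerivExt_varStem {D : Set (Fin n → ℂ)} (hDc : ConjInvariant D) (hD : IsOpen D)
    {F : StemMap n} (hF : IsStem D F) (hc : ∀ K, ContinuousOn (fun z => F z K) D)
    (hh : ∀ a, HolIn D a F) (H K : Finset (Fin n)) :
    ∃ G, IsDerivExt D H (stemMul (varStem K) F) G :=
  exists_isDerivExt hDc hD ((isStem_varStem D K).stemMul hF) (continuousOn_stemMul_varStem hc K) H
    fun a _ => (hh a).stemMul_varStem K

theorem IsSliceRegular.exists_extension {D : Set (Fin n → ℂ)} (hDc : ConjInvariant D)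
    (hD : IsOpen D) {f : (Fin n → ℍ[ℝ]) → ℍ[ℝ]} (hf : IsSliceRegular D f) (H : Finset (Fin n)) :
    ∃ g : Finset (Fin n) → (Fin n → ℍ[ℝ]) → ℍ[ℝ],
      (∀ K ⊆ H,
        ContinuousOn (g K) (circ D) ∧
        Set.EqOn (g K) (almansi D H K f) (circ (offReal D H)) ∧
        (∀ h ∈ H, IsCircularIn D h (g K)) ∧
        (∀ p, IsLeast {i | i ∉ H} p → IsSliceIn D p (g K)) ∧
        (∀ h ∈ H, IsHarmonicIn D h (g K))) ∧
      ∀ x ∈ circ D, f x = ∑ K ∈ H.powerset, (-1 : ℝ) ^ (H \ K).card •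
        sliceMul D (fun y => ordProd (H \ K) (fun i => star (y i))) (g K) x := by
  have hreg := hf
  obtain ⟨F, hF, hFf, -⟩ := hf
  obtain ⟨hc, hh⟩ := (isSliceRegular_iff hD hF hFf).1 hreg
  choose G hG using exists_isDerivExt_varStem hDc hD hF hc hh H
  have hind : ∀ K, Induces D (G K) (inducedFn (G K)) := fun K =>
    induces_inducedFn hDc (hG K).isStem
  refine ⟨fun K => inducedFn (G K), fun K _ => ⟨?_, ?_, fun h hhH => ?_, fun p hp => ?_,
    fun h hhH => ?_⟩, fun x hx => ?_⟩
  · exact continuousOn_inducedFn hDc (hG K).isStem (hG K).cont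
  · exact (hG K).eqOn_almansi hDc hF hFf
  · exact isCircularIn_of_stem hDc (hG K).isStem (hind K) fun z hz T hT =>
      (hG K).eq_zero hD hz (Finset.not_disjoint_iff.2 ⟨h, hT, hhH⟩)
  · exact isSliceIn_of_stem hDc (hG K).isStem (hind K) fun z hz T hT =>
      (hG K).eq_zero hD hz (not_disjoint_of_isLeast hp hT)
  · obtain ⟨G', hG', hol, hext⟩ := (hG K).exists_singleton hDc hD
      ((isStem_varStem D K).stemMul hF) (continuousOn_stemMul_varStem hc K)
      (fun a _ => (hh a).stemMul_varStem K) hhH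
    exact isHarmonicIn_inducedFn hDc hD hG' hol hext
  · exact decomposition_of_stem hDc hFf (fun K _ => (hG K).isStem) (fun K _ => hind K)
      (fun K _ z hz T hT => (hG K).eq_zero hD hz hT)
      (fun z hz V => sum_recCoef_smul_of_isDerivExt hD hc (fun K _ => hG K) hz V) hx

end SliceAnalysis

/-! ### Regularity in one variable and the converse -/

namespace SliceAnalysis

open Filter Topology Function

variable {n : ℕ}

theorem isOpen_sectionSet {D : Set (Fin n → ℂ)} (hDc : ConjInvariant D) (hD : IsOpen D)
    (p : Fin n) {J : Fin n → ℍ[ℝ]} (hJ : ∀ i, J i ∈ imUnits) (z : Fin n → ℂ) :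
    IsOpen (sectionSet D p (fun i => slicePt (J i) (z i))) := by
  have : sectionSet D p (fun i => slicePt (J i) (z i))
      = (fun w : Fin 1 → ℂ => w 0) ⁻¹' {w | update z p w ∈ D} :=
    Set.ext fun w => mem_sectionSet hDc hJ
  rw [this]
  exact (isOpen_section hD p z).preimage (continuous_apply 0)

/-- Left multiplication by J_T is real linear and can be absorbed into the form ℓ. Holomorphy of G
in z_p thus passes to the sections. -/
theorem pairing_sectionStem (ℓ : ℍ[ℝ] →L[ℝ] ℝ) (p : Fin n) (J : Fin n → ℍ[ℝ]) (z : Fin n → ℂ)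
    (G : StemMap n) (v : Fin 1 → ℂ) :
    pairing ℓ 0 (sectionStem p J z G) ∅ v = ∑ T : Finset (Fin n) with p ∉ T,
      pairing (ℓ.comp (ContinuousLinearMap.mul ℝ ℍ[ℝ] (ordProd T J))) p G T
        (update z p (v 0)) := by
  apply Complex.ext
  · rw [Complex.re_sum]
    simp [sectionStem]
  · rw [Complex.im_sum]
    simp [sectionStem]

theorem isSliceRegularIn_of_holIn {D : Set (Fin n → ℂ)} (hDc : ConjInvariant D) (hD : IsOpen D)
    {G : StemMap n} {g : (Fin n → ℍ[ℝ]) → ℍ[ℝ]} (hG : IsStem D G) (hg : Induces D G g)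
    {p : Fin n} (hG0 : ∀ z ∈ D, ∀ T, (∃ i ∈ T, i < p) → G z T = 0)
    (hc : ∀ K, ContinuousOn (fun z => G z K) D) (hol : HolIn D p G) :
    IsSliceRegularIn D p g := by
  refine ⟨⟨G, hG, hg⟩, ?_⟩
  rintro y ⟨z, _, J, hJ, rfl⟩
  refine (isSliceRegular_iff (isOpen_sectionSet hDc hD p hJ z) (isStem_sectionStem hDc hG p hJ z)
    (induces_sectionStem hDc hg hG0 hJ z)).2 ⟨fun S => ?_, fun a w hw K hK ℓ => ?_⟩
  · refine continuousOn_finsetSum _ fun T _ => continuousOn_const.fun_mul ?_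
    refine (hc _).comp (f := fun w : Fin 1 → ℂ => update z p (w 0)) ?_
      fun w hw => (mem_sectionSet hDc hJ).1 hw
    exact (continuous_const.update p (continuous_apply 0)).continuousOn
  · obtain rfl : a = 0 := Subsingleton.elim _ _
    obtain rfl : K = ∅ := Finset.eq_empty_of_forall_notMem fun i hi =>
      hK (Subsingleton.elim i 0 ▸ hi)
    simp only [pairing_sectionStem, update_self]
    refine DifferentiableAt.fun_sum fun T hT => ?_
    have := hol _ ((mem_sectionSet hDc hJ).1 hw) T (Finset.mem_filter.1 hT).2
      (ℓ.comp (ContinuousLinearMap.mul ℝ ℍ[ℝ] (ordProd T J)))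
    simpa only [update_idem, update_self] using this

theorem sum_signOn_sectionStem {p : Fin n} {S : Finset (Fin n)} (hS : p ∉ S) (z : Fin n → ℂ)
    (G : StemMap n) (w : Fin 1 → ℂ) (R : Finset (Fin 1)) :
    ∑ E : Finset (Fin n), (∏ i ∈ S, signOn E i) •
        sectionStem p (fun i => signOn E i • iUnit) z G w R
      = (2 : ℝ) ^ n • (ordProd S (fun _ => iUnit) *
        G (update z p (w 0)) (if 0 ∈ R then insert p S else S)) := by
  have h := sum_signOn_ordProd (fun T => if p ∉ T then
    G (update z p (w 0)) (if 0 ∈ R then insert p T else T) else 0) (fun _ => iUnit) S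
  simp only [hS, not_false_eq_true, if_true, mul_ite, mul_zero, ← Finset.sum_filter] at h
  exact h

/-- The reverse passage: the sections for all sign choices of the fixed units determine the
components of G by the same character inversion as in `sum_signOn_ordProd`. -/
theorem pairing_eq_sum_sectionStem (ℓ : ℍ[ℝ] →L[ℝ] ℝ) {p : Fin n} {S : Finset (Fin n)}
    (hS : p ∉ S) (z : Fin n → ℂ) (G : StemMap n) (w : Fin 1 → ℂ) :
    pairing ℓ p G S (update z p (w 0)) = ∑ E : Finset (Fin n),
      ((((2 : ℝ) ^ n)⁻¹ * ∏ i ∈ S, signOn E i : ℝ) : ℂ) *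
        pairing (ℓ.comp (ContinuousLinearMap.mul ℝ ℍ[ℝ] (ordProd S fun _ => iUnit)⁻¹)) 0
          (sectionStem p (fun i => signOn E i • iUnit) z G) ∅ w := by
  have key : ∀ R : Finset (Fin 1),
      ℓ (G (update z p (w 0)) (if 0 ∈ R then insert p S else S)) = ∑ E : Finset (Fin n),
        (((2 : ℝ) ^ n)⁻¹ * ∏ i ∈ S, signOn E i) *
          ℓ ((ordProd S fun _ => iUnit)⁻¹ * sectionStem p (fun i => signOn E i • iUnit) z G w R) := by
    intro R
    have h := congrArg (fun q => ℓ ((ordProd S fun _ => iUnit)⁻¹ * ((2 : ℝ) ^ n)⁻¹ • q))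
      (sum_signOn_sectionStem hS z G w R)
    beta_reduce at h
    rw [smul_smul, inv_mul_cancel₀ (by positivity), one_smul, ← mul_assoc,
      inv_mul_cancel₀ (ordProd_ne_zero (fun _ => iUnit_mem) S), one_mul] at h
    rw [← h, Finset.smul_sum, Finset.mul_sum, map_sum]
    refine Finset.sum_congr rfl fun E _ => ?_
    rw [smul_smul, mul_smul_comm, map_smul, smul_eq_mul]
  apply Complex.ext
  · rw [Complex.re_sum]
    simpa [Complex.re_ofReal_mul, -Complex.ofReal_mul] using key ∅
  · rw [Complex.im_sum]
    simpa [Complex.im_ofReal_mul, -Complex.ofReal_mul] using key {0}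

theorem holIn_of_isSliceRegularIn {D : Set (Fin n → ℂ)} (hDc : ConjInvariant D) (hD : IsOpen D)
    {G : StemMap n} {g : (Fin n → ℍ[ℝ]) → ℍ[ℝ]} (hG : IsStem D G) (hg : Induces D G g)
    {p : Fin n} (hG0 : ∀ z ∈ D, ∀ T, (∃ i ∈ T, i < p) → G z T = 0)
    (hreg : IsSliceRegularIn D p g) : HolIn D p G := by
  intro z hz S hS ℓ
  have h1 : ∀ w : ℂ, pairing ℓ p G S (update z p w) = _ := fun w =>
    pairing_eq_sum_sectionStem ℓ hS z G (fun _ => w)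
  simp only [h1]
  refine DifferentiableAt.fun_sum fun E _ => DifferentiableAt.const_mul ?_ _
  have hJ : ∀ i, signOn E i • iUnit ∈ imUnits := signOn_smul_mem E iUnit_mem
  have h2 := ((isSliceRegular_iff (isOpen_sectionSet hDc hD p hJ z)
    (isStem_sectionStem hDc hG p hJ z) (induces_sectionStem hDc hg hG0 hJ z)).1
    (hreg.2 _ (slicePt_mem_circ hz hJ))).2 0 (fun _ => z p)
    ((mem_sectionSet hDc hJ).2 (by simpa using hz)) ∅ (Finset.notMem_empty _)
    (ℓ.comp (ContinuousLinearMap.mul ℝ ℍ[ℝ] (ordProd S fun _ => iUnit)⁻¹))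
  have e : ∀ w : ℂ, update (fun _ : Fin 1 => z p) 0 w = fun _ => w := by
    intro w; funext i; rw [Subsingleton.elim i 0, update_self]
  simpa only [e] using h2

theorem IsSliceRegular.exists_isSliceRegularIn {D : Set (Fin n → ℂ)} (hDc : ConjInvariant D)
    (hD : IsOpen D) {f : (Fin n → ℍ[ℝ]) → ℍ[ℝ]} (hf : IsSliceRegular D f) (H K : Finset (Fin n))
    {p : Fin n} (hp : IsLeast {i | i ∉ H} p) :
    ∃ g : (Fin n → ℍ[ℝ]) → ℍ[ℝ],
      Set.EqOn g (almansi D H K f) (circ (offReal D H)) ∧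
      (H.Nonempty → ContinuousOn g (circ D)) ∧ IsSliceRegularIn D p g := by
  have hreg := hf
  obtain ⟨F, hF, hFf, -⟩ := hf
  obtain ⟨hc, hh⟩ := (isSliceRegular_iff hD hF hFf).1 hreg
  obtain ⟨G, hG⟩ := exists_isDerivExt_varStem hDc hD hF hc hh H K
  exact ⟨inducedFn G, hG.eqOn_almansi hDc hF hFf,
    fun _ => continuousOn_inducedFn hDc hG.isStem hG.cont,
    isSliceRegularIn_of_holIn hDc hD hG.isStem (induces_inducedFn hDc hG.isStem)
      (fun z hz T hT => hG.eq_zero hD hz (not_disjoint_of_isLeast hp hT)) hG.cont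
      (hG.holIn hD hp.1 ((hh p).stemMul_varStem K))⟩

/-- The stem function of an extension of a component. -/
theorem eq_stemDeriv_of_eqOn_almansi {D : Set (Fin n → ℂ)} (hDc : ConjInvariant D)
    {F G : StemMap n} {f g : (Fin n → ℍ[ℝ]) → ℍ[ℝ]} (hF : IsStem D F) (hf : Induces D F f)
    (hg : Induces D G g) {H K : Finset (Fin n)}
    (h : Set.EqOn g (almansi D H K f) (circ (offReal D H))) :
    ∀ z ∈ offReal D H, G z = stemDeriv H (stemMul (varStem K) F) z :=
  stem_unique ((hg.mono (offReal_subset D H)).congr h) (induces_almansi hDc hF hf H K).2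

/-- As p ∉ H, the coefficients depend neither on z_p nor on whether p belongs to V, so the pairing
of F is a combination of pairings of the G_K with constants. -/
theorem HolIn.of_sum_recCoef {D : Set (Fin n → ℂ)} (hD : IsOpen D) {F : StemMap n}
    {H : Finset (Fin n)} {G : Finset (Fin n) → StemMap n} {p : Fin n} (hp : p ∉ H)
    (hG : ∀ K ⊆ H, HolIn D p (G K))
    (h : ∀ z ∈ D, ∀ V, ∑ K ∈ H.powerset, recCoef H K z V • G K z (V \ H) = F z V) :
    HolIn D p F := by
  refine HolIn.congr hD (F := fun z V => ∑ K ∈ H.powerset, recCoef H K z V • G K z (V \ H)) ?_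
    fun z hz => funext (h z hz)
  intro z hz V hV ℓ
  have h1 : ∀ w, pairing ℓ p (fun z V => ∑ K ∈ H.powerset, recCoef H K z V • G K z (V \ H)) V
      (update z p w) = ∑ K ∈ H.powerset, (recCoef H K z V : ℂ) *
        pairing ℓ p (G K) (V \ H) (update z p w) := by
    intro w
    have hne : ∀ i ∈ H, i ≠ p := fun i hi e => hp (e ▸ hi)
    have e1 : ∀ K ⊆ H, recCoef H K (update z p w) V = recCoef H K z V := by
      intro K _
      unfold recCoef
      congr 1
      refine Finset.prod_congr rfl fun i hi => ?_
      rw [update_of_ne (hne i (Finset.mem_sdiff.1 hi).1)]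
    have e2 : ∀ K ⊆ H, recCoef H K (update z p w) (insert p V) = recCoef H K z V := by
      intro K hK
      rw [← e1 K hK]
      unfold recCoef
      congr 1
      · refine Finset.prod_congr rfl fun i hi => ?_
        simp [hne i (hK hi)]
      · refine Finset.prod_congr rfl fun i hi => ?_
        simp [hne i (Finset.mem_sdiff.1 hi).1]
    have e3 : insert p V \ H = insert p (V \ H) := Finset.insert_sdiff_of_notMem _ hp
    apply Complex.ext
    · rw [pairing_re, Complex.re_sum, map_sum]
      refine Finset.sum_congr rfl fun K hK => ?_
      rw [e1 K (Finset.mem_powerset.1 hK), Complex.re_ofReal_mul, pairing_re, map_smul, smul_eq_mul]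
    · rw [pairing_im, Complex.im_sum, map_sum]
      refine Finset.sum_congr rfl fun K hK => ?_
      rw [e2 K (Finset.mem_powerset.1 hK), e3, Complex.im_ofReal_mul, pairing_im, map_smul,
        smul_eq_mul]
  simp only [h1]
  refine DifferentiableAt.fun_sum fun K hK => DifferentiableAt.const_mul ?_ _
  exact hG K (Finset.mem_powerset.1 hK) z hz _ (by simp [hV]) ℓ

/-- A stem map holomorphic in `z_a` and a continuous function, if equal off the real `z_a`, are
equal. -/
theorem HolIn.eqOn_of_offReal {D : Set (Fin n → ℂ)} (hD : IsOpen D) {F : StemMap n} {a : Fin n}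
    (hF : HolIn D a F) {R : (Fin n → ℂ) → ℍ[ℝ]} (hR : ContinuousOn R D) {V : Finset (Fin n)}
    (h : ∀ z ∈ offReal D {a}, F z V = R z) : ∀ z ∈ D, F z V = R z := by
  intro z hz
  by_cases him : (z a).im = 0
  swap
  · exact h z ⟨hz, by simpa using him⟩
  refine eq_of_forall_dual fun ℓ => ?_
  -- The point is approached in the direction of z_a only, where F is continuous by holomorphy;
  -- joint continuity of F is not available here.
  have hγ : Tendsto (fun t : ℝ => z a + t * Complex.I) (𝓝[>] 0) (𝓝 (z a)) := by
    have : Continuous (fun t : ℝ => z a + t * Complex.I) := by fun_prop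
    have h := this.tendsto 0
    simp only [Complex.ofReal_zero, zero_mul, add_zero] at h
    exact h.mono_left nhdsWithin_le_nhds
  have h1 := (hF.hasFDerivAt_form hz ℓ V).continuousAt.tendsto.comp hγ
  have hup : ContinuousAt (fun w => update z a w) (z a) :=
    (continuous_const.update a continuous_id).continuousAt
  have h2 : ContinuousAt (fun w => ℓ (R (update z a w))) (z a) := by
    refine ℓ.continuous.continuousAt.comp (ContinuousAt.comp (g := R) ?_ hup)
    rw [update_eq_self]
    exact hR.continuousAt (hD.mem_nhds hz)
  have h3 := h2.tendsto.comp hγ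
  rw [update_eq_self] at h1 h3
  refine tendsto_nhds_unique_of_eventuallyEq h1 h3 ?_
  have hmem : z a ∈ {w | update z a w ∈ D} := by simpa using hz
  filter_upwards [hγ.eventually ((isOpen_section hD a z).mem_nhds hmem), self_mem_nhdsWithin]
    with t ht ht0
  refine congrArg ℓ (h _ ⟨ht, fun i hi => ?_⟩)
  obtain rfl := Finset.mem_singleton.1 hi
  have ht0 : 0 < t := ht0
  simpa [him] using ht0.ne'

theorem HolIn.continuousOn_of_subsingleton {n : ℕ} {D : Set (Fin n → ℂ)} {F : StemMap n}
    {a : Fin n} (ha : ∀ i, i = a) (hF : HolIn D a F) (V : Finset (Fin n)) :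
    ContinuousOn (fun z => F z V) D := by
  rw [← contDiffOn_zero (𝕜 := ℝ)]
  refine contDiffOn_of_coord fun ℓ => ?_
  rw [contDiffOn_zero]
  intro z hz
  have h1 := (hF.hasFDerivAt_form hz ℓ V).continuousAt
  have h2 : ContinuousAt (fun z' : Fin n → ℂ => ℓ (F (update z a (z' a)) V)) z :=
    ContinuousAt.comp (f := fun z' : Fin n → ℂ => z' a) h1 (continuous_apply a).continuousAt
  have h3 : ∀ z' : Fin n → ℂ, update z a (z' a) = z' := fun z' => by
    funext i; rw [ha i, update_self]
  simp only [h3] at h2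
  exact h2.continuousWithinAt

theorem isLeast_Iio_compl (p : Fin n) : IsLeast {i | i ∉ Finset.Iio p} p :=
  ⟨by simp, fun i hi => by simpa using hi⟩

/-- Continuity is supplied only for nonempty H, so H = ∅ yields just the holomorphy of F in the
least variable. The continuity of F has to be won from the extensions before holomorphy in the other
variables can be carried over to the real points. -/
theorem isSliceRegular_of_forall {D : Set (Fin n → ℂ)} (hDc : ConjInvariant D)
    (hD : IsOpen D) {f : (Fin n → ℍ[ℝ]) → ℍ[ℝ]} (hf : IsSlice D f)
    (h : ∀ H K : Finset (Fin n), K ⊆ H → ∀ p, IsLeast {i | i ∉ H} p →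
      ∃ g : (Fin n → ℍ[ℝ]) → ℍ[ℝ],
        Set.EqOn g (almansi D H K f) (circ (offReal D H)) ∧
        (H.Nonempty → ContinuousOn g (circ D)) ∧ IsSliceRegularIn D p g) :
    IsSliceRegular D f := by
  obtain ⟨F, hF, hFf⟩ := hf
  have hempty : ∀ p : Fin n, (∀ i, p ≤ i) → HolIn D p F := by
    intro p hp
    obtain ⟨g, hg, -, hreg⟩ := h ∅ ∅ subset_rfl p ⟨by simp, fun i _ => hp i⟩
    obtain ⟨hG, hGg⟩ := stem_spec hreg.1
    have e := eq_stemDeriv_of_eqOn_almansi hDc hF hFf hGg hg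
    refine (holIn_of_isSliceRegularIn hDc hD hG hGg
      (fun z _ T hT => ?_) hreg).congr hD fun z hz => ?_
    · obtain ⟨i, _, hi⟩ := hT
      exact absurd (hp i) (not_le.2 hi)
    · rw [e z ⟨hz, by simp⟩, stemMul_varStem_empty]
      funext K
      simp [stemDeriv]
  have hext : ∀ H : Finset (Fin n), H.Nonempty → ∀ p, IsLeast {i | i ∉ H} p →
      ∃ G : Finset (Fin n) → StemMap n,
        ∀ K ⊆ H, IsDerivExt D H (stemMul (varStem K) F) (G K) ∧ HolIn D p (G K) := by
    intro H hH p hp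
    have : ∀ K : Finset (Fin n), ∃ G : StemMap n, K ⊆ H →
        IsDerivExt D H (stemMul (varStem K) F) G ∧ HolIn D p G := by
      intro K
      by_cases hK : K ⊆ H
      swap
      · exact ⟨0, fun h => absurd h hK⟩
      obtain ⟨g, hg, hgc, hreg⟩ := h H K hK p hp
      obtain ⟨hG, hGg⟩ := stem_spec hreg.1
      have hd : IsDerivExt D H (stemMul (varStem K) F) (stem D g) :=
        ⟨hG, hGg.continuousOn_stem (hgc hH), eq_stemDeriv_of_eqOn_almansi hDc hF hFf hGg hg⟩
      exact ⟨_, fun _ => ⟨hd, holIn_of_isSliceRegularIn hDc hD hG hGg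
        (fun z hz T hT => hd.eq_zero hD hz (not_disjoint_of_isLeast hp hT)) hreg⟩⟩
    choose G hG using this
    exact ⟨G, hG⟩
  have hc : ∀ V, ContinuousOn (fun z => F z V) D := by
    intro V
    -- With no variable D has at most one point, and with one variable holomorphy implies
    -- continuity. From two variables on, H = {0} is a proper subset: F agrees off real z_0 with a
    -- continuous combination of extensions, and by holomorphy in z_0 everywhere.
    obtain _ | _ | m := n
    · exact (continuous_of_const fun z z' => by rw [Subsingleton.elim z z']).continuousOn
    · exact (hempty 0 fun i => Fin.zero_le i).continuousOn_of_subsingleton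
        (fun i => Fin.fin_one_eq_zero i) V
    · obtain ⟨G, hG⟩ := hext {0} (Finset.singleton_nonempty 0) 1
        ⟨by simp, fun i hi => Fin.one_le_of_ne_zero (by simpa using hi)⟩
      have hR := continuousOn_sum_recCoef (fun K hK => (hG K hK).1.cont) V
      exact hR.congr ((hempty 0 fun i => Fin.zero_le i).eqOn_of_offReal hD hR fun z hz =>
        (sum_recCoef_smul_offReal (fun K hK => (hG K hK).1.eq) hz V).symm)
  refine (isSliceRegular_iff hD hF hFf).2 ⟨hc, fun p => ?_⟩
  -- The choice H = {i < p} makes p the least index outside H; for the least p this H is empty and f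
  -- itself is used.
  by_cases hH : (Finset.Iio p).Nonempty
  · obtain ⟨G, hG⟩ := hext _ hH p (isLeast_Iio_compl p)
    exact HolIn.of_sum_recCoef hD (isLeast_Iio_compl p).1 (fun K hK => (hG K hK).2)
      fun z hz V => sum_recCoef_smul_of_isDerivExt hD hc (fun K hK => (hG K hK).1) hz V
  · rw [Finset.not_nonempty_iff_eq_empty] at hH
    refine hempty p fun i => not_lt.1 fun hi => ?_
    have : i ∈ Finset.Iio p := Finset.mem_Iio.2 hi
    simp [hH] at this

end SliceAnalysis

/-! ### The statements that need no regularity -/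

namespace SliceAnalysis

variable {n : ℕ}

theorem eq_sum_almansi {D : Set (Fin n → ℂ)} (hD : ConjInvariant D)
    {f : (Fin n → ℍ[ℝ]) → ℍ[ℝ]} (hf : IsSlice D f) (H : Finset (Fin n)) {x : Fin n → ℍ[ℝ]}
    (hx : x ∈ circ (offReal D H)) :
    f x = ∑ K ∈ H.powerset, (-1 : ℝ) ^ (H \ K).card •
      sliceMul (offReal D H) (fun y => ordProd (H \ K) (fun i => star (y i)))
        (almansi D H K f) x := by
  obtain ⟨F, hF, hFf⟩ := hf
  exact decomposition_of_stem (hD.offReal H) (hFf.mono (offReal_subset D H))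
    (G := fun K => stemDeriv H (stemMul (varStem K) F))
    (fun K _ => (induces_almansi hD hF hFf H K).1)
    (fun K _ => (induces_almansi hD hF hFf H K).2)
    (fun K _ z _ T hT => stemDeriv_eq_zero _ z hT)
    (fun z hz V => sum_recCoef_smul H F hz.2 V) hx

theorem isCircularIn_almansi {D : Set (Fin n → ℂ)} (hD : ConjInvariant D)
    {f : (Fin n → ℍ[ℝ]) → ℍ[ℝ]} (hf : IsSlice D f) {H : Finset (Fin n)} (K : Finset (Fin n))
    {h : Fin n} (hh : h ∈ H) : IsCircularIn (offReal D H) h (almansi D H K f) := by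
  obtain ⟨F, hF, hFf⟩ := hf
  have hi := induces_almansi hD hF hFf H K
  exact isCircularIn_of_stem (hD.offReal H) hi.1 hi.2 fun z _ T hT =>
    stemDeriv_eq_zero _ z (Finset.not_disjoint_iff.2 ⟨h, hT, hh⟩)

theorem isSliceIn_almansi {D : Set (Fin n → ℂ)} (hD : ConjInvariant D)
    {f : (Fin n → ℍ[ℝ]) → ℍ[ℝ]} (hf : IsSlice D f) {H : Finset (Fin n)} (K : Finset (Fin n))
    {p : Fin n} (hp : IsLeast {i | i ∉ H} p) :
    IsSliceIn (offReal D H) p (almansi D H K f) := by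
  obtain ⟨F, hF, hFf⟩ := hf
  have hi := induces_almansi hD hF hFf H K
  exact isSliceIn_of_stem (hD.offReal H) hi.1 hi.2 fun z _ T hT =>
    stemDeriv_eq_zero _ z (not_disjoint_of_isLeast hp hT)

theorem isSlicePreserving_offReal_iff {D : Set (Fin n → ℂ)} (hD : ConjInvariant D)
    {f : (Fin n → ℍ[ℝ]) → ℍ[ℝ]} (hf : IsSlice D f) :
    IsSlicePreserving (offReal D Finset.univ) f ↔
      ∀ K : Finset (Fin n), ∀ x ∈ circ (offReal D Finset.univ),
        ∃ r : ℝ, almansi D Finset.univ K f x = (r : ℍ[ℝ]) := by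
  obtain ⟨F, hF, hFf⟩ := hf
  rw [isSlicePreserving_iff (hF.mono (offReal_subset D _)) (hFf.mono (offReal_subset D _)),
    real_iff_almansi_real hD hF hFf]

end SliceAnalysis

theorem theorem3p2 {n : ℕ} (D : Set (Fin n → ℂ)) (hD : ConjInvariant D)
    (f : (Fin n → ℍ[ℝ]) → ℍ[ℝ]) (hf : IsSlice D f) :
    -- (1) the decomposition
    (∀ H : Finset (Fin n), ∀ x ∈ circ (offReal D H),
      f x = ∑ K ∈ H.powerset, (-1 : ℝ) ^ (H \ K).card •
        sliceMul (offReal D H) (fun y => ordProd (H \ K) (fun i => star (y i)))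
          (almansi D H K f) x) ∧
    -- (2) circularity in the variables of `H`, sliceness in `x_p`
    (∀ H K : Finset (Fin n), K ⊆ H →
      (∀ h ∈ H, IsCircularIn (offReal D H) h (almansi D H K f)) ∧
      (∀ p, IsLeast {i | i ∉ H} p → IsSliceIn (offReal D H) p (almansi D H K f))) ∧
    -- (3) if `f` is slice regular, the components extend to `Ω_D`, where they are harmonic
    (IsOpen D → IsSliceRegular D f → ∀ H : Finset (Fin n),
      ∃ g : Finset (Fin n) → (Fin n → ℍ[ℝ]) → ℍ[ℝ],
        (∀ K ⊆ H,
          ContinuousOn (g K) (circ D) ∧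
          Set.EqOn (g K) (almansi D H K f) (circ (offReal D H)) ∧
          (∀ h ∈ H, IsCircularIn D h (g K)) ∧
          (∀ p, IsLeast {i | i ∉ H} p → IsSliceIn D p (g K)) ∧
          (∀ h ∈ H, IsHarmonicIn D h (g K))) ∧
        ∀ x ∈ circ D, f x = ∑ K ∈ H.powerset, (-1 : ℝ) ^ (H \ K).card •
          sliceMul D (fun y => ordProd (H \ K) (fun i => star (y i))) (g K) x) ∧
    -- (4) characterization of slice regularity
    (IsOpen D → (IsSliceRegular D f ↔
      ∀ H K : Finset (Fin n), K ⊆ H → ∀ p, IsLeast {i | i ∉ H} p →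
        ∃ g : (Fin n → ℍ[ℝ]) → ℍ[ℝ],
          Set.EqOn g (almansi D H K f) (circ (offReal D H)) ∧
          (H.Nonempty → ContinuousOn g (circ D)) ∧
          IsSliceRegularIn D p g)) ∧
    -- (5) characterization of slice preservingness
    (IsSlicePreserving (offReal D Finset.univ) f ↔
      ∀ K : Finset (Fin n), ∀ x ∈ circ (offReal D Finset.univ),
        ∃ r : ℝ, almansi D Finset.univ K f x = (r : ℍ[ℝ])) ∧
    (D ⊆ closure (offReal D Finset.univ) → ContinuousOn f (circ D) →
      (IsSlicePreserving D f ↔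
        ∀ K : Finset (Fin n), ∀ x ∈ circ (offReal D Finset.univ),
          ∃ r : ℝ, almansi D Finset.univ K f x = (r : ℍ[ℝ]))) := by
  refine ⟨fun H x hx => eq_sum_almansi hD hf H hx,
    fun H K _ => ⟨fun h hh => isCircularIn_almansi hD hf K hh,
      fun p hp => isSliceIn_almansi hD hf K hp⟩,
    fun hDo hreg H => hreg.exists_extension hD hDo H,
    fun hDo => ⟨fun hreg H K _ p hp => hreg.exists_isSliceRegularIn hD hDo H K hp,
      isSliceRegular_of_forall hD hDo hf⟩,
    isSlicePreserving_offReal_iff hD hf, fun hd hc => ?_⟩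
  obtain ⟨F, hF, hFf⟩ := hf
  rw [isSlicePreserving_iff_of_dense hF hFf hc hd]
  exact isSlicePreserving_offReal_iff hD ⟨F, hF, hFf⟩
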